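/- Let $\kappa$ be an algebraically closed field with the trivial valuation, and let $G=(V,E)$ be a finite simple 3-regular, three-connected planar graph of genus $g=\#E-\#V+1$. Fix a planar embedding of $G$ (an embedding in the sphere, given combinatorially by a rotation system with $\#V-\#E+\#\text{faces}=2$, together with an outer face). A vertex is exterior if it lies on the outer face, and interior otherwise. Let $x_F$ be variables indexed by the $g$ interior faces $F$, and identify $\mathbb{P}^{g-1}$ with $\operatorname{Proj}\kappa[x_F]$. For an exterior vertex $v$ let $L_v$ be the ideal generated by the $x_F$ with $F$ not incident to $v$; for an interior vertex $v$ let $L_v$ be generated by the $x_F$ with $F$ not incident to $v$ and by $\sum_{F\ni v}x_F$. The schön line arrangement is the arrangement of the $2g-2$ lines defined by the $L_v$; its ideal is $I_{\rm sch}=\bigcap_v L_v$. Tropical projective space is $\mathbb{TP}^{g-1}=\big((\mathbb{R}\cup\{\infty\})^g\setminus\{(\infty,\dots,\infty)\}\big)/\mathbb{R}(1,\dots,1)$ with the quotient topology. The tropicalization $\operatorname{trop}(I)$ of a graded ideal $I$ is the set of $w\in\mathbb{TP}^{g-1}$ such that, for every homogeneous $f\in I$, the minimum of the $w$-weights of the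 monomials of $f$ is $\infty$ or is attained at least twice. A tropical line is the tropicalization of the ideal of a line in $\mathbb{P}^{g-1}$. A modification of $G$ is a space obtained from a geometric realization of $G$ by gluing finitely many (possibly no) finite metric trees to points of it. A tropical graph curve associated to $G$ is an arrangement of $2g-2$ tropical lines in $\mathbb{TP}^{g-1}$ whose union is homeomorphic to a modification of $G$. The graph curve $X_G$ over $\kappa$ consists of one $\mathbb{P}^1$ for each vertex, with one simple node for each edge $uv$, joining the components of $u$ and $v$, the three nodes on each component being distinct. Sections of its canonical bundle are families of differentials on the components with at most simple poles at the nodes and with opposite residues on the two branches at each node. A canonical embedding of $X_G$ is an embedding into $\mathbb{P}^{g-1}$ given by a basis of these sections; it has a weakly faithful tropicalization if the tropicalization of its homogeneous ideal is a tropical graph curve associated to $G$. Then: 1. For every choice of nodes, the schön line arrangement is the image of a canonical embedding of $X_G$, with the component of $v$ mapping onto the line $L_v$, for every $v$. 2. $\operatorname{trop}(I_{\rm sch})=\bigcup_v\operatorname{trop}(L_v)$, where the $\operatorname{trop}(L_v)$ are $2g-2$ distinct tropical lines, and $\operatorname{trop}(I_{\rm sch})$ is a tropical graph curve associated to $G$;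 in particular it is homeomorphic to a modification of $G$. That is, the schön embedding of $X_G$ has a weakly faithful tropicalization. 3. This tropicalization is well structured: there is a homeomorphism from a modification of $G$ to $\operatorname{trop}(I_{\rm sch})$ that takes every interior vertex $v$ to the branch point of $\operatorname{trop}(L_v)$ (the common point of its branches, where the branch labelled by two faces $F,F'$ incident to $v$ consists of the points at which the minimal coordinate is attained at both $F$ and $F'$), and every exterior vertex $v$ to the point $\operatorname{trop}(L_v)\cap\operatorname{trop}(L_u)$, where $u$ is the unique interior vertex adjacent to $v$. 4. Consequently, every 3-regular, three-connected planar graph $G$ has a tropical graph curve associated to it, and $X_G$ has a canonical embedding with a weakly faithful tropicalization. -/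

import Mathlib

namespace TropGraph

/-! ### Tropical projective space and tropicalization -/

section Tropical

variable {ι : Type*}

/-- The set `(ℝ ∪ {∞})^ι ∖ {(∞, …, ∞)}`. -/
abbrev TropVec (ι : Type*) : Type _ := {w : ι → WithTop ℝ // ∃ i, w i ≠ ⊤}

/-- Two vectors are equivalent when they differ by a tropical scalar `c ∈ ℝ`, that is, by adding
`c` to all coordinates. -/
def tropSetoid (ι : Type*) : Setoid (TropVec ι) where
  r w w' := ∃ c : ℝ, ∀ i, w'.1 i = w.1 i + (c : WithTop ℝ)
  iseqv :=
    { refl := fun w => ⟨0, fun i => by simp⟩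
      symm := by
        rintro w w' ⟨c, hc⟩
        refine ⟨-c, fun i => ?_⟩
        rw [hc i, add_assoc, ← WithTop.coe_add]
        simp
      trans := by
        rintro w w' w'' ⟨c, hc⟩ ⟨d, hd⟩
        refine ⟨c + d, fun i => ?_⟩
        rw [hd i, hc i, add_assoc, ← WithTop.coe_add] }

/-- Tropical projective space with coordinates indexed by `ι`: the quotient of
`(ℝ ∪ {∞})^ι ∖ {(∞, …, ∞)}` by tropical scalars. It compactifies `ℝ^ι / ℝ (1, …, 1)` by the
coordinate hyperplanes at infinity. -/
def TP (ι : Type*) : Type _ := Quotient (tropSetoid ι)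

/-- The Euclidean topology on tropical projective space (the quotient topology; `ℝ ∪ {∞}` carries
its order topology). -/
instance : TopologicalSpace (TP ι) :=
  inferInstanceAs (TopologicalSpace (Quotient (tropSetoid ι)))

/-- The point of tropical projective space with homogeneous coordinates `w`. -/
def TP.mk (w : TropVec ι) : TP ι := Quotient.mk (tropSetoid ι) w

variable {κ : Type*} [Field κ]

/-- The `w`-weight `∑ i, α i * w i` of the monomial with exponent `α`; it is `∞` when a variable of
infinite weight divides the monomial. -/
noncomputable def weight (w : ι → WithTop ℝ) (α : ι →₀ ℕ) : WithTop ℝ :=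
  α.sum fun i n => n • w i

/-- Tropical vanishing of `f` at `w`, for the trivial valuation on `κ` (all nonzero coefficients
have valuation `0`): the minimum of the weights of the monomials of `f` is `∞` or is attained at
least twice. -/
def TropVanishes (f : MvPolynomial ι κ) (w : ι → WithTop ℝ) : Prop :=
  ∀ α ∈ f.support, weight w α ≠ ⊤ → (∀ β ∈ f.support, weight w α ≤ weight w β) →
    ∃ β ∈ f.support, β ≠ α ∧ weight w β = weight w α

/-- The tropicalization of a homogeneous polynomial into tropical projective space. If `f = m * g`
with `m` a monomial, it consists of the hyperplanes at infinity of the variables dividing `m`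
together with the tropicalization of `g`. -/
def tropHypersurface (f : MvPolynomial ι κ) : Set (TP ι) :=
  {p | ∀ w : TropVec ι, TP.mk w = p → TropVanishes f w.1}

/-- The tropicalization of a graded ideal into tropical projective space: the intersection of the
tropicalizations of its homogeneous elements. -/
def tropProj (I : Ideal (MvPolynomial ι κ)) : Set (TP ι) :=
  {p | ∀ f ∈ I, ∀ n : ℕ, f.IsHomogeneous n → p ∈ tropHypersurface f}

variable (κ) in
/-- A tropical line: the tropicalization of the defining ideal of a line of `ℙ(κ^ι)`, i.e. of a
two-dimensional linear subspace of `κ^ι`. -/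
def IsTropicalLine (S : Set (TP ι)) : Prop :=
  ∃ W : Submodule κ (ι → κ), Module.finrank κ W = 2 ∧
    S = tropProj (MvPolynomial.vanishingIdeal κ (W : Set (ι → κ)))

end Tropical

/-! ### Graphs: genus, connectivity, geometric realizations and modifications -/

section Graphs

/-- The genus (first Betti number) `#E - #V + 1` of a connected graph. -/
noncomputable def genus {V : Type*} (G : SimpleGraph V) : ℕ :=
  Nat.card G.edgeSet + 1 - Nat.card V

/-- Three-(vertex-)connectedness: there are at least four vertices, and deleting at most two
vertices leaves a connected graph. -/
def ThreeConnected {V : Type*} (G : SimpleGraph V) : Prop :=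
  4 ≤ Nat.card V ∧ ∀ S : Finset V, S.card ≤ 2 → (G.induce ((S : Set V)ᶜ)).Connected

/-- The geometric realization of a finite simple graph: the union of the edges in the simplex on
the vertex set. As only its homeomorphism type matters below, all edges may be given the same
length. -/
def realization {V : Type*} [Fintype V] (G : SimpleGraph V) : Set (V → ℝ) :=
  {x | x ∈ stdSimplex ℝ V ∧ ∃ u v, (u = v ∨ G.Adj u v) ∧ ∀ w, w ≠ u → w ≠ v → x w = 0}

/-- A vertex as a point of the geometric realization. -/
noncomputable def vertexPoint {V : Type*} [Fintype V] [DecidableEq V] (G : SimpleGraph V) (v : V) :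
    realization G :=
  ⟨Pi.single v 1, single_mem_stdSimplex ℝ v, v, v, Or.inl rfl,
    fun _ hw _ => Pi.single_eq_of_ne hw 1⟩

/-- The data of a modification of `G`: finitely many finite trees, each with a point `root i` that
is to be glued to the point `base i` of the geometric realization of `G`. There may be no tree. -/
structure Modification {V : Type*} [Fintype V] (G : SimpleGraph V) where
  num : ℕ
  size : Fin num → ℕ
  tree : ∀ i, SimpleGraph (Fin (size i))
  isTree : ∀ i, (tree i).IsTree
  base : Fin num → realization G
  root : ∀ i, realization (tree i)

namespace Modification

variable {V : Type*} [Fintype V] {G : SimpleGraph V} (N : Modification G)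

/-- The gluing relation: the root of each tree is identified with its base point. -/
inductive Glue : realization G ⊕ (Σ i, realization (N.tree i)) →
    realization G ⊕ (Σ i, realization (N.tree i)) → Prop
  | glue (i : Fin N.num) : Glue (Sum.inl (N.base i)) (Sum.inr ⟨i, N.root i⟩)

/-- The topological space underlying the modification, with the quotient topology. -/
abbrev Space : Type _ := Quot N.Glue

/-- A vertex of `G` as a point of the modification. -/
noncomputable def vertex [DecidableEq V] (v : V) : N.Space :=
  Quot.mk _ (Sum.inl (vertexPoint G v))

end Modification

/-- `S` is a tropical graph curve associated to `G`, of genus `g`: an arrangement of `2g - 2`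
(distinct) tropical lines in `TP^{g-1}` that is homeomorphic to a modification of `G`. -/
def IsTropicalGraphCurve (κ : Type*) [Field κ] {V : Type*} [Fintype V] (G : SimpleGraph V)
    {ι : Type*} (S : Set (TP ι)) : Prop :=
  Nat.card ι = genus G ∧
  (∃ T : Fin (2 * genus G - 2) → Set (TP ι), Function.Injective T ∧
    (∀ i, IsTropicalLine κ (T i)) ∧ S = ⋃ i, T i) ∧
  ∃ N : Modification G, Nonempty (N.Space ≃ₜ S)

end Graphs

/-! ### Planar embeddings -/

section Planar

variable {V : Type*}

/-- A rotation system: a cyclic order of the darts (oriented edges) leaving each vertex. It is the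
combinatorial form of an embedding of a connected graph into a closed oriented surface. -/
structure RotationSystem (G : SimpleGraph V) where
  rot : Equiv.Perm G.Dart
  rot_fst : ∀ d, (rot d).fst = d.fst
  rot_cyclic : ∀ d d' : G.Dart, d.fst = d'.fst → rot.SameCycle d d'

namespace RotationSystem

variable {G : SimpleGraph V} (R : RotationSystem G)

/-- The face permutation: traverse a dart, then leave its end point along the next dart. -/
def facePerm : Equiv.Perm G.Dart :=
  (Function.Involutive.toPerm _ (SimpleGraph.Dart.symm_involutive (G := G))).trans R.rot

/-- The faces are the closed walks traced by the face permutation. -/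
def Face : Type _ := Quotient (Equiv.Perm.SameCycle.setoid R.facePerm)

/-- The face that has the dart `d` on its boundary walk. -/
def faceOf (d : G.Dart) : R.Face := Quotient.mk (Equiv.Perm.SameCycle.setoid R.facePerm) d

/-- The vertex `v` lies on the boundary of the face `F`. -/
def Incident (v : V) (F : R.Face) : Prop := ∃ d : G.Dart, d.fst = v ∧ R.faceOf d = F

instance [Finite V] : Finite R.Face := by
  have : Finite G.Dart :=
    Finite.of_injective (fun d : G.Dart => d.toProd) SimpleGraph.Dart.toProd_injective
  exact inferInstanceAs (Finite (Quotient (Equiv.Perm.SameCycle.setoid R.facePerm)))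

end RotationSystem

/-- An embedding of a finite connected graph into the sphere, in combinatorial form: a rotation
system with Euler characteristic `#V - #E + #F = 2`. Together with the choice of a face as the outer
face it is a planar embedding. -/
structure PlanarEmbedding (G : SimpleGraph V) extends RotationSystem G where
  euler : Nat.card V + Nat.card toRotationSystem.Face = Nat.card G.edgeSet + 2

namespace PlanarEmbedding

variable {G : SimpleGraph V} (M : PlanarEmbedding G)

/-- The faces of the embedding. -/
abbrev Face : Type _ := M.toRotationSystem.Face

/-- The interior faces, with respect to the outer face `o`. -/
abbrev IntFace (o : M.Face) : Type _ := {F : M.Face // F ≠ o}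

/-- An exterior vertex is a vertex on the outer face; the other vertices are interior. -/
def Exterior (o : M.Face) (v : V) : Prop := M.Incident v o

noncomputable instance [Finite V] (o : M.Face) : Fintype (M.IntFace o) := Fintype.ofFinite _

end PlanarEmbedding

end Planar

/-! ### The schön line arrangement -/

section Schon

variable {V : Type*} [Finite V] {G : SimpleGraph V}
variable (κ : Type*) [Field κ] (M : PlanarEmbedding G) (o : M.Face)

open Classical in
/-- The ideal `L_v` of the line of the schön arrangement belonging to the vertex `v`, in the
polynomial ring with one variable for each interior face. It is generated by the variables of the
interior faces not incident to `v` and, if `v` is an interior vertex, the sum of the variables of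
the faces incident to `v`. -/
noncomputable def lineIdeal (v : V) : Ideal (MvPolynomial (M.IntFace o) κ) :=
  Ideal.span
    ({f | ∃ F : M.IntFace o, ¬ M.Incident v F.1 ∧ f = MvPolynomial.X F} ∪
     {f | ¬ M.Exterior o v ∧
        f = ∑ F : M.IntFace o, if M.Incident v F.1 then MvPolynomial.X F else 0})

/-- The defining ideal of the schön line arrangement. -/
noncomputable def schonIdeal : Ideal (MvPolynomial (M.IntFace o) κ) := ⨅ v, lineIdeal κ M o v

/-- The tropicalization of the schön line arrangement. -/
def tropSchon : Set (TP (M.IntFace o)) := tropProj (schonIdeal κ M o)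

/-- The tropical line of the vertex `v`. -/
def tropLine (v : V) : Set (TP (M.IntFace o)) := tropProj (lineIdeal κ M o v)

/-- The branch of the tropical line of `v` labelled by the pair `F, F'`: the points of the line at
which the minimum of the coordinates is attained at `F` and at `F'`. -/
def branch (v : V) (F F' : M.IntFace o) : Set (TP (M.IntFace o)) :=
  {p | p ∈ tropLine κ M o v ∧ ∀ w : TropVec (M.IntFace o), TP.mk w = p →
    w.1 F = w.1 F' ∧ ∀ F'', w.1 F ≤ w.1 F''}

/-- `p` is the branch point of the tropical line of `v`: the unique common point of the branches
labelled by the pairs of faces incident to `v`. -/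
def IsBranchPoint (v : V) (p : TP (M.IntFace o)) : Prop :=
  {q | ∀ F F' : M.IntFace o, F ≠ F' → M.Incident v F.1 → M.Incident v F'.1 →
    q ∈ branch κ M o v F F'} = {p}

end Schon

/-- The tropicalization of the schön arrangement is well structured: there is a homeomorphism from a
modification of `G` to it that takes every interior vertex `v` to the branch point of the tropical
line of `v`, and every exterior vertex `v` to the intersection of the tropical lines of `v` and `u`,
where `u` is the unique interior vertex adjacent to `v`. -/
def IsWellStructured {V : Type*} [Fintype V] [DecidableEq V] {G : SimpleGraph V}
    (κ : Type*) [Field κ] (M : PlanarEmbedding G) (o : M.Face) : Prop :=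
  ∃ (N : Modification G) (h : N.Space ≃ₜ tropSchon κ M o),
    (∀ v, ¬ M.Exterior o v → IsBranchPoint κ M o v (h (N.vertex v))) ∧
    (∀ v, M.Exterior o v → ∃ u, (G.Adj v u ∧ ¬ M.Exterior o u) ∧
      (∀ u', G.Adj v u' → ¬ M.Exterior o u' → u' = u) ∧
      tropLine κ M o v ∩ tropLine κ M o u = {(h (N.vertex v) : TP (M.IntFace o))})

/-! ### Graph curves and their canonical embeddings -/

section GraphCurves

/-- The determinant of two vectors of `κ²`. -/
def bracket {κ : Type*} [Field κ] (p q : Fin 2 → κ) : κ := p 0 * q 1 - p 1 * q 0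

/-- The two vectors span the same line, i.e. (if nonzero) are homogeneous coordinates of the same
point of projective space. -/
def SameProj (κ : Type*) [Field κ] {ι : Type*} (x y : ι → κ) : Prop :=
  Submodule.span κ {x} = Submodule.span κ {y}

/-- A graph curve with dual graph `G`: one copy of `ℙ¹` for each vertex `v` and, for each edge
`vu`, a node gluing the point `node v u` of the component of `v` (given by homogeneous coordinates)
to the point `node u v` of the component of `u`. The nodes on each component are distinct. Only the
values of `node` at adjacent pairs matter. -/
structure GraphCurve (κ : Type*) [Field κ] {V : Type*} (G : SimpleGraph V) where
  node : V → V → Fin 2 → κ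
  node_ne_zero : ∀ v u, G.Adj v u → node v u ≠ 0
  node_distinct : ∀ v u w, G.Adj v u → G.Adj v w → u ≠ w → bracket (node v u) (node v w) ≠ 0

namespace GraphCurve

variable {κ : Type*} [Field κ] {V : Type*} [Fintype V] [DecidableEq V] {G : SimpleGraph V}
  [DecidableRel G.Adj] (X : GraphCurve κ G)

/-- The points with homogeneous coordinates `q` on the component of `v` and `q'` on the component
of `u` are the same point of the curve. -/
def SamePoint (v : V) (q : Fin 2 → κ) (u : V) (q' : Fin 2 → κ) : Prop :=
  (v = u ∧ SameProj κ q q') ∨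
    (G.Adj v u ∧ SameProj κ q (X.node v u) ∧ SameProj κ q' (X.node u v))

/-- For a 3-regular graph, the differentials on the component of `v` with at most simple poles at
its three nodes `p₁, p₂, p₃`, and no other poles, are
`ℓ(q) (q₀ dq₁ - q₁ dq₀) / ([p₁, q] [p₂, q] [p₃, q])` for a linear form `ℓ` on `κ²`, with `[ , ]` the
bracket. This is the residue of that differential at `node v u`. -/
noncomputable def residue (ℓ : Module.Dual κ (Fin 2 → κ)) (v u : V) : κ :=
  ℓ (X.node v u) / ∏ w ∈ (G.neighborFinset v).erase u, bracket (X.node v w) (X.node v u)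

/-- The global sections of the dualizing sheaf (canonical bundle) of a graph curve of a 3-regular
graph: a differential on each component with at most simple poles at the nodes, such that the two
residues at each node add up to zero. -/
noncomputable def canonicalSections : Submodule κ (V → Module.Dual κ (Fin 2 → κ)) where
  carrier := {s | ∀ v u, G.Adj v u → X.residue (s v) v u + X.residue (s u) u v = 0}
  zero_mem' := by
    intro v u _
    simp [residue]
  add_mem' := by
    intro s t hs ht v u h
    have h1 := hs v u h
    have h2 := ht v u h
    simp only [residue, Pi.add_apply, LinearMap.add_apply, add_div] at h1 h2 ⊢
    linear_combination h1 + h2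
  smul_mem' := by
    intro c s hs v u h
    have h1 := hs v u h
    simp only [residue, Pi.smul_apply, LinearMap.smul_apply, smul_eq_mul, mul_div_assoc] at h1 ⊢
    linear_combination c * h1

variable {ι : Type*}

/-- The canonical map of the curve given by a basis of the sections of the canonical bundle, on the
component of `v` and in homogeneous coordinates: the basis sections, in the trivialization of the
canonical bundle on the component described above, are the coordinates of the map. -/
noncomputable def canonicalMap (b : Module.Basis ι κ X.canonicalSections) (v : V) :
    (Fin 2 → κ) →ₗ[κ] (ι → κ) :=
  LinearMap.pi fun i => (b i).1 v

/-- The canonical map is an embedding: it is defined everywhere, and two points have the same image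
exactly if they are the same point of the curve. (The components are then embedded as distinct lines,
so that the two branches at every node have distinct tangent directions and the canonical map is a
closed immersion.) -/
def IsCanonicalEmbedding (b : Module.Basis ι κ X.canonicalSections) : Prop :=
  (∀ v q, q ≠ 0 → X.canonicalMap b v q ≠ 0) ∧
  ∀ v q u q', q ≠ 0 → q' ≠ 0 →
    (SameProj κ (X.canonicalMap b v q) (X.canonicalMap b u q') ↔ X.SamePoint v q u q')

/-- The homogeneous ideal of the image of the component of `v`. -/
noncomputable def componentIdeal (b : Module.Basis ι κ X.canonicalSections) (v : V) :
    Ideal (MvPolynomial ι κ) :=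
  MvPolynomial.vanishingIdeal κ (Set.range (X.canonicalMap b v))

/-- The homogeneous ideal of the image of the whole curve. -/
noncomputable def imageIdeal (b : Module.Basis ι κ X.canonicalSections) :
    Ideal (MvPolynomial ι κ) :=
  MvPolynomial.vanishingIdeal κ (⋃ v, Set.range (X.canonicalMap b v))

/-- The canonical embedding given by the basis `b` has a weakly faithful tropicalization: its
tropicalization (for the trivial valuation) is a tropical graph curve associated to `G`. -/
def IsWeaklyFaithful (b : Module.Basis ι κ X.canonicalSections) : Prop :=
  IsTropicalGraphCurve κ G (tropProj (X.imageIdeal b))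

end GraphCurve

end GraphCurves

end TropGraph

/-! The tropicalization of the schön arrangement is homeomorphic to `G` itself, so the modification
is the one without trees, and every section of the canonical bundle is read off from its residues.

*Faces.* All the combinatorics rests on a duality (`exists_jump_eq`): since the graph and its dual
are connected and the Euler characteristic is `2`, the flows on the edges are the combinations of
the boundaries of the faces, and the antisymmetric functions with circulation zero around all the
faces are the potential differences, over any field. If an edge had the same face on both sides, or
two edges separated the same two faces, the second fact would turn them into an edge cut with at
most two edges, which a three-connected cubic graph does not have (`eq_of_forall_adj_ne`). Hence the
three faces at a vertex are distinct, two faces share at most one edge, and a vertex is determined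
by its faces.

*The canonical embedding.* On a component with three nodes the linear forms correspond to the
triples of residues with sum zero, so the canonical sections are the flows with coefficients in `κ`.
The boundaries of the interior faces form a basis (`GraphCurve.exists_basis`). In this basis the
node of an edge is the difference of the unit vectors of its two faces, the one of the outer face
being dropped. Hence the component of `v` is mapped isomorphically onto the line of `v`, and two
lines meet only in the node of a common edge. That the line ideals are full vanishing ideals follows
by eliminating variables (`eq_vanishingIdeal_of_retraction`).

*The tropical lines.* A polynomial in the ideal of a line vanishes tropically where the linear
generators do, as one sees by restricting it to a suitable parametrization of the line and comparing
coefficients (`tropVanishes_of_aeval_eq_zero`). Products of linear forms show that the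
tropicalization of the arrangement is the union of the tropical lines (`tropSchon_eq_iUnion`).

*The homeomorphism.* In the exponential coordinates `y = exp (-w)`, normalized to maximum `1`, the
tropical line of an interior vertex consists of the vectors supported on its three faces and equal
to `1` on two of them; the line of an exterior vertex consists of the vectors supported on its two
interior faces. The map `PlanarEmbedding.height` is continuous on the geometric realization of `G`
and sends a vertex to the indicator function of its interior faces. For an edge, it is `1` on the
faces at the edge, and the value on the third face at an end point is a parameter along the edge.
The combinatorics of the faces shows that it is injective with the arrangement as its image, and a
continuous bijection from a compact space to a Hausdorff space is a homeomorphism. -/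

namespace TropGraph

/-! ### Duality between flows and potentials -/

section Duality

variable {D E X Y K : Type*} [Field K]

/-- The functions on the darts that change sign when a dart is reversed by `σ`. -/
def antisymm (K : Type*) [Field K] (σ : D → D) : Submodule K (D → K) where
  carrier := {φ | ∀ d, φ (σ d) = -φ d}
  zero_mem' := fun d => by simp
  add_mem' := fun {φ ψ} h k d => by simp only [Pi.add_apply, h d, k d]; ring
  smul_mem' := fun c φ h d => by simp only [Pi.smul_apply, h d, smul_eq_mul]; ring

/-- The total value of a function on the darts attached to each `x` under the labelling `s` of the
darts. For `s` the initial vertex it is the divergence, for `s` the face it is the circulation. -/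
def total (K : Type*) [Field K] [Fintype D] [DecidableEq X] (s : D → X) :
    (D → K) →ₗ[K] (X → K) where
  toFun φ x := ∑ d with s d = x, φ d
  map_add' φ ψ := by ext x; simp [Finset.sum_add_distrib]
  map_smul' c φ := by ext x; simp [Finset.mul_sum]

/-- The difference of a function on labels across each dart. -/
def jump (K : Type*) [Field K] (σ : D → D) (t : D → Y) : (Y → K) →ₗ[K] (D → K) where
  toFun c d := c (t d) - c (t (σ d))
  map_add' c c' := by ext d; simp only [Pi.add_apply]; ring
  map_smul' a c := by ext d; simp only [Pi.smul_apply, smul_eq_mul, RingHom.id_apply]; ring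

/-- The labels are linked by the darts: a function that agrees on the two ends of every dart is
constant. -/
def Linked (K : Type*) (σ : D → D) (s : D → X) : Prop :=
  ∀ c : X → K, (∀ d, c (s d) = c (s (σ d))) → ∀ x y, c x = c y

/-- The antisymmetric function that is `1` on the dart `d`, `-1` on the reversed dart and `0`
elsewhere. -/
def dartFun (K : Type*) [Field K] [DecidableEq D] (σ : D → D) (d : D) : D → K :=
  Pi.single d 1 - Pi.single (σ d) 1

theorem dartFun_mem_antisymm [DecidableEq D] {σ : D → D} (hσ : Function.Involutive σ) (d : D) :
    dartFun K σ d ∈ antisymm K σ := by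
  intro d'
  have e1 : (σ d' = d) ↔ (d' = σ d) := ⟨fun h => by rw [← h, hσ], fun h => by rw [h, hσ]⟩
  have e2 : (σ d' = σ d) ↔ (d' = d) := hσ.injective.eq_iff
  simp only [dartFun, Pi.sub_apply, Pi.single_apply, e1, e2]
  ring

theorem total_dartFun [Fintype D] [DecidableEq D] [DecidableEq X] (σ : D → D) (s : D → X) (d : D) :
    total K s (dartFun K σ d) = Pi.single (s d) 1 - Pi.single (s (σ d)) 1 := by
  ext x
  simp [total, dartFun, Finset.sum_sub_distrib, Pi.single_apply, Finset.sum_ite_eq', eq_comm]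

/-- A jump has zero totals for `s` if going around the permutation `π` within the fibres of `s`
passes from the label of each dart to the label of its reversed dart. -/
theorem total_jump_eq_zero [Fintype D] [DecidableEq X] {σ : D → D} {s : D → X} {t : D → Y}
    (π : Equiv.Perm D) (hs : ∀ d, s (π d) = s d) (ht : ∀ d, t (π d) = t (σ d)) (c : Y → K) :
    total K s (jump K σ t c) = 0 := by
  ext x
  have : ∑ d with s d = x, c (t (π d)) = ∑ d with s d = x, c (t d) :=
    Finset.sum_equiv π (fun d => by simp [hs]) (fun d _ => rfl)
  simp only [ht] at this
  simp [total, jump, Finset.sum_sub_distrib, this]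

theorem card_le_finrank_total_add_one [Fintype D] [DecidableEq D] [Fintype X] [DecidableEq X]
    {σ : D → D} (hσ : Function.Involutive σ) {s : D → X} (hs : Linked K σ s) :
    Fintype.card X ≤
      Module.finrank K (LinearMap.range ((total K s).domRestrict (antisymm K σ))) + 1 := by
  rcases isEmpty_or_nonempty X with hX | ⟨⟨x₀⟩⟩
  · simp
  set R := LinearMap.range ((total K s).domRestrict (antisymm K σ)) with hR
  have h1 := Subspace.finrank_add_finrank_dualAnnihilator_eq R
  rw [Module.finrank_fintype_fun_eq_card] at h1
  let ev : R.dualAnnihilator →ₗ[K] K :=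
    (LinearMap.applyₗ (Pi.single x₀ (1 : K))).comp R.dualAnnihilator.subtype
  have hev : Function.Injective ev := by
    refine (injective_iff_map_eq_zero _).2 ?_
    rintro ⟨f, hf⟩ h0
    replace h0 : f (Pi.single x₀ 1) = 0 := h0
    have hc : ∀ d, f (Pi.single (s d) 1) = f (Pi.single (s (σ d)) 1) := by
      intro d
      have hr : Pi.single (s d) 1 - Pi.single (s (σ d)) 1 ∈ R :=
        ⟨⟨_, dartFun_mem_antisymm hσ d⟩, total_dartFun σ s d⟩
      have := (Submodule.mem_dualAnnihilator f).1 hf _ hr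
      rw [map_sub, sub_eq_zero] at this
      exact this
    have hz := hs (fun x => f (Pi.single x 1)) hc
    have : f = 0 := by
      apply LinearMap.pi_ext'
      intro x
      ext
      simpa [h0] using hz x x₀
    simpa using this
  have h2 := LinearMap.finrank_le_finrank_of_injective hev
  rw [Module.finrank_self] at h2
  omega

theorem card_le_finrank_jump_add_one [Fintype D] [Fintype Y] {σ : D → D} {t : D → Y}
    (ht : Linked K σ t) :
    Fintype.card Y ≤ Module.finrank K (LinearMap.range (jump K σ t)) + 1 := by
  rcases isEmpty_or_nonempty Y with hY | ⟨⟨y₀⟩⟩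
  · simp
  have h1 := LinearMap.finrank_range_add_finrank_ker (jump K σ t)
  rw [Module.finrank_fintype_fun_eq_card] at h1
  let ev : LinearMap.ker (jump K σ t) →ₗ[K] K :=
    (LinearMap.proj y₀).comp (LinearMap.ker (jump K σ t)).subtype
  have hev : Function.Injective ev := by
    refine (injective_iff_map_eq_zero _).2 ?_
    rintro ⟨c, hc⟩ h0
    replace h0 : c y₀ = 0 := h0
    have hz := ht c (fun d => sub_eq_zero.1 (congrFun hc d))
    have : c = 0 := by
      ext y
      rw [hz y y₀, h0, Pi.zero_apply]
    simpa using this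
  have h2 := LinearMap.finrank_le_finrank_of_injective hev
  rw [Module.finrank_self] at h2
  omega

/-- If two labellings `s` and `t` of the darts are linked, the jumps of `t` have zero totals for `s`
and the Euler characteristic `#X - #E + #Y` is `2`, then every antisymmetric function with zero
totals for `s` is a jump of `t`: both spaces have dimension `#Y - 1`. -/
theorem exists_jump_eq [Fintype D] [DecidableEq D] [Fintype E] [Fintype X] [DecidableEq X]
    [Fintype Y] {σ : D → D} (hσ : Function.Involutive σ) {s : D → X} {t : D → Y} (p : E → D)
    (hp : ∀ d, ∃ e, d = p e ∨ d = σ (p e)) (hs : Linked K σ s) (ht : Linked K σ t)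
    (hcard : Fintype.card X + Fintype.card Y = Fintype.card E + 2)
    (hst : ∀ c, total K s (jump K σ t c) = 0)
    {φ : D → K} (hφ : ∀ d, φ (σ d) = -φ d) (h0 : total K s φ = 0) :
    ∃ c, jump K σ t c = φ := by
  have hA : Module.finrank K (antisymm K σ) ≤ Fintype.card E := by
    rw [← Module.finrank_fintype_fun_eq_card K]
    refine LinearMap.finrank_le_finrank_of_injective
      (f := (LinearMap.funLeft K K p).comp (antisymm K σ).subtype) ?_
    refine (injective_iff_map_eq_zero _).2 ?_
    rintro ⟨ψ, hψ⟩ h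
    have h' : ∀ e, ψ (p e) = 0 := fun e => congrFun h e
    have : ψ = 0 := by
      ext d
      obtain ⟨e, rfl | rfl⟩ := hp d
      · exact h' e
      · rw [hψ, h', neg_zero, Pi.zero_apply]
    simpa using this
  have h1 := LinearMap.finrank_range_add_finrank_ker ((total K s).domRestrict (antisymm K σ))
  have h2 := card_le_finrank_total_add_one hσ hs
  have h3 := card_le_finrank_jump_add_one ht
  set Z := (LinearMap.ker ((total K s).domRestrict (antisymm K σ))).map (antisymm K σ).subtype
    with hZ
  have hZr : Module.finrank K Z =
      Module.finrank K (LinearMap.ker ((total K s).domRestrict (antisymm K σ))) :=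
    Submodule.finrank_map_subtype_eq _ _
  have hle : LinearMap.range (jump K σ t) ≤ Z := by
    rintro _ ⟨c, rfl⟩
    refine ⟨⟨jump K σ t c, fun d => ?_⟩, hst c, rfl⟩
    simp [jump, hσ d]
  have heq := Submodule.eq_of_le_of_finrank_le hle (by omega)
  have : φ ∈ Z := ⟨⟨φ, hφ⟩, h0, rfl⟩
  rw [← heq] at this
  exact this

end Duality

/-! ### Cubic three-connected graphs -/

section Cubic

variable {V : Type*} [Fintype V] [DecidableEq V] {G : SimpleGraph V} [DecidableRel G.Adj]

theorem exists_adj_ne_ne (hreg : G.IsRegularOfDegree 3) (v p q : V) :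
    ∃ x, G.Adj v x ∧ x ≠ p ∧ x ≠ q := by
  by_contra! h
  have hsub : G.neighborFinset v ⊆ {p, q} := by
    intro x hx
    rw [SimpleGraph.mem_neighborFinset] at hx
    by_cases hp : x = p
    · simp [hp]
    · simp [h x hx hp]
  have h1 := Finset.card_le_card hsub
  have h2 : (G.neighborFinset v).card = 3 := hreg v
  have h3 := Finset.card_le_two (a := p) (b := q)
  omega

omit [Fintype V] [DecidableEq V] [DecidableRel G.Adj] in
theorem eq_of_forall_adj_notMem {K : Type*} (hconn : ThreeConnected G) (f : V → K)
    (S : Finset V) (hS : S.card ≤ 2)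
    (hf : ∀ u w, u ∉ S → w ∉ S → G.Adj u w → f u = f w) {u w : V} (hu : u ∉ S) (hw : w ∉ S) :
    f u = f w := by
  obtain ⟨p⟩ := (hconn.2 S hS).preconnected ⟨u, by simpa using hu⟩ ⟨w, by simpa using hw⟩
  have key : ∀ (a b : ((S : Set V)ᶜ : Set V)), (G.induce ((S : Set V)ᶜ)).Walk a b →
      f a = f b := by
    intro a b p
    induction p with
    | nil => rfl
    | @cons a b _ h _ ih => exact (hf _ _ a.2 b.2 h).trans ih
  exact key _ _ p

omit [Fintype V] [DecidableEq V] [DecidableRel G.Adj] in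
theorem linked_fst (K : Type*) (hconn : ThreeConnected G) :
    Linked K SimpleGraph.Dart.symm (fun d : G.Dart => d.fst) := by
  intro c hc x y
  exact eq_of_forall_adj_notMem hconn c ∅ (by simp) (fun u w _ _ h => hc ⟨(u, w), h⟩)
    (by simp) (by simp)

/-- A function on the vertices that is constant along all edges but two is constant: a
three-connected cubic graph has no edge cut with at most two edges. -/
theorem eq_of_forall_adj_ne {K : Type*} (hreg : G.IsRegularOfDegree 3) (hconn : ThreeConnected G)
    (f : V → K) (a b a' b' : V)
    (hf : ∀ u w, G.Adj u w → s(u, w) ≠ s(a, b) → s(u, w) ≠ s(a', b') → f u = f w) (u w : V) :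
    f u = f w := by
  have main : ∀ a b a' b' : V,
      (∀ u w, G.Adj u w → s(u, w) ≠ s(a, b) → s(u, w) ≠ s(a', b') → f u = f w) →
      ∀ y, y ≠ a → y ≠ a' → f a = f y := by
    intro a b a' b' hf y hy hy'
    -- a neighbour of `a` outside `{a, a'}` that is reached along an unexceptional edge
    obtain ⟨x, hx, hxb, hx'⟩ := exists_adj_ne_ne hreg a b (if a = a' then b' else a')
    have hxa : x ≠ a := hx.ne'
    have hxa' : x ≠ a' := by
      split_ifs at hx' with h
      · rw [← h]; exact hxa
      · exact hx'
    have h1 : f a = f x := by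
      apply hf a x hx
      · simp [hxb, hxa]
      · rw [Ne, Sym2.eq_iff]
        rintro (⟨h, h'⟩ | ⟨-, h⟩)
        · rw [if_pos h] at hx'
          exact hx' h'
        · exact hxa' h
    rw [h1]
    refine eq_of_forall_adj_notMem hconn f {a, a'} Finset.card_le_two ?_ (by simp [hxa, hxa'])
      (by simp [hy, hy'])
    intro p q hp hq hpq
    simp only [Finset.mem_insert, Finset.mem_singleton, not_or] at hp hq
    apply hf p q hpq
    · rw [Ne, Sym2.eq_iff]
      rintro (⟨h, -⟩ | ⟨-, h⟩)
      exacts [hp.1 h, hq.1 h]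
    · rw [Ne, Sym2.eq_iff]
      rintro (⟨h, -⟩ | ⟨-, h⟩)
      exacts [hp.2 h, hq.2 h]
  have m1 := main a b a' b' hf
  have m2 := main a' b' a b (fun u w h h1 h2 => hf u w h h2 h1)
  obtain ⟨y, hy⟩ : ∃ y, y ∉ ({a, a'} : Finset V) := by
    by_contra! h
    have h4 := hconn.1
    rw [Nat.card_eq_fintype_card, ← Finset.card_univ] at h4
    have := (Finset.card_le_card (fun y _ => h y : (Finset.univ : Finset V) ⊆ {a, a'})).trans
      Finset.card_le_two
    omega
  simp only [Finset.mem_insert, Finset.mem_singleton, not_or] at hy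
  have all : ∀ z, f z = f y := by
    intro z
    by_cases h : z = a
    · rw [h]; exact m1 y hy.1 hy.2
    by_cases h' : z = a'
    · rw [h']; exact m2 y hy.2 hy.1
    rw [← m1 z h h', m1 y hy.1 hy.2]
  rw [all u, all w]

end Cubic

/-! ### Rotation systems of cubic graphs -/

namespace RotationSystem

section Rot

variable {V : Type*} {G : SimpleGraph V} (R : RotationSystem G)

theorem facePerm_apply (d : G.Dart) : R.facePerm d = R.rot d.symm := rfl

theorem faceOf_facePerm (d : G.Dart) : R.faceOf (R.facePerm d) = R.faceOf d :=
  Quotient.sound (s := Equiv.Perm.SameCycle.setoid R.facePerm)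
    (Equiv.Perm.sameCycle_apply_left.2 (Equiv.Perm.SameCycle.refl _ _))

/-- The face on the other side of a dart is the face of the next dart. -/
theorem faceOf_symm (d : G.Dart) : R.faceOf d.symm = R.faceOf (R.rot d) := by
  rw [← R.faceOf_facePerm d.symm, facePerm_apply, SimpleGraph.Dart.symm_symm]

theorem eq_of_fst_eq {K : Type*} {h : G.Dart → K} (hh : ∀ d, h (R.rot d) = h d) {d d' : G.Dart}
    (hd : d.fst = d'.fst) : h d = h d' := by
  obtain ⟨k, hk⟩ := R.rot_cyclic d d' hd
  have key : ∀ k : ℤ, ∀ d, h ((R.rot ^ k) d) = h d := by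
    intro k
    induction k using Int.induction_on with
    | zero => simp
    | succ n ih => intro d; rw [add_comm, zpow_one_add, Equiv.Perm.mul_apply, hh, ih]
    | pred n ih =>
      intro d
      rw [sub_eq_neg_add, zpow_add, zpow_neg_one, Equiv.Perm.mul_apply, ← hh,
        ← Equiv.Perm.mul_apply, mul_inv_cancel, Equiv.Perm.one_apply, ih]
  rw [← hk, key]

theorem incident_fst (d : G.Dart) : R.Incident d.fst (R.faceOf d) := ⟨d, rfl, rfl⟩

theorem incident_fst_symm (d : G.Dart) : R.Incident d.fst (R.faceOf d.symm) :=
  ⟨R.rot d, R.rot_fst d, (R.faceOf_symm d).symm⟩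

theorem incident_snd (d : G.Dart) : R.Incident d.snd (R.faceOf d) := by
  simpa using R.incident_fst_symm d.symm

theorem incident_snd_symm (d : G.Dart) : R.Incident d.snd (R.faceOf d.symm) :=
  R.incident_fst d.symm

variable [Fintype V] [DecidableEq V] [DecidableRel G.Adj]

theorem linked_faceOf (K : Type*) (hreg : G.IsRegularOfDegree 3) (hconn : ThreeConnected G) :
    Linked K SimpleGraph.Dart.symm R.faceOf := by
  intro c hc
  have hrot : ∀ d, c (R.faceOf (R.rot d)) = c (R.faceOf d) := fun d => by
    rw [hc d, faceOf_symm]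
  have hex : ∀ v, ∃ d : G.Dart, d.fst = v := fun v => by
    obtain ⟨x, hx, -⟩ := exists_adj_ne_ne hreg v v v
    exact ⟨⟨(v, x), hx⟩, rfl⟩
  choose D hD using hex
  have key : ∀ d, c (R.faceOf d) = c (R.faceOf (D d.fst)) := fun d =>
    R.eq_of_fst_eq (h := fun d => c (R.faceOf d)) hrot (hD _).symm
  have hconst := linked_fst K hconn (fun v => c (R.faceOf (D v))) (fun d => by
    change c (R.faceOf (D d.fst)) = c (R.faceOf (D d.symm.fst))
    rw [← key, ← key, hc])
  intro x y
  induction x using Quotient.inductionOn with | _ d =>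
  induction y using Quotient.inductionOn with | _ d' =>
  exact (key d).trans ((hconst _ _).trans (key d').symm)

variable (hreg : G.IsRegularOfDegree 3)
include hreg

/-- In a cubic graph the rotation has order three and is transitive at every vertex. -/
theorem rot_aux (d : G.Dart) : R.rot d ≠ d ∧ R.rot (R.rot d) ≠ d ∧
    R.rot (R.rot (R.rot d)) = d ∧
    ∀ d' : G.Dart, d'.fst = d.fst → d' = d ∨ d' = R.rot d ∨ d' = R.rot (R.rot d) := by
  set S := Finset.univ.filter fun d' : G.Dart => d'.fst = d.fst with hS
  have hcard : S.card = 3 := (G.dart_fst_fiber_card_eq_degree d.fst).trans (hreg d.fst)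
  -- a subset of the fibre that contains `d` and is closed under rotation is everything
  have hclosed : ∀ T : Finset G.Dart, d ∈ T → (∀ e, R.rot e ∈ T ↔ e ∈ T) → S ⊆ T := by
    intro T hd hT d' hd'
    have hd'' : d'.fst = d.fst := by simpa [hS] using hd'
    have := R.eq_of_fst_eq (h := fun e => (e ∈ T)) (fun e => propext (hT e)) hd''
    exact this ▸ hd
  have hsize : ∀ T : Finset G.Dart, d ∈ T → (∀ e, R.rot e ∈ T ↔ e ∈ T) → 3 ≤ T.card :=
    fun T h1 h2 => hcard ▸ Finset.card_le_card (hclosed T h1 h2)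
  have h1 : R.rot d ≠ d := by
    intro h
    have := hsize {d} (by simp) (fun e => by
      have : R.rot e = d ↔ e = d := by
        conv_lhs => rw [← h]
        exact R.rot.injective.eq_iff
      simpa using this)
    simp at this
  have h2 : R.rot (R.rot d) ≠ d := by
    intro h
    have := hsize {d, R.rot d} (by simp) (fun e => by
      have e1 : R.rot e = d ↔ e = R.rot d := by
        conv_lhs => rw [← h]
        exact R.rot.injective.eq_iff
      have e2 : R.rot e = R.rot d ↔ e = d := R.rot.injective.eq_iff
      simp only [Finset.mem_insert, Finset.mem_singleton, e1, e2]
      exact or_comm)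
    have := this.trans Finset.card_le_two
    omega
  have h21 : R.rot (R.rot d) ≠ R.rot d := fun h => h1 (R.rot.injective h)
  have hsub : ({d, R.rot d, R.rot (R.rot d)} : Finset G.Dart) ⊆ S := by
    intro e he
    simp only [Finset.mem_insert, Finset.mem_singleton] at he
    rcases he with rfl | rfl | rfl <;> simp [hS, R.rot_fst]
  have hT : ({d, R.rot d, R.rot (R.rot d)} : Finset G.Dart) = S := by
    apply Finset.eq_of_subset_of_card_le hsub
    rw [hcard, Finset.card_eq_three.2 ⟨_, _, _, h1.symm, h2.symm, h21.symm, rfl⟩]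
  have hmem : ∀ d' : G.Dart, d'.fst = d.fst →
      d' = d ∨ d' = R.rot d ∨ d' = R.rot (R.rot d) := by
    intro d' hd'
    have : d' ∈ S := by simp [hS, hd']
    rw [← hT] at this
    simpa using this
  refine ⟨h1, h2, ?_, hmem⟩
  rcases hmem (R.rot (R.rot (R.rot d))) (by simp only [R.rot_fst]) with h | h | h
  · exact h
  · exact absurd (R.rot.injective h) h2
  · exact absurd (R.rot.injective h) h21

theorem rot_ne (d : G.Dart) : R.rot d ≠ d := (R.rot_aux hreg d).1

theorem rot_rot_ne (d : G.Dart) : R.rot (R.rot d) ≠ d := (R.rot_aux hreg d).2.1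

theorem rot_rot_rot (d : G.Dart) : R.rot (R.rot (R.rot d)) = d := (R.rot_aux hreg d).2.2.1

theorem eq_rot_of_fst_eq {d d' : G.Dart} (h : d'.fst = d.fst) :
    d' = d ∨ d' = R.rot d ∨ d' = R.rot (R.rot d) := (R.rot_aux hreg d).2.2.2 d' h

theorem incident_iff (d : G.Dart) (F : R.Face) : R.Incident d.fst F ↔
    F = R.faceOf d ∨ F = R.faceOf (R.rot d) ∨ F = R.faceOf (R.rot (R.rot d)) := by
  constructor
  · rintro ⟨d', h, rfl⟩
    rcases R.eq_rot_of_fst_eq hreg h with rfl | rfl | rfl <;> simp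
  · rintro (rfl | rfl | rfl)
    · exact ⟨_, rfl, rfl⟩
    · exact ⟨_, R.rot_fst _, rfl⟩
    · exact ⟨_, by simp only [R.rot_fst], rfl⟩

/-- Two faces at a vertex are separated by an edge at this vertex. -/
theorem exists_dart_of_incident {v : V} {L F : R.Face} (hL : R.Incident v L)
    (hF : R.Incident v F) (hne : L ≠ F) :
    ∃ d : G.Dart, d.fst = v ∧ ((R.faceOf d = L ∧ R.faceOf d.symm = F) ∨
      (R.faceOf d = F ∧ R.faceOf d.symm = L)) := by
  obtain ⟨a, rfl, rfl⟩ := hL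
  rcases (R.incident_iff hreg a F).1 hF with rfl | rfl | rfl
  · exact absurd rfl hne
  · exact ⟨a, rfl, Or.inl ⟨rfl, R.faceOf_symm a⟩⟩
  · refine ⟨R.rot (R.rot a), by simp only [R.rot_fst], Or.inr ⟨rfl, ?_⟩⟩
    rw [faceOf_symm, R.rot_rot_rot hreg]

end Rot

end RotationSystem

/-! ### Faces of three-connected cubic planar graphs -/

namespace PlanarEmbedding

variable {V : Type*} [Fintype V] [DecidableEq V] {G : SimpleGraph V} [DecidableRel G.Adj]
  (M : PlanarEmbedding G) (hreg : G.IsRegularOfDegree 3) (hconn : ThreeConnected G)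
include hreg hconn

noncomputable instance : Fintype M.Face := Fintype.ofFinite _

noncomputable instance : DecidableEq M.Face := Classical.decEq _

omit [Fintype V] [DecidableEq V] [DecidableRel G.Adj] hreg hconn in
theorem exists_section : ∃ p : G.edgeSet → G.Dart, ∀ d, ∃ e, d = p e ∨ d = (p e).symm := by
  have h : ∀ e : G.edgeSet, ∃ d : G.Dart, d.edge = e.1 := by
    rintro ⟨e, he⟩
    induction e using Sym2.ind with | _ x y =>
    exact ⟨⟨(x, y), he⟩, rfl⟩
  choose p hp using h
  refine ⟨p, fun d => ⟨⟨d.edge, d.edge_mem⟩, ?_⟩⟩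
  have := hp ⟨d.edge, d.edge_mem⟩
  exact (SimpleGraph.dart_edge_eq_iff _ _).1 this.symm

omit [DecidableEq V] hreg hconn in
theorem euler_card : Fintype.card V + Fintype.card M.Face = Fintype.card G.edgeSet + 2 := by
  simpa only [Nat.card_eq_fintype_card] using M.euler

/-- Every flow with coefficients in `K` is a combination of the boundaries of the faces. -/
theorem exists_jump_faceOf_eq (K : Type*) [Field K] {φ : G.Dart → K}
    (hφ : ∀ d, φ d.symm = -φ d) (h0 : total K (fun d : G.Dart => d.fst) φ = 0) :
    ∃ c, jump K SimpleGraph.Dart.symm M.faceOf c = φ := by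
  obtain ⟨p, hp⟩ := exists_section (G := G)
  exact exists_jump_eq SimpleGraph.Dart.symm_involutive p hp (linked_fst K hconn)
    (M.linked_faceOf K hreg hconn) M.euler_card
    (total_jump_eq_zero M.rot M.rot_fst fun d => (M.faceOf_symm d).symm) hφ h0

/-- An antisymmetric function with circulation zero around every face is a potential difference. -/
theorem exists_jump_fst_eq (K : Type*) [Field K] {φ : G.Dart → K}
    (hφ : ∀ d, φ d.symm = -φ d) (h0 : total K M.faceOf φ = 0) :
    ∃ c, jump K SimpleGraph.Dart.symm (fun d : G.Dart => d.fst) c = φ := by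
  obtain ⟨p, hp⟩ := exists_section (G := G)
  exact exists_jump_eq SimpleGraph.Dart.symm_involutive p hp (M.linked_faceOf K hreg hconn)
    (linked_fst K hconn) (by rw [add_comm, M.euler_card])
    (total_jump_eq_zero M.facePerm M.faceOf_facePerm fun d => M.rot_fst d.symm) hφ h0

/-- An antisymmetric function supported on two edges that has circulation zero around every face
vanishes, for otherwise these edges would be a cut. -/
theorem eq_zero_of_total_faceOf_eq_zero {φ : G.Dart → ℚ}
    (hφ : ∀ d, φ d.symm = -φ d) (h0 : total ℚ M.faceOf φ = 0) (d d' : G.Dart)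
    (hsupp : ∀ e : G.Dart, e.edge ≠ d.edge → e.edge ≠ d'.edge → φ e = 0) : φ = 0 := by
  obtain ⟨f, rfl⟩ := M.exists_jump_fst_eq hreg hconn ℚ hφ h0
  have := eq_of_forall_adj_ne hreg hconn f d.fst d.snd d'.fst d'.snd (fun u w h h1 h2 =>
    sub_eq_zero.1 (hsupp ⟨(u, w), h⟩ h1 h2))
  ext e
  exact sub_eq_zero.2 (this _ _)

omit [Fintype V] [DecidableRel G.Adj] hreg hconn in
theorem dartFun_eq_zero_of_edge_ne {d e : G.Dart} (h : e.edge ≠ d.edge) :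
    dartFun ℚ SimpleGraph.Dart.symm d e = 0 := by
  have h1 : e ≠ d := fun h' => h (by rw [h'])
  have h2 : e ≠ d.symm := fun h' => h (by rw [h', SimpleGraph.Dart.edge_symm])
  simp [dartFun, h1, h2]

/-- The two sides of an edge are different faces. -/
theorem faceOf_ne_faceOf_symm (d : G.Dart) : M.faceOf d ≠ M.faceOf d.symm := by
  intro h
  have h0 := M.eq_zero_of_total_faceOf_eq_zero hreg hconn
    (φ := dartFun ℚ SimpleGraph.Dart.symm d)
    (dartFun_mem_antisymm SimpleGraph.Dart.symm_involutive d)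
    (by rw [total_dartFun, h, sub_self]) d d (fun e h1 _ => dartFun_eq_zero_of_edge_ne h1)
  have := congrFun h0 d
  simp [dartFun, d.symm_ne.symm] at this

/-- Two faces have at most one edge in common. -/
theorem dart_eq_of_faceOf_eq {d d' : G.Dart} (h : M.faceOf d = M.faceOf d')
    (h' : M.faceOf d.symm = M.faceOf d'.symm) : d = d' := by
  have h0 := M.eq_zero_of_total_faceOf_eq_zero hreg hconn
    (φ := dartFun ℚ SimpleGraph.Dart.symm d - dartFun ℚ SimpleGraph.Dart.symm d')
    ((antisymm ℚ SimpleGraph.Dart.symm).sub_mem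
      (dartFun_mem_antisymm SimpleGraph.Dart.symm_involutive d)
      (dartFun_mem_antisymm SimpleGraph.Dart.symm_involutive d'))
    (by rw [map_sub, total_dartFun, total_dartFun, h, h', sub_self]) d d' (fun e h1 h2 => by
      rw [Pi.sub_apply, dartFun_eq_zero_of_edge_ne h1, dartFun_eq_zero_of_edge_ne h2, sub_self])
  have := congrFun h0 d
  by_contra hne
  simp only [dartFun, Pi.sub_apply, Pi.single_apply, d.symm_ne.symm, hne, if_true, if_false,
    Pi.zero_apply] at this
  split_ifs at this <;> norm_num at this

theorem faceOf_rot_ne (d : G.Dart) : M.faceOf (M.rot d) ≠ M.faceOf d := by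
  rw [← M.faceOf_symm]
  exact (M.faceOf_ne_faceOf_symm hreg hconn d).symm

theorem faceOf_rot_rot_ne (d : G.Dart) : M.faceOf (M.rot (M.rot d)) ≠ M.faceOf d := by
  have := M.faceOf_rot_ne hreg hconn (M.rot (M.rot d))
  rw [M.rot_rot_rot hreg] at this
  exact this.symm

/-- Different vertices on two common faces are joined by the edge between these faces. -/
theorem exists_dart_of_incident_incident {u v : V} (huv : u ≠ v) {L F : M.Face} (hne : L ≠ F)
    (huL : M.Incident u L) (huF : M.Incident u F) (hvL : M.Incident v L) (hvF : M.Incident v F) :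
    ∃ d : G.Dart, d.fst = u ∧ d.snd = v ∧ ((M.faceOf d = L ∧ M.faceOf d.symm = F) ∨
      (M.faceOf d = F ∧ M.faceOf d.symm = L)) := by
  obtain ⟨d, hd, h⟩ := M.exists_dart_of_incident hreg huL huF hne
  obtain ⟨d', hd', h'⟩ := M.exists_dart_of_incident hreg hvL hvF hne
  refine ⟨d, hd, ?_, h⟩
  have hdd : d ≠ d' := fun e => huv (by rw [← hd, ← hd', e])
  have : d = d'.symm := by
    rcases h with ⟨h1, h2⟩ | ⟨h1, h2⟩ <;> rcases h' with ⟨h3, h4⟩ | ⟨h3, h4⟩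
    · exact absurd (M.dart_eq_of_faceOf_eq hreg hconn (h1.trans h3.symm) (h2.trans h4.symm)) hdd
    · exact M.dart_eq_of_faceOf_eq hreg hconn (h1.trans h4.symm)
        (by rw [SimpleGraph.Dart.symm_symm]; exact h2.trans h3.symm)
    · exact M.dart_eq_of_faceOf_eq hreg hconn (h1.trans h4.symm)
        (by rw [SimpleGraph.Dart.symm_symm]; exact h2.trans h3.symm)
    · exact absurd (M.dart_eq_of_faceOf_eq hreg hconn (h1.trans h3.symm) (h2.trans h4.symm)) hdd
  rw [this]
  exact hd'

/-- A vertex is determined by its three faces. -/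
theorem eq_of_incident (d : G.Dart) {v : V} (h1 : M.Incident v (M.faceOf d))
    (h2 : M.Incident v (M.faceOf (M.rot d))) (h3 : M.Incident v (M.faceOf (M.rot (M.rot d)))) :
    d.fst = v := by
  by_contra huv
  obtain ⟨e, he, he', hf⟩ := M.exists_dart_of_incident_incident hreg hconn huv
    (M.faceOf_rot_ne hreg hconn d).symm (M.incident_fst d)
    ((M.incident_iff hreg d _).2 (by simp)) h1 h2
  obtain ⟨e', hee, hee', hf'⟩ := M.exists_dart_of_incident_incident hreg hconn huv
    (M.faceOf_rot_ne hreg hconn (M.rot d)).symm ((M.incident_iff hreg d _).2 (by simp))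
    ((M.incident_iff hreg d _).2 (by simp)) h2 h3
  have : e = e' := by
    apply SimpleGraph.Dart.toProd_injective
    exact Prod.ext (he.trans hee.symm) (he'.trans hee'.symm)
  subst this
  have n1 := M.faceOf_rot_rot_ne hreg hconn d
  have n2 := M.faceOf_rot_ne hreg hconn d
  have n3 := M.faceOf_rot_ne hreg hconn (M.rot d)
  rcases hf with ⟨a, b⟩ | ⟨a, b⟩ <;> rcases hf' with ⟨a', b'⟩ | ⟨a', b'⟩
  · exact n2 (a'.symm.trans a)
  · exact n1 (a'.symm.trans a)
  · exact n1 (b'.symm.trans b)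
  · exact n2 (b'.symm.trans b)

/-- An edge between two exterior vertices lies on the outer face. -/
theorem outer_of_exterior {o : M.Face} (d : G.Dart) (h1 : M.Exterior o d.fst)
    (h2 : M.Exterior o d.snd) : o = M.faceOf d ∨ o = M.faceOf d.symm := by
  rcases (M.incident_iff hreg d o).1 h1 with h | h | h
  · exact Or.inl h
  · exact Or.inr (by rw [M.faceOf_symm]; exact h)
  · have := M.eq_of_incident hreg hconn d (M.incident_snd d)
      (by rw [← M.faceOf_symm]; exact M.incident_snd_symm d) (h ▸ h2)
    exact absurd this d.adj.ne

end PlanarEmbedding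

/-! ### Tropical vanishing -/

section TropVanishing

variable {ι κ : Type*} [Field κ]

theorem TP.mk_eq_mk_iff {w w' : TropVec ι} :
    TP.mk w = TP.mk w' ↔ ∃ c : ℝ, ∀ i, w'.1 i = w.1 i + (c : WithTop ℝ) :=
  ⟨fun h => Quotient.exact (s := tropSetoid ι) h, fun h => Quotient.sound (s := tropSetoid ι) h⟩

theorem TP.exists_mk (p : TP ι) : ∃ w, TP.mk w = p := by
  induction p using Quotient.inductionOn with | _ w => exact ⟨w, rfl⟩

theorem tropProj_anti {I J : Ideal (MvPolynomial ι κ)} (h : I ≤ J) : tropProj J ⊆ tropProj I :=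
  fun _ hp f hf n hn => hp f (h hf) n hn

theorem weight_add (w : ι → WithTop ℝ) (α β : ι →₀ ℕ) :
    weight w (α + β) = weight w α + weight w β :=
  Finsupp.sum_add_index' (fun i => by simp) (fun i a b => add_nsmul _ _ _)

theorem weight_single (w : ι → WithTop ℝ) (i : ι) : weight w (Finsupp.single i 1) = w i := by
  simp [weight]

theorem nsmul_top_withTop {n : ℕ} (hn : n ≠ 0) : n • (⊤ : WithTop ℝ) = ⊤ := by
  obtain ⟨m, rfl⟩ := Nat.exists_eq_succ_of_ne_zero hn
  rw [succ_nsmul, WithTop.add_top]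

theorem weight_eq_top {w : ι → WithTop ℝ} {α : ι →₀ ℕ} {i : ι} (hi : w i = ⊤) (hα : α i ≠ 0) :
    weight w α = ⊤ := by
  classical
  rw [weight, Finsupp.sum, ← Finset.add_sum_erase _ _ (Finsupp.mem_support_iff.2 hα), hi,
    nsmul_top_withTop hα, WithTop.top_add]

/-- A polynomial does not vanish tropically at `w` when it has a monomial of finite weight whose
weight is less than those of all the other monomials. -/
theorem not_tropVanishes_iff {f : MvPolynomial ι κ} {w : ι → WithTop ℝ} :
    ¬ TropVanishes f w ↔ ∃ α ∈ f.support, weight w α ≠ ⊤ ∧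
      ∀ β ∈ f.support, β ≠ α → weight w α < weight w β := by
  unfold TropVanishes
  push Not
  constructor
  · rintro ⟨α, hα, hw, hmin, hne⟩
    exact ⟨α, hα, hw, fun β hβ h => lt_of_le_of_ne (hmin β hβ) (hne β hβ h).symm⟩
  · rintro ⟨α, hα, hw, h⟩
    refine ⟨α, hα, hw, fun β hβ => ?_, fun β hβ hne => (h β hβ hne).ne'⟩
    by_cases hβα : β = α
    · rw [hβα]
    · exact (h β hβ hβα).le

theorem add_lt_add_withTop {a b a' b' : WithTop ℝ} (ha : a ≠ ⊤) (hb : b ≠ ⊤) (h : a ≤ a')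
    (h' : b ≤ b') (hne : a < a' ∨ b < b') : a + b < a' + b' := by
  rcases hne with h1 | h1
  · exact (WithTop.add_lt_add_right hb h1).trans_le (by gcongr)
  · exact (WithTop.add_lt_add_left ha h1).trans_le (by gcongr)

/-- The tropical vanishing locus of a product is contained in the union of those of the factors. -/
theorem not_tropVanishes_mul {f g : MvPolynomial ι κ} {w : ι → WithTop ℝ}
    (hf : ¬ TropVanishes f w) (hg : ¬ TropVanishes g w) : ¬ TropVanishes (f * g) w := by
  classical
  rw [not_tropVanishes_iff] at *
  obtain ⟨α, hα, hαw, hαm⟩ := hf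
  obtain ⟨β, hβ, hβw, hβm⟩ := hg
  have hlt : ∀ α' ∈ f.support, ∀ β' ∈ g.support, (α', β') ≠ (α, β) →
      weight w (α + β) < weight w (α' + β') := by
    intro α' hα' β' hβ' hne
    rw [weight_add, weight_add]
    by_cases h1 : α' = α
    · have h2 : β' ≠ β := fun h2 => hne (by rw [h1, h2])
      exact add_lt_add_withTop hαw hβw (by rw [h1]) (hβm β' hβ' h2).le (Or.inr (hβm β' hβ' h2))
    · refine add_lt_add_withTop hαw hβw (hαm α' hα' h1).le ?_ (Or.inl (hαm α' hα' h1))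
      by_cases h2 : β' = β
      · rw [h2]
      · exact (hβm β' hβ' h2).le
  refine ⟨α + β, ?_, ?_, ?_⟩
  · rw [MvPolynomial.mem_support_iff, MvPolynomial.coeff_mul,
      Finset.sum_eq_single_of_mem (α, β) (by simp)]
    · exact mul_ne_zero (MvPolynomial.mem_support_iff.1 hα) (MvPolynomial.mem_support_iff.1 hβ)
    · rintro ⟨α', β'⟩ h hne
      by_contra h0
      have := hlt α' (MvPolynomial.mem_support_iff.2 (left_ne_zero_of_mul h0)) β'
        (MvPolynomial.mem_support_iff.2 (right_ne_zero_of_mul h0)) hne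
      rw [Finset.HasAntidiagonal.mem_antidiagonal.1 h] at this
      exact lt_irrefl _ this
  · rw [weight_add]
    exact WithTop.add_ne_top.2 ⟨hαw, hβw⟩
  · intro γ hγ hne
    obtain ⟨α', hα', β', hβ', rfl⟩ := Finset.mem_add.1 (MvPolynomial.support_mul f g hγ)
    refine hlt α' hα' β' hβ' fun h => hne ?_
    rw [Prod.mk.injEq] at h
    rw [h.1, h.2]

theorem not_tropVanishes_one (w : ι → WithTop ℝ) : ¬ TropVanishes (1 : MvPolynomial ι κ) w := by
  rw [not_tropVanishes_iff]
  have hs : (1 : MvPolynomial ι κ).support = {0} := MvPolynomial.support_one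
  refine ⟨0, by simp [hs], by simp [weight], fun β hβ h => absurd ?_ h⟩
  simpa [hs] using hβ

theorem not_tropVanishes_prod {J : Type*} (s : Finset J) {f : J → MvPolynomial ι κ}
    {w : ι → WithTop ℝ} (hf : ∀ j ∈ s, ¬ TropVanishes (f j) w) :
    ¬ TropVanishes (∏ j ∈ s, f j) w :=
  Finset.prod_induction f (fun g => ¬ TropVanishes g w) (fun _ _ => not_tropVanishes_mul)
    (not_tropVanishes_one w) hf

theorem tropVanishes_X_iff {w : ι → WithTop ℝ} {i : ι} :
    TropVanishes (MvPolynomial.X i : MvPolynomial ι κ) w ↔ w i = ⊤ := by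
  rw [← not_iff_not, not_tropVanishes_iff]
  simp [MvPolynomial.support_X, weight_single]

theorem support_sum_X [DecidableEq ι] (s : Finset ι) :
    (∑ i ∈ s, MvPolynomial.X i : MvPolynomial ι κ).support =
      s.image fun i => Finsupp.single i 1 := by
  ext α
  rw [MvPolynomial.mem_support_iff, MvPolynomial.coeff_sum, Finset.mem_image]
  simp only [MvPolynomial.coeff_X]
  constructor
  · intro h
    obtain ⟨i, hi, h⟩ := Finset.exists_ne_zero_of_sum_ne_zero h
    exact ⟨i, hi, by by_contra h'; simp [h'] at h⟩
  · rintro ⟨i, hi, rfl⟩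
    rw [Finset.sum_eq_single_of_mem i hi (fun j _ hj => by
      rw [if_neg]; intro h; exact hj (Finsupp.single_left_injective one_ne_zero h))]
    simp

/-- If a polynomial vanishes on the curve with the coordinates `x_i = 1`, `x_j = -1 - z`, `x_k = z`,
the other coordinates being `0`, then it vanishes tropically at the points at which these other
coordinates are `∞` and the minimum is attained at `i` and `j`: for a monomial of least weight,
`x_k` has the least exponent, and a unique one would give a nonzero coefficient in the expansion
with respect to `z`. -/
theorem tropVanishes_of_aeval_eq_zero [DecidableEq ι] {f : MvPolynomial ι κ} {n : ℕ}
    (hf : f.IsHomogeneous n) {i j k : ι} (hij : i ≠ j) (hik : i ≠ k) (hjk : j ≠ k)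
    (h0 : MvPolynomial.aeval (fun l => if l = i then (1 : Polynomial κ) else
      if l = j then -1 - Polynomial.X else if l = k then Polynomial.X else 0) f = 0)
    {w : ι → WithTop ℝ} (hw : ∀ l, l ≠ i → l ≠ j → l ≠ k → w l = ⊤) (hwj : w j = w i)
    (hwk : w i ≤ w k) : TropVanishes f w := by
  by_contra hnot
  obtain ⟨α, hα, hαw, hlt⟩ := not_tropVanishes_iff.1 hnot
  set g : ι → Polynomial κ := fun l => if l = i then (1 : Polynomial κ) else
      if l = j then -1 - Polynomial.X else if l = k then Polynomial.X else 0 with hg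
  have hgi : g i = 1 := by simp [hg]
  have hgj : g j = -1 - Polynomial.X := by simp [hg, hij.symm]
  have hgk : g k = Polynomial.X := by simp [hg, hik.symm, hjk.symm]
  have hsupp : ∀ β : ι →₀ ℕ, (∀ l, l ≠ i → l ≠ j → l ≠ k → β l = 0) →
      β.support ⊆ {i, j, k} := by
    intro β hβ l hl
    by_contra h
    simp only [Finset.mem_insert, Finset.mem_singleton, not_or] at h
    exact (Finsupp.mem_support_iff.1 hl) (hβ l h.1 h.2.1 h.2.2)
  have hprod : ∀ β : ι →₀ ℕ, (∀ l, l ≠ i → l ≠ j → l ≠ k → β l = 0) →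
      β.prod (fun l e => g l ^ e) = (-1 - Polynomial.X) ^ β j * Polynomial.X ^ β k := by
    intro β hβ
    rw [Finsupp.prod_of_support_subset β (hsupp β hβ) _ (by simp)]
    rw [Finset.prod_insert (by simp [hij, hik]), Finset.prod_insert (by simp [hjk]),
      Finset.prod_singleton, hgi, hgj, hgk, one_pow, one_mul]
  have hweight : ∀ β : ι →₀ ℕ, (∀ l, l ≠ i → l ≠ j → l ≠ k → β l = 0) →
      weight w β = (β i + β j) • w i + β k • w k := by
    intro β hβ
    rw [weight, Finsupp.sum_of_support_subset β (hsupp β hβ) _ (by simp)]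
    rw [Finset.sum_insert (by simp [hij, hik]), Finset.sum_insert (by simp [hjk]),
      Finset.sum_singleton, hwj, add_nsmul, add_assoc]
  have hdeg : ∀ β ∈ f.support, (∀ l, l ≠ i → l ≠ j → l ≠ k → β l = 0) →
      β i + β j + β k = n := by
    intro β hβ h
    have := hf (MvPolynomial.mem_support_iff.1 hβ)
    rw [Finsupp.weight_apply, Finsupp.sum_of_support_subset β (hsupp β h) _ (by simp),
      Finset.sum_insert (by simp [hij, hik]), Finset.sum_insert (by simp [hjk]),
      Finset.sum_singleton] at this
    simpa [add_assoc] using this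
  have hαl : ∀ l, l ≠ i → l ≠ j → l ≠ k → α l = 0 := by
    intro l h1 h2 h3
    by_contra h
    exact hαw (weight_eq_top (hw l h1 h2 h3) h)
  have hcoeff : ((MvPolynomial.aeval g f).coeff (α k)) = f.coeff α * (-1) ^ α j := by
    rw [MvPolynomial.aeval_def, MvPolynomial.eval₂_eq, Polynomial.finsetSum_coeff,
      Finset.sum_eq_single_of_mem α hα]
    · change ((Polynomial.C (f.coeff α)) * α.prod (fun l e => g l ^ e)).coeff _ = _
      rw [hprod α hαl, Polynomial.coeff_C_mul, Polynomial.coeff_mul_X_pow']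
      simp [Polynomial.coeff_zero_eq_eval_zero]
    · intro β hβ hne
      change ((Polynomial.C (f.coeff β)) * β.prod (fun l e => g l ^ e)).coeff _ = 0
      by_cases hβl : ∀ l, l ≠ i → l ≠ j → l ≠ k → β l = 0
      · rw [hprod β hβl, Polynomial.coeff_C_mul, Polynomial.coeff_mul_X_pow', if_neg, mul_zero]
        intro hle
        refine absurd (hlt β hβ hne) (not_lt.2 ?_)
        have e1 := hdeg α hα hαl
        have e2 := hdeg β hβ hβl
        rw [hweight α hαl, hweight β hβl]
        obtain ⟨m, hm⟩ := Nat.exists_eq_add_of_le hle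
        have e3 : β i + β j = α i + α j + m := by omega
        rw [e3, hm, add_nsmul (w i) _ m, add_nsmul (w k), add_assoc, add_comm (β k • w k)]
        gcongr
      · push Not at hβl
        obtain ⟨l, h1, h2, h3, h4⟩ := hβl
        have : β.prod (fun l e => g l ^ e) = 0 := by
          refine Finset.prod_eq_zero (Finsupp.mem_support_iff.2 h4) ?_
          simp [hg, h1, h2, h3, h4]
        rw [this, mul_zero, Polynomial.coeff_zero]
  rw [h0, Polynomial.coeff_zero] at hcoeff
  exact mul_ne_zero (MvPolynomial.mem_support_iff.1 hα) (pow_ne_zero _ (by simp)) hcoeff.symm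

end TropVanishing

/-! ### Vanishing ideals of linear subspaces -/

section VanishingIdeal

variable {ι κ : Type*} [Field κ]

/-- If modulo an ideal `I` of polynomials vanishing on `W` the variables are congruent to the
coordinates of a polynomial map with values in `W`, then `I` is the vanishing ideal of `W`. -/
theorem eq_vanishingIdeal_of_retraction [Infinite κ] {I : Ideal (MvPolynomial ι κ)}
    {W : Set (ι → κ)} (ℓ : ι → MvPolynomial ι κ) (hX : ∀ i, MvPolynomial.X i - ℓ i ∈ I)
    (hW : ∀ x : ι → κ, (fun i => MvPolynomial.eval x (ℓ i)) ∈ W)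
    (hI : I ≤ MvPolynomial.vanishingIdeal κ W) : I = MvPolynomial.vanishingIdeal κ W := by
  refine le_antisymm hI fun f hf => ?_
  have hzero : MvPolynomial.aeval ℓ f = 0 := by
    apply MvPolynomial.funext
    intro x
    have := MvPolynomial.mem_vanishingIdeal_iff.1 hf _ (hW x)
    rw [map_zero, ← this, MvPolynomial.aeval_def, MvPolynomial.eval₂_eq, MvPolynomial.aeval_def,
      MvPolynomial.eval₂_eq]
    simp
  have hcongr : (Ideal.Quotient.mkₐ κ I).comp (MvPolynomial.aeval ℓ) = Ideal.Quotient.mkₐ κ I := by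
    apply MvPolynomial.algHom_ext
    intro i
    simpa using (Ideal.Quotient.eq.2 (hX i)).symm
  have := DFunLike.congr_fun hcongr f
  rw [AlgHom.comp_apply, hzero, map_zero] at this
  exact Ideal.Quotient.eq_zero_iff_mem.1 this.symm

theorem vanishingIdeal_iUnion {J : Type*} (Z : J → Set (ι → κ)) :
    MvPolynomial.vanishingIdeal κ (⋃ j, Z j) = ⨅ j, MvPolynomial.vanishingIdeal κ (Z j) := by
  ext f
  simp only [MvPolynomial.mem_vanishingIdeal_iff, Ideal.mem_iInf, Set.mem_iUnion]
  exact ⟨fun h j x hx => h x ⟨j, hx⟩, fun h x ⟨j, hx⟩ => h j x hx⟩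

end VanishingIdeal

/-! ### The lines of the schön arrangement -/

namespace PlanarEmbedding

section LineSpace

variable {V : Type*} [Fintype V] {G : SimpleGraph V} (κ : Type*) [Field κ] (M : PlanarEmbedding G)
  (o : M.Face)

/-- The linear subspace of the line of the vertex `v`: the vectors supported on the faces at `v`,
with coordinate sum zero if `v` is interior. -/
def lineSpace (v : V) : Submodule κ (M.IntFace o → κ) where
  carrier := {y | (∀ F : M.IntFace o, ¬ M.Incident v F.1 → y F = 0) ∧
    (¬ M.Exterior o v → ∑ F, y F = 0)}
  zero_mem' := by simp
  add_mem' := fun {y z} hy hz => ⟨fun F hF => by simp [hy.1 F hF, hz.1 F hF],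
    fun h => by simp [Finset.sum_add_distrib, hy.2 h, hz.2 h]⟩
  smul_mem' := fun c y hy => ⟨fun F hF => by simp [hy.1 F hF],
    fun h => by simp [← Finset.mul_sum, hy.2 h]⟩

variable {κ}

open Classical in
/-- The extension of a vector on the interior faces by a coordinate of the outer face that makes the
coordinate sum zero. In these coordinates the conditions on the lines of interior and of exterior
vertices become the same. -/
noncomputable def extend (y : M.IntFace o → κ) (F : M.Face) : κ :=
  if h : F = o then -∑ F, y F else y ⟨F, h⟩

variable {M o}

theorem extend_coe (y : M.IntFace o → κ) (F : M.IntFace o) : M.extend o y F.1 = y F := by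
  simp [extend, F.2]

theorem extend_outer (y : M.IntFace o → κ) : M.extend o y o = -∑ F, y F := by
  simp [extend]

theorem sum_face_eq {A : Type*} [AddCommMonoid A] (z : M.Face → A) (o : M.Face) :
    ∑ F, z F = z o + ∑ F : M.IntFace o, z F.1 := by
  classical
  convert Fintype.sum_eq_add_sum_subtype_ne z o

theorem sum_extend (y : M.IntFace o → κ) : ∑ F, M.extend o y F = 0 := by
  rw [sum_face_eq _ o, extend_outer]
  simp [extend_coe]

theorem extend_restrict {z : M.Face → κ} (hz : ∑ F, z F = 0) (F : M.Face) :
    M.extend o (fun F : M.IntFace o => z F.1) F = z F := by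
  by_cases h : F = o
  · subst h
    rw [sum_face_eq _ F] at hz
    rw [extend_outer]
    exact (eq_neg_of_add_eq_zero_left hz).symm
  · exact extend_coe _ ⟨F, h⟩

theorem mem_lineSpace_iff {v : V} {y : M.IntFace o → κ} :
    y ∈ M.lineSpace κ o v ↔ ∀ F, ¬ M.Incident v F → M.extend o y F = 0 := by
  constructor
  · rintro ⟨h1, h2⟩ F hF
    by_cases h : F = o
    · subst h
      rw [extend_outer, h2 hF, neg_zero]
    · rw [extend_coe _ ⟨F, h⟩]
      exact h1 _ hF
  · intro h
    refine ⟨fun F hF => ?_, fun hv => ?_⟩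
    · rw [← extend_coe y F, h _ hF]
    · have := h o hv
      rwa [extend_outer, neg_eq_zero] at this

end LineSpace

section Lines

variable {V : Type*} [Fintype V] [DecidableEq V] {G : SimpleGraph V} [DecidableRel G.Adj]
  {κ : Type*} [Field κ] {M : PlanarEmbedding G} {o : M.Face}
  (hreg : G.IsRegularOfDegree 3) (hconn : ThreeConnected G)

include hreg

theorem exists_dart (v : V) : ∃ d : G.Dart, d.fst = v := by
  obtain ⟨x, hx, -⟩ := exists_adj_ne_ne hreg v v v
  exact ⟨⟨(v, x), hx⟩, rfl⟩

include hconn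

variable (M) in
theorem sum_incident {A : Type*} [AddCommMonoid A] (d : G.Dart) {z : M.Face → A}
    (hz : ∀ F, ¬ M.Incident d.fst F → z F = 0) :
    ∑ F, z F = z (M.faceOf d) + z (M.faceOf (M.rot d)) + z (M.faceOf (M.rot (M.rot d))) := by
  have n1 := M.faceOf_rot_rot_ne hreg hconn d
  have n2 := M.faceOf_rot_ne hreg hconn d
  have n3 := M.faceOf_rot_ne hreg hconn (M.rot d)
  rw [← Finset.sum_subset (Finset.subset_univ
    {M.faceOf d, M.faceOf (M.rot d), M.faceOf (M.rot (M.rot d))}),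
    Finset.sum_insert (by simp [n1.symm, n2.symm]), Finset.sum_insert (by simp [n3.symm]),
    Finset.sum_singleton, add_assoc]
  intro F _ hF
  apply hz
  rw [M.incident_iff hreg]
  simpa using hF

theorem finrank_lineSpace (v : V) : Module.finrank κ (M.lineSpace κ o v) = 2 := by
  obtain ⟨d, rfl⟩ := exists_dart hreg v
  have n1 := M.faceOf_rot_rot_ne hreg hconn d
  have n2 := M.faceOf_rot_ne hreg hconn d
  have n3 := M.faceOf_rot_ne hreg hconn (M.rot d)
  let T : M.lineSpace κ o d.fst →ₗ[κ] κ × κ :=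
    { toFun := fun y => (M.extend o y.1 (M.faceOf d), M.extend o y.1 (M.faceOf (M.rot d)))
      map_add' := fun y z => by
        have h : ∀ F, M.extend o (y.1 + z.1) F = M.extend o y.1 F + M.extend o z.1 F := by
          intro F
          unfold extend
          split_ifs <;> simp [Finset.sum_add_distrib, add_comm]
        simp [h]
      map_smul' := fun c y => by
        have h : ∀ F, M.extend o (c • y.1) F = c * M.extend o y.1 F := by
          intro F
          unfold extend
          split_ifs <;> simp [← Finset.mul_sum]
        simp [h] }
  have hinj : Function.Injective T := by
    refine (injective_iff_map_eq_zero _).2 ?_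
    rintro ⟨y, hy⟩ h
    have h1 : M.extend o y (M.faceOf d) = 0 := congrArg Prod.fst h
    have h2 : M.extend o y (M.faceOf (M.rot d)) = 0 := congrArg Prod.snd h
    have hy' := mem_lineSpace_iff.1 hy
    have h3 : M.extend o y (M.faceOf (M.rot (M.rot d))) = 0 := by
      have := sum_extend (M := M) (o := o) y
      rwa [M.sum_incident hreg hconn d hy', h1, h2, zero_add, zero_add] at this
    ext F
    change y F = 0
    rw [← extend_coe y F]
    by_cases hF : M.Incident d.fst F.1
    · rcases (M.incident_iff hreg d _).1 hF with h | h | h <;> rw [h] <;> assumption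
    · exact hy' _ hF
  have hsurj : Function.Surjective T := by
    rintro ⟨a, b⟩
    set z : M.Face → κ := fun F => if F = M.faceOf d then a else if F = M.faceOf (M.rot d) then b
      else if F = M.faceOf (M.rot (M.rot d)) then -(a + b) else 0 with hz
    have hz0 : ∀ F, ¬ M.Incident d.fst F → z F = 0 := by
      intro F hF
      rw [M.incident_iff hreg] at hF
      push Not at hF
      simp [hz, hF]
    have hs : ∑ F, z F = 0 := by
      rw [M.sum_incident hreg hconn d hz0]
      simp [hz, n1, n2, n3]
    refine ⟨⟨fun F => z F.1, mem_lineSpace_iff.2 fun F hF => ?_⟩, ?_⟩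
    · rw [extend_restrict hs, hz0 F hF]
    · change (M.extend o (fun F => z F.1) _, M.extend o (fun F => z F.1) _) = _
      rw [extend_restrict hs, extend_restrict hs]
      simp [hz, n2]
  rw [LinearEquiv.finrank_eq (LinearEquiv.ofBijective T ⟨hinj, hsurj⟩)]
  simp

/-- Two faces at a vertex are complemented by a third one. -/
theorem exists_third_face {v : V} {L F : M.Face} (hL : M.Incident v L) (hF : M.Incident v F)
    (hne : L ≠ F) : ∃ K, M.Incident v K ∧ K ≠ L ∧ K ≠ F ∧
      ∀ H, M.Incident v H ↔ H = L ∨ H = F ∨ H = K := by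
  obtain ⟨d, rfl, h⟩ := M.exists_dart_of_incident hreg hL hF hne
  have n1 := M.faceOf_rot_rot_ne hreg hconn d
  have n3 := M.faceOf_rot_ne hreg hconn (M.rot d)
  refine ⟨M.faceOf (M.rot (M.rot d)), (M.incident_iff hreg d _).2 (by simp), ?_⟩
  rw [M.faceOf_symm] at h
  rcases h with ⟨rfl, rfl⟩ | ⟨rfl, rfl⟩
  · exact ⟨n1, n3, fun H => M.incident_iff hreg d H⟩
  · exact ⟨n3, n1, fun H => (M.incident_iff hreg d H).trans or_left_comm⟩

theorem exists_intFace {v : V} (hv : ¬ M.Exterior o v) :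
    ∃ F F' K : M.IntFace o, F ≠ F' ∧ F ≠ K ∧ F' ≠ K ∧
      ∀ H : M.IntFace o, M.Incident v H.1 ↔ H = F ∨ H = F' ∨ H = K := by
  obtain ⟨d, rfl⟩ := exists_dart hreg v
  have n1 := M.faceOf_rot_rot_ne hreg hconn d
  have n2 := M.faceOf_rot_ne hreg hconn d
  have n3 := M.faceOf_rot_ne hreg hconn (M.rot d)
  have ho := (M.incident_iff hreg d o).not.1 hv
  push Not at ho
  refine ⟨⟨_, ho.1.symm⟩, ⟨_, ho.2.1.symm⟩, ⟨_, ho.2.2.symm⟩, ?_, ?_, ?_, fun H => ?_⟩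
  · simpa [Subtype.ext_iff] using n2.symm
  · simpa [Subtype.ext_iff] using n1.symm
  · simpa [Subtype.ext_iff] using n3.symm
  · simpa [Subtype.ext_iff] using M.incident_iff hreg d H.1

/-- The line ideal of `v` consists of all the polynomials that vanish on the line of `v`. -/
theorem lineIdeal_eq_vanishingIdeal [Infinite κ] (v : V) :
    lineIdeal κ M o v =
      MvPolynomial.vanishingIdeal κ (M.lineSpace κ o v : Set (M.IntFace o → κ)) := by
  classical
  obtain ⟨K, hK⟩ : ∃ K : M.IntFace o, ¬ M.Exterior o v → M.Incident v K.1 := by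
    by_cases hv : M.Exterior o v
    · obtain ⟨d, rfl⟩ := exists_dart hreg v
      by_cases hd : M.faceOf d = o
      · exact ⟨⟨_, hd ▸ M.faceOf_rot_ne hreg hconn d⟩, fun h => absurd hv h⟩
      · exact ⟨⟨_, hd⟩, fun h => absurd hv h⟩
    · obtain ⟨F, F', K, -, -, -, h⟩ := exists_intFace hreg hconn hv
      exact ⟨F, fun _ => (h F).2 (Or.inl rfl)⟩
  -- the retraction solves the equation of an interior vertex for the coordinate at `K`
  let S : MvPolynomial (M.IntFace o) κ :=
    ∑ F : M.IntFace o, if M.Incident v F.1 then MvPolynomial.X F else 0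
  refine eq_vanishingIdeal_of_retraction
    (fun F => if M.Incident v F.1 then
      (if ¬ M.Exterior o v ∧ F = K then MvPolynomial.X F - S else MvPolynomial.X F) else 0)
    (fun F => ?_) (fun x => ⟨fun F hF => ?_, fun hv => ?_⟩) ?_
  · by_cases hF : M.Incident v F.1
    · by_cases hFK : ¬ M.Exterior o v ∧ F = K
      · rw [if_pos hF, if_pos hFK, sub_sub_cancel]
        exact Ideal.subset_span (Or.inr ⟨hFK.1, rfl⟩)
      · rw [if_pos hF, if_neg hFK, sub_self]
        exact Ideal.zero_mem _
    · rw [if_neg hF, sub_zero]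
      exact Ideal.subset_span (Or.inl ⟨F, hF, rfl⟩)
  · simp [hF]
  · have hKv := hK hv
    have h1 : ∀ F : M.IntFace o, (MvPolynomial.eval x) (if M.Incident v F.1 then
        (if ¬ M.Exterior o v ∧ F = K then MvPolynomial.X F - S else MvPolynomial.X F) else 0) =
        (MvPolynomial.eval x) (if M.Incident v F.1 then MvPolynomial.X F else 0) -
          if F = K then MvPolynomial.eval x S else 0 := by
      intro F
      by_cases hFK : F = K
      · subst hFK
        simp [hKv, hv]
      · simp [hFK]
    rw [Finset.sum_congr rfl (fun F _ => h1 F), Finset.sum_sub_distrib, ← map_sum]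
    simp [S]
  · rw [lineIdeal, Ideal.span_le]
    rintro f (⟨F, hF, rfl⟩ | ⟨hv, rfl⟩)
    · refine MvPolynomial.mem_vanishingIdeal_iff.2 fun x hx => ?_
      simpa using hx.1 F hF
    · refine MvPolynomial.mem_vanishingIdeal_iff.2 fun x hx => ?_
      rw [map_sum, ← hx.2 hv]
      refine Finset.sum_congr rfl fun F _ => ?_
      split_ifs with h
      · simp
      · simp [hx.1 F h]

theorem isTropicalLine_tropLine [Infinite κ] (v : V) : IsTropicalLine κ (tropLine κ M o v) :=
  ⟨M.lineSpace κ o v, finrank_lineSpace hreg hconn v, by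
    rw [tropLine, lineIdeal_eq_vanishingIdeal hreg hconn]⟩

end Lines

end PlanarEmbedding

/-! ### The tropical lines of the arrangement -/

section TropLines

variable {V : Type*} [Fintype V] [DecidableEq V] {G : SimpleGraph V} [DecidableRel G.Adj]
  {M : PlanarEmbedding G} {o : M.Face}

/-- The conditions on the homogeneous coordinates of the points of the tropical line of `v`: the
coordinates of the faces not at `v` are infinite and, if `v` is interior, the minimal coordinate is
attained at least twice. -/
def OnTropLine (v : V) (w : M.IntFace o → WithTop ℝ) : Prop :=
  (∀ F : M.IntFace o, ¬ M.Incident v F.1 → w F = ⊤) ∧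
  (¬ M.Exterior o v → ∃ F F' : M.IntFace o, F ≠ F' ∧ M.Incident v F.1 ∧ M.Incident v F'.1 ∧
    w F = w F' ∧ ∀ F'', w F ≤ w F'')

omit [Fintype V] [DecidableEq V] [DecidableRel G.Adj] in
theorem OnTropLine.add_const {v : V} {w w' : M.IntFace o → WithTop ℝ} (h : OnTropLine v w) (c : ℝ)
    (hc : ∀ F, w' F = w F + (c : WithTop ℝ)) : OnTropLine v w' := by
  refine ⟨fun F hF => by rw [hc, h.1 F hF, WithTop.top_add], fun hv => ?_⟩
  obtain ⟨F, F', hne, hF, hF', he, hmin⟩ := h.2 hv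
  exact ⟨F, F', hne, hF, hF', by rw [hc, hc, he], fun F'' => by
    rw [hc, hc]
    gcongr
    exact hmin F''⟩

variable {κ : Type*} [Field κ]

omit [DecidableEq V] [DecidableRel G.Adj] in
/-- The generators of the line ideal cut out the tropical line. -/
theorem exists_not_tropVanishes {v : V} {w : TropVec (M.IntFace o)} (h : ¬ OnTropLine v w.1) :
    ∃ f ∈ lineIdeal κ M o v, f.IsHomogeneous 1 ∧ ¬ TropVanishes f w.1 := by
  classical
  by_cases h1 : ∀ F : M.IntFace o, ¬ M.Incident v F.1 → w.1 F = ⊤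
  · have h2 : ¬ M.Exterior o v ∧ ∀ F F' : M.IntFace o, F ≠ F' → M.Incident v F.1 →
        M.Incident v F'.1 → w.1 F = w.1 F' → ¬ ∀ F'', w.1 F ≤ w.1 F'' := by
      by_contra h2
      apply h
      refine ⟨h1, fun hv => ?_⟩
      by_contra h3
      exact h2 ⟨hv, fun F F' hne hF hF' he hmin => h3 ⟨F, F', hne, hF, hF', he, hmin⟩⟩
    obtain ⟨hv, h2⟩ := h2
    refine ⟨_, Ideal.subset_span (Or.inr ⟨hv, rfl⟩), ?_, ?_⟩
    · refine MvPolynomial.IsHomogeneous.sum _ _ _ fun F _ => ?_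
      split_ifs
      · exact MvPolynomial.isHomogeneous_X _ _
      · exact MvPolynomial.isHomogeneous_zero _ _ _
    · rw [← Finset.sum_filter, not_tropVanishes_iff, support_sum_X]
      obtain ⟨F₀, hF₀⟩ := w.2
      obtain ⟨F, -, hF⟩ := Finset.exists_min_image Finset.univ w.1 ⟨F₀, Finset.mem_univ _⟩
      have hFtop : w.1 F ≠ ⊤ := ((hF F₀ (Finset.mem_univ _)).trans_lt (lt_top_iff_ne_top.2 hF₀)).ne
      have hFv : M.Incident v F.1 := by
        by_contra hF'
        exact hFtop (h1 F hF')
      refine ⟨Finsupp.single F 1, Finset.mem_image_of_mem _ (by simpa using hFv), by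
        rwa [weight_single], fun β hβ hne => ?_⟩
      obtain ⟨F', hF', rfl⟩ := Finset.mem_image.1 hβ
      rw [weight_single, weight_single]
      refine lt_of_le_of_ne (hF F' (Finset.mem_univ _)) fun he => ?_
      refine h2 F F' ?_ hFv (by simpa using hF') he fun F'' => hF F'' (Finset.mem_univ _)
      rintro rfl
      exact hne rfl
  · push Not at h1
    obtain ⟨F, hF, hw⟩ := h1
    exact ⟨_, Ideal.subset_span (Or.inl ⟨F, hF, rfl⟩), MvPolynomial.isHomogeneous_X _ _,
      tropVanishes_X_iff.not.2 hw⟩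

variable (hreg : G.IsRegularOfDegree 3) (hconn : ThreeConnected G)
include hreg hconn

theorem OnTropLine.tropVanishes {v : V} {w : M.IntFace o → WithTop ℝ} (h : OnTropLine v w)
    {f : MvPolynomial (M.IntFace o) κ} (hf : f ∈ lineIdeal κ M o v) {n : ℕ}
    (hn : f.IsHomogeneous n) : TropVanishes f w := by
  classical
  by_cases hv : M.Exterior o v
  · have hf' : f ∈ Ideal.span (MvPolynomial.X '' {F : M.IntFace o | ¬ M.Incident v F.1}) := by
      refine Ideal.span_mono ?_ hf
      rintro g (⟨F, hF, rfl⟩ | ⟨hv', -⟩)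
      exacts [⟨F, hF, rfl⟩, absurd hv hv']
    intro α hα hαw
    obtain ⟨F, hF, hα'⟩ := MvPolynomial.mem_ideal_span_X_image.1 hf' α hα
    exact absurd (weight_eq_top (h.1 F hF) hα') hαw
  · obtain ⟨F, F', hne, hF, hF', he, hmin⟩ := h.2 hv
    obtain ⟨K, hK, hKF, hKF', hall⟩ := PlanarEmbedding.exists_third_face hreg hconn hF hF'
      (fun h => hne (Subtype.ext h))
    have hKo : K ≠ o := by
      rintro rfl
      exact hv hK
    have hall' : ∀ H : M.IntFace o, M.Incident v H.1 ↔ H = F ∨ H = F' ∨ H = ⟨K, hKo⟩ := fun H => by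
      rw [hall]; simp [Subtype.ext_iff]
    have n1 : F ≠ ⟨K, hKo⟩ := fun h => hKF (by rw [h])
    have n2 : F' ≠ ⟨K, hKo⟩ := fun h => hKF' (by rw [h])
    refine tropVanishes_of_aeval_eq_zero hn hne n1 n2 ?_ (fun H h1 h2 h3 => h.1 H ?_) he.symm
      (hmin _)
    · rw [← AlgHom.coe_toRingHom, ← RingHom.mem_ker]
      refine Ideal.span_le.2 ?_ hf
      rintro g (⟨H, hH, rfl⟩ | ⟨-, rfl⟩)
      · rw [hall'] at hH
        push Not at hH
        simp [RingHom.mem_ker, hH]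
      · have hfil : (Finset.univ.filter fun H : M.IntFace o => M.Incident v H.1) =
            {F, F', ⟨K, hKo⟩} := by
          ext H; simp [hall']
        simp only [SetLike.mem_coe, RingHom.mem_ker, AlgHom.coe_toRingHom]
        rw [← Finset.sum_filter, hfil, map_sum, Finset.sum_insert (by simp [hne, n1]),
          Finset.sum_insert (by simp [n2]), Finset.sum_singleton]
        simp [hne.symm, n1.symm, n2.symm]
    · rw [hall']
      simp [h1, h2, h3]

theorem mk_mem_tropLine_iff {v : V} {w : TropVec (M.IntFace o)} :
    TP.mk w ∈ tropLine κ M o v ↔ OnTropLine v w.1 := by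
  constructor
  · intro h
    by_contra hnot
    obtain ⟨f, hf, hn, hfw⟩ := exists_not_tropVanishes (κ := κ) hnot
    exact hfw (h f hf 1 hn w rfl)
  · intro h f hf n hn w' hw'
    obtain ⟨c, hc⟩ := TP.mk_eq_mk_iff.1 hw'.symm
    exact (h.add_const c hc).tropVanishes hreg hconn hf hn

/-- The tropicalization of the arrangement is the union of the tropical lines: off the union, the
product of linear equations that fail for the single lines does not vanish tropically. -/
theorem tropSchon_eq_iUnion : tropSchon κ M o = ⋃ v, tropLine κ M o v := by
  apply Set.Subset.antisymm
  · intro p hp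
    obtain ⟨w, rfl⟩ := p.exists_mk
    by_contra hnot
    simp only [Set.mem_iUnion, not_exists, mk_mem_tropLine_iff hreg hconn] at hnot
    choose f hf hn hw using fun v => exists_not_tropVanishes (κ := κ) (hnot v)
    refine not_tropVanishes_prod Finset.univ (fun v _ => hw v) (hp _ ?_ _
      (MvPolynomial.IsHomogeneous.prod Finset.univ f (fun _ => 1) fun v _ => hn v) w rfl)
    rw [schonIdeal, Ideal.mem_iInf]
    exact fun v => Ideal.mem_of_dvd _ (Finset.dvd_prod_of_mem f (Finset.mem_univ v)) (hf v)
  · exact Set.iUnion_subset fun v => tropProj_anti (iInf_le _ v)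

end TropLines

/-! ### Linear forms on the plane and residues -/

section Bracket

variable {κ : Type*} [Field κ]

theorem bracket_swap (p q : Fin 2 → κ) : bracket q p = -bracket p q := by
  simp only [bracket]; ring

theorem bracket_smul_eq (p q x : Fin 2 → κ) :
    bracket p q • x = bracket x q • p + bracket p x • q := by
  ext i
  fin_cases i <;> simp [bracket] <;> ring

/-- The residue theorem for three points of the projective line. -/
theorem sum_residue_eq_zero (ℓ : Module.Dual κ (Fin 2 → κ)) {p q r : Fin 2 → κ}
    (hpq : bracket p q ≠ 0) (hqr : bracket q r ≠ 0) (hrp : bracket r p ≠ 0) :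
    ℓ p / (bracket q p * bracket r p) + ℓ q / (bracket r q * bracket p q) +
      ℓ r / (bracket p r * bracket q r) = 0 := by
  have h := congrArg ℓ (bracket_smul_eq p q r)
  simp only [map_smul, map_add, smul_eq_mul] at h
  rw [bracket_swap p q, bracket_swap q r, bracket_swap r p]
  rw [bracket_swap q r, bracket_swap r p] at h
  field_simp
  linear_combination (-1 : κ) * h

theorem exists_linearForm {p q : Fin 2 → κ} (hpq : bracket p q ≠ 0) (a b : κ) :
    ∃ ℓ : Module.Dual κ (Fin 2 → κ), ℓ p = a ∧ ℓ q = b := by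
  refine ⟨{ toFun := fun x => (a * bracket x q + b * bracket p x) / bracket p q
            map_add' := fun x y => ?_
            map_smul' := fun c x => ?_ }, ?_, ?_⟩
  · rw [← add_div]; congr 1; simp only [bracket, Pi.add_apply]; ring
  · simp only [bracket, Pi.smul_apply, smul_eq_mul, RingHom.id_apply]
    rw [← mul_div_assoc]; congr 1; ring
  · have : bracket p p = 0 := by simp only [bracket]; ring
    simp [this, hpq]
  · have : bracket q q = 0 := by simp only [bracket]; ring
    simp [this, hpq]

end Bracket

section SameProj

variable {κ : Type*} [Field κ] {ι J : Type*}

theorem sameProj_smul {c : κ} (hc : c ≠ 0) (x : ι → κ) : SameProj κ (c • x) x :=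
  Submodule.span_singleton_smul_eq hc.isUnit x

theorem sameProj_map_iff {f : (ι → κ) →ₗ[κ] (J → κ)} (hf : Function.Injective f) {x y : ι → κ} :
    SameProj κ (f x) (f y) ↔ SameProj κ x y := by
  unfold SameProj
  rw [← Set.image_singleton, ← Set.image_singleton, Submodule.span_image, Submodule.span_image]
  exact (Submodule.map_injective_of_injective hf).eq_iff

end SameProj

/-! ### The canonical embedding given by the boundaries of the interior faces -/

namespace PlanarEmbedding

variable {V : Type*} [Fintype V] [DecidableEq V] {G : SimpleGraph V} [DecidableRel G.Adj]
  (κ : Type*) [Field κ] (M : PlanarEmbedding G) (o : M.Face)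

/-- The difference of the unit vectors of the two faces at the edge of a dart. -/
noncomputable def edgeVec (d : G.Dart) : M.Face → κ :=
  Pi.single (M.faceOf d) 1 - Pi.single (M.faceOf d.symm) 1

/-- The point of the arrangement that corresponds to an edge: the restriction of `edgeVec` to the
interior faces. -/
noncomputable def nodeVec (d : G.Dart) : M.IntFace o → κ := fun F => M.edgeVec κ d F.1

omit [DecidableEq V] [DecidableRel G.Adj] in
theorem sum_edgeVec (d : G.Dart) : ∑ F, M.edgeVec κ d F = 0 := by
  simp [edgeVec, Finset.sum_sub_distrib]

omit [DecidableEq V] [DecidableRel G.Adj] in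
theorem extend_nodeVec (d : G.Dart) (F : M.Face) :
    M.extend o (M.nodeVec κ o d) F = M.edgeVec κ d F :=
  extend_restrict (M.sum_edgeVec κ d) F

omit [Fintype V] [DecidableEq V] [DecidableRel G.Adj] in
theorem nodeVec_symm (d : G.Dart) : M.nodeVec κ o d.symm = -M.nodeVec κ o d := by
  ext F
  simp [nodeVec, edgeVec]

omit [DecidableEq V] [DecidableRel G.Adj] in
theorem nodeVec_mem (d : G.Dart) : M.nodeVec κ o d ∈ M.lineSpace κ o d.fst := by
  rw [mem_lineSpace_iff]
  intro F hF
  have h1 : F ≠ M.faceOf d := fun h => hF (h ▸ M.incident_fst d)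
  have h2 : F ≠ M.faceOf d.symm := fun h => hF (h ▸ M.incident_fst_symm d)
  rw [extend_nodeVec]
  simp [edgeVec, h1, h2]

variable {M o κ} in
/-- Two lines of the arrangement meet only if the vertices are adjacent, and then in the point of
the edge. -/
theorem exists_eq_smul_nodeVec (hreg : G.IsRegularOfDegree 3) (hconn : ThreeConnected G) {v u : V}
    (hvu : v ≠ u) {y : M.IntFace o → κ} (hv : y ∈ M.lineSpace κ o v) (hu : y ∈ M.lineSpace κ o u)
    (hy : y ≠ 0) :
    ∃ d : G.Dart, d.fst = v ∧ d.snd = u ∧ ∃ a : κ, a ≠ 0 ∧ y = a • M.nodeVec κ o d := by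
  rw [mem_lineSpace_iff] at hv hu
  have hcommon : ∀ F, M.extend o y F ≠ 0 → M.Incident v F ∧ M.Incident u F := fun F hF =>
    ⟨by by_contra h; exact hF (hv F h), by by_contra h; exact hF (hu F h)⟩
  obtain ⟨L, hL⟩ : ∃ L, M.extend o y L ≠ 0 := by
    by_contra! h
    exact hy (funext fun F => by rw [← extend_coe y F, h]; rfl)
  -- the coordinates add up to zero, so there is a second one that is not zero
  obtain ⟨R, hRL, hR⟩ : ∃ R, R ≠ L ∧ M.extend o y R ≠ 0 := by
    by_contra! h
    have := sum_extend (M := M) (o := o) y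
    rw [Finset.sum_eq_single_of_mem L (Finset.mem_univ _) fun R _ hR => h R hR] at this
    exact hL this
  obtain ⟨hLv, hLu⟩ := hcommon L hL
  obtain ⟨hRv, hRu⟩ := hcommon R hR
  obtain ⟨d, rfl, rfl, hd⟩ :=
    M.exists_dart_of_incident_incident hreg hconn hvu hRL.symm hLv hRv hLu hRu
  have hdL : M.extend o y (M.faceOf d) ≠ 0 := by
    rcases hd with ⟨h, -⟩ | ⟨h, -⟩ <;> rwa [h]
  have hthird : M.extend o y (M.faceOf (M.rot (M.rot d))) = 0 := by
    by_contra h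
    exact hvu (M.eq_of_incident hreg hconn d (M.incident_snd d)
      (by rw [← M.faceOf_symm]; exact M.incident_snd_symm d) (hcommon _ h).2)
  have hsum := sum_extend (M := M) (o := o) y
  rw [M.sum_incident hreg hconn d hv, hthird, add_zero, ← M.faceOf_symm] at hsum
  refine ⟨d, rfl, rfl, M.extend o y (M.faceOf d), hdL, funext fun F => ?_⟩
  rw [← extend_coe y F]
  have hne := M.faceOf_ne_faceOf_symm hreg hconn d
  simp only [Pi.smul_apply, nodeVec, edgeVec, Pi.sub_apply, Pi.single_apply, smul_eq_mul]
  by_cases h1 : F.1 = M.faceOf d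
  · rw [h1]; simp [hne]
  · by_cases h2 : F.1 = M.faceOf d.symm
    · rw [h2, if_neg hne.symm]
      simp [eq_neg_of_add_eq_zero_right hsum]
    · rw [if_neg h1, if_neg h2, sub_zero, mul_zero]
      by_cases h3 : M.Incident d.fst F.1
      · rw [M.incident_iff hreg, ← M.faceOf_symm] at h3
        rcases h3 with h | h | h
        exacts [absurd h h1, absurd h h2, h ▸ hthird]
      · exact hv _ h3

end PlanarEmbedding

namespace GraphCurve

open PlanarEmbedding

variable {V : Type*} [Fintype V] [DecidableEq V] {G : SimpleGraph V} [DecidableRel G.Adj]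
  {κ : Type*} [Field κ] {X : GraphCurve κ G} {M : PlanarEmbedding G} {o : M.Face}

variable (X) in
/-- The node of a dart, on the component of its initial vertex. -/
def dartNode (d : G.Dart) : Fin 2 → κ := X.node d.fst d.snd

variable (X M) in
/-- The denominator in the residue at the node of a dart. -/
def denom (d : G.Dart) : κ :=
  bracket (X.dartNode (M.rot d)) (X.dartNode d) *
    bracket (X.dartNode (M.rot (M.rot d))) (X.dartNode d)

omit [Fintype V] [DecidableEq V] [DecidableRel G.Adj] in
theorem bracket_dartNode_ne_zero {d d' : G.Dart} (h : d.fst = d'.fst) (hne : d ≠ d') :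
    bracket (X.dartNode d) (X.dartNode d') ≠ 0 := by
  unfold dartNode
  rw [← h]
  refine X.node_distinct _ _ _ d.adj (h ▸ d'.adj) fun h' => hne ?_
  exact SimpleGraph.Dart.toProd_injective (Prod.ext h h')

variable (hreg : G.IsRegularOfDegree 3)
include hreg

theorem neighborFinset_erase (d : G.Dart) : (G.neighborFinset d.fst).erase d.snd =
    {(M.rot d).snd, (M.rot (M.rot d)).snd} := by
  have hsnd : ∀ e : G.Dart, e.fst = d.fst → (e.snd = d.snd ↔ e = d) := fun e he =>
    ⟨fun h => SimpleGraph.Dart.toProd_injective (Prod.ext he h), fun h => by rw [h]⟩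
  have f1 : (M.rot d).fst = d.fst := M.rot_fst d
  have f2 : (M.rot (M.rot d)).fst = d.fst := (M.rot_fst _).trans f1
  ext w
  simp only [Finset.mem_erase, SimpleGraph.mem_neighborFinset, Finset.mem_insert,
    Finset.mem_singleton]
  constructor
  · rintro ⟨hw, hadj⟩
    rcases M.eq_rot_of_fst_eq hreg (d := d) (d' := ⟨(d.fst, w), hadj⟩) rfl with h | h | h
    · exact absurd (congrArg (fun e : G.Dart => e.snd) h) hw
    · exact Or.inl (congrArg (fun e : G.Dart => e.snd) h)
    · exact Or.inr (congrArg (fun e : G.Dart => e.snd) h)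
  · rintro (rfl | rfl)
    · refine ⟨fun h => M.rot_ne hreg d ((hsnd _ f1).1 h), ?_⟩
      rw [← f1]; exact (M.rot d).adj
    · refine ⟨fun h => M.rot_rot_ne hreg d ((hsnd _ f2).1 h), ?_⟩
      rw [← f2]; exact (M.rot (M.rot d)).adj

variable (M) in
theorem residue_eq (ℓ : Module.Dual κ (Fin 2 → κ)) (d : G.Dart) :
    X.residue ℓ d.fst d.snd = ℓ (X.dartNode d) / X.denom M d := by
  have f1 : (M.rot d).fst = d.fst := M.rot_fst d
  have f2 : (M.rot (M.rot d)).fst = d.fst := (M.rot_fst _).trans f1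
  rw [residue, neighborFinset_erase (M := M) hreg, Finset.prod_pair]
  · simp only [denom, dartNode, f1, f2]
  · intro h
    exact M.rot_ne hreg (M.rot d)
      (SimpleGraph.Dart.toProd_injective (Prod.ext (f1.trans f2.symm) h)).symm

theorem denom_ne_zero (d : G.Dart) : X.denom M d ≠ 0 :=
  mul_ne_zero (bracket_dartNode_ne_zero (M.rot_fst d) (M.rot_ne hreg d))
    (bracket_dartNode_ne_zero ((M.rot_fst _).trans (M.rot_fst d)) (M.rot_rot_ne hreg d))

theorem bracket_rot_ne_zero (d : G.Dart) :
    bracket (X.dartNode d) (X.dartNode (M.rot d)) ≠ 0 :=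
  bracket_dartNode_ne_zero (M.rot_fst d).symm (M.rot_ne hreg d).symm

variable (M) in
theorem sum_residue_rot (ℓ : Module.Dual κ (Fin 2 → κ)) (d : G.Dart) :
    ℓ (X.dartNode d) / X.denom M d + ℓ (X.dartNode (M.rot d)) / X.denom M (M.rot d) +
      ℓ (X.dartNode (M.rot (M.rot d))) / X.denom M (M.rot (M.rot d)) = 0 := by
  have h1 := bracket_rot_ne_zero (X := X) (M := M) hreg d
  have h2 := bracket_rot_ne_zero (X := X) (M := M) hreg (M.rot d)
  have h3 := bracket_rot_ne_zero (X := X) (M := M) hreg (M.rot (M.rot d))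
  rw [M.rot_rot_rot hreg] at h3
  have := sum_residue_eq_zero ℓ h1 h2 h3
  simpa only [denom, M.rot_rot_rot hreg] using this

theorem linearForm_ext (M : PlanarEmbedding G) {ℓ ℓ' : Module.Dual κ (Fin 2 → κ)} (d : G.Dart)
    (h1 : ℓ (X.dartNode d) = ℓ' (X.dartNode d))
    (h2 : ℓ (X.dartNode (M.rot d)) = ℓ' (X.dartNode (M.rot d))) : ℓ = ℓ' := by
  refine LinearMap.ext fun q => ?_
  have hb := bracket_rot_ne_zero (X := X) (M := M) hreg d
  apply mul_left_cancel₀ hb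
  rw [← smul_eq_mul, ← smul_eq_mul, ← map_smul, ← map_smul, bracket_smul_eq]
  simp only [map_add, map_smul, h1, h2]

variable (X) in
/-- The residues of a section at all the nodes. -/
noncomputable def residues (M : PlanarEmbedding G) :
    X.canonicalSections →ₗ[κ] (G.Dart → κ) where
  toFun s d := s.1 d.fst (X.dartNode d) / X.denom M d
  map_add' s t := by ext d; simp [add_div]
  map_smul' c s := by ext d; simp [mul_div_assoc]

theorem residues_apply (s : X.canonicalSections) (d : G.Dart) :
    X.residues M s d = X.residue (s.1 d.fst) d.fst d.snd := (residue_eq M hreg _ d).symm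

theorem residues_injective : Function.Injective (X.residues M) := by
  intro s t h
  apply Subtype.ext
  ext1 v
  obtain ⟨d, rfl⟩ := exists_dart hreg v
  have key : ∀ e : G.Dart, e.fst = d.fst → s.1 d.fst (X.dartNode e) = t.1 d.fst (X.dartNode e) := by
    intro e he
    have := congrFun h e
    simp only [residues, LinearMap.coe_mk, AddHom.coe_mk] at this
    rw [div_left_inj' (denom_ne_zero hreg e), he] at this
    exact this
  exact linearForm_ext hreg M d (key d rfl) (key _ (M.rot_fst d))

theorem exists_residues_eq_jump (c : M.Face → κ) :
    ∃ s : X.canonicalSections, X.residues M s = jump κ SimpleGraph.Dart.symm M.faceOf c := by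
  choose D hD using exists_dart (G := G) hreg
  set φ := jump κ SimpleGraph.Dart.symm M.faceOf c with hφ
  have hφr : ∀ d, φ d = c (M.faceOf d) - c (M.faceOf (M.rot d)) := fun d => by
    rw [← M.faceOf_symm]; rfl
  choose ℓ h0 h1 using fun v => exists_linearForm (bracket_rot_ne_zero (X := X) (M := M) hreg (D v))
    (φ (D v) * X.denom M (D v)) (φ (M.rot (D v)) * X.denom M (M.rot (D v)))
  have hres : ∀ d : G.Dart, ℓ d.fst (X.dartNode d) / X.denom M d = φ d := by
    intro d
    have e0 : ℓ d.fst (X.dartNode (D d.fst)) / X.denom M (D d.fst) = φ (D d.fst) := by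
      rw [h0, mul_div_cancel_right₀ _ (denom_ne_zero hreg _)]
    have e1 : ℓ d.fst (X.dartNode (M.rot (D d.fst))) / X.denom M (M.rot (D d.fst)) =
        φ (M.rot (D d.fst)) := by
      rw [h1, mul_div_cancel_right₀ _ (denom_ne_zero hreg _)]
    have e2 := sum_residue_rot (X := X) M hreg (ℓ d.fst) (D d.fst)
    rw [e0, e1] at e2
    rcases M.eq_rot_of_fst_eq hreg (hD d.fst).symm with h | h | h
    · rwa [← h] at e0
    · rwa [← h] at e1
    · rw [← h] at e2
      rw [eq_neg_of_add_eq_zero_right e2, hφr, hφr, hφr, ← h]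
      have : M.rot d = D d.fst := by
        conv_lhs => rw [h]
        exact M.rot_rot_rot hreg _
      rw [this]
      ring
  refine ⟨⟨ℓ, fun v u hvu => ?_⟩, funext hres⟩
  have r1 := (residue_eq M hreg (ℓ v) ⟨(v, u), hvu⟩).trans (hres ⟨(v, u), hvu⟩)
  have r2 := (residue_eq M hreg (ℓ u) ⟨(u, v), hvu.symm⟩).trans (hres ⟨(u, v), hvu.symm⟩)
  change X.residue (ℓ v) v u = _ at r1
  change X.residue (ℓ u) u v = _ at r2
  rw [r1, r2]
  change (c _ - c _) + (c _ - c _) = 0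
  simp only [SimpleGraph.Dart.symm, Prod.swap]
  ring

variable (hconn : ThreeConnected G)
include hconn

variable (X M o) in
/-- The sections whose residues are the boundaries of the interior faces are a basis. -/
theorem exists_basis : ∃ b : Module.Basis (M.IntFace o) κ X.canonicalSections,
    ∀ d F, X.residues M (b F) d = M.nodeVec κ o d F := by
  classical
  let E : (M.IntFace o → κ) →ₗ[κ] (M.Face → κ) :=
    { toFun := fun c F => if h : F = o then 0 else c ⟨F, h⟩
      map_add' := fun c c' => by ext F; by_cases h : F = o <;> simp [h]
      map_smul' := fun a c => by ext F; by_cases h : F = o <;> simp [h] }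
  let J := (jump κ SimpleGraph.Dart.symm M.faceOf).comp E
  have hJ : Function.Injective J := by
    refine (injective_iff_map_eq_zero _).2 fun c hc => ?_
    have := M.linked_faceOf κ hreg hconn (E c) (fun d => sub_eq_zero.1 (congrFun hc d))
    ext F
    have := this F.1 o
    simpa [E, F.2] using this
  have hrange : LinearMap.range (X.residues M) = LinearMap.range J := by
    apply le_antisymm
    · rintro _ ⟨s, rfl⟩
      obtain ⟨c, hc⟩ := M.exists_jump_faceOf_eq hreg hconn κ (φ := X.residues M s) (fun d => by
        have := s.2 d.fst d.snd d.adj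
        rw [residues_apply hreg, residues_apply hreg]
        exact (neg_eq_of_add_eq_zero_right this).symm) (by
        ext v
        obtain ⟨d, rfl⟩ := exists_dart hreg v
        have hfib : (Finset.univ.filter fun e : G.Dart => e.fst = d.fst) =
            {d, M.rot d, M.rot (M.rot d)} := by
          ext e
          simp only [Finset.mem_filter, Finset.mem_univ, true_and, Finset.mem_insert,
            Finset.mem_singleton]
          constructor
          · exact M.eq_rot_of_fst_eq hreg
          · rintro (rfl | rfl | rfl) <;> simp only [M.rot_fst]
        change ∑ e : G.Dart with e.fst = d.fst, X.residues M s e = 0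
        have n1 := M.rot_ne hreg d
        have n2 := M.rot_rot_ne hreg d
        have n3 := M.rot_ne hreg (M.rot d)
        rw [hfib, Finset.sum_insert (by simp [n1.symm, n2.symm]),
          Finset.sum_insert (by simp [n3.symm]), Finset.sum_singleton, ← add_assoc]
        have := sum_residue_rot (X := X) M hreg (s.1 d.fst) d
        simpa only [residues, LinearMap.coe_mk, AddHom.coe_mk, M.rot_fst] using this)
      refine ⟨fun F => c F.1 - c o, ?_⟩
      rw [← hc]
      have hE : ∀ F, E (fun F => c F.1 - c o) F = c F - c o := fun F => by
        by_cases h : F = o <;> simp [E, h]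
      ext d
      change E _ _ - E _ _ = c _ - c _
      rw [hE, hE]
      ring
    · rintro _ ⟨c, rfl⟩
      obtain ⟨s, hs⟩ := exists_residues_eq_jump (X := X) (M := M) hreg (E c)
      exact ⟨s, hs⟩
  let e1 := LinearEquiv.ofInjective J hJ
  let e2 := LinearEquiv.ofInjective (X.residues M) (residues_injective hreg)
  let e3 := LinearEquiv.ofEq _ _ hrange
  let b := Module.Basis.ofEquivFun (e2.trans (e3.trans e1.symm))
  refine ⟨b, fun d F => ?_⟩
  have h1 : e3 (e2 (b F)) = e1 (Pi.single F 1) := by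
    have h := Module.Basis.ofEquivFun_repr_apply (e2.trans (e3.trans e1.symm)) (b F)
    have : (e2.trans (e3.trans e1.symm)) (b F) = Pi.single F 1 := by
      ext i
      rw [← h i, Module.Basis.repr_self, Finsupp.single_eq_pi_single]
    rw [← this]
    simp
  have h2 := congrFun (congrArg Subtype.val h1) d
  change X.residues M (b F) d = E (Pi.single F 1) _ - E (Pi.single F 1) _ at h2
  rw [h2]
  have hE : ∀ H, E (Pi.single F 1) H = if F.1 = H then 1 else 0 := by
    intro H
    by_cases h : H = o
    · have : F.1 ≠ H := fun h' => F.2 (h'.trans h)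
      rw [if_neg this]
      simp [E, h]
    · simp only [E, LinearMap.coe_mk, AddHom.coe_mk, dif_neg h, Pi.single_apply, Subtype.ext_iff]
      simp only [eq_comm]
  rw [hE, hE]
  simp [nodeVec, edgeVec, Pi.single_apply]

variable {b : Module.Basis (M.IntFace o) κ X.canonicalSections}
  (hb : ∀ d F, X.residues M (b F) d = M.nodeVec κ o d F)
include hb

omit hconn in
theorem canonicalMap_dartNode (d : G.Dart) :
    X.canonicalMap b d.fst (X.dartNode d) = X.denom M d • M.nodeVec κ o d := by
  ext F
  have := hb d F
  simp only [residues, LinearMap.coe_mk, AddHom.coe_mk] at this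
  rw [div_eq_iff (denom_ne_zero hreg d)] at this
  simp [canonicalMap, this, mul_comm]

omit hconn in
theorem smul_canonicalMap (d : G.Dart) (q : Fin 2 → κ) :
    bracket (X.dartNode d) (X.dartNode (M.rot d)) • X.canonicalMap b d.fst q =
      (bracket q (X.dartNode (M.rot d)) * X.denom M d) • M.nodeVec κ o d +
      (bracket (X.dartNode d) q * X.denom M (M.rot d)) • M.nodeVec κ o (M.rot d) := by
  have h := canonicalMap_dartNode hreg hb (M.rot d)
  rw [M.rot_fst] at h
  rw [← map_smul, bracket_smul_eq, map_add, map_smul, map_smul,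
    canonicalMap_dartNode hreg hb, h, smul_smul, smul_smul]

theorem canonicalMap_injective (v : V) : Function.Injective (X.canonicalMap b v) := by
  obtain ⟨d, rfl⟩ := exists_dart hreg v
  refine (injective_iff_map_eq_zero _).2 fun q hq => ?_
  have h := smul_canonicalMap hreg hb d q
  rw [hq, smul_zero] at h
  set α := bracket q (X.dartNode (M.rot d)) * X.denom M d with hα
  set β := bracket (X.dartNode d) q * X.denom M (M.rot d) with hβ
  -- the two node vectors are independent, as seen in the coordinates of the first and third face
  have hz : ∀ F, α * M.edgeVec κ d F + β * M.edgeVec κ (M.rot d) F = 0 := by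
    intro F
    have hs : ∑ F, (α * M.edgeVec κ d F + β * M.edgeVec κ (M.rot d) F) = 0 := by
      rw [Finset.sum_add_distrib, ← Finset.mul_sum, ← Finset.mul_sum, M.sum_edgeVec κ d,
        M.sum_edgeVec κ (M.rot d), mul_zero, mul_zero, add_zero]
    rw [← extend_restrict (o := o) hs F]
    have : (fun F : M.IntFace o => α * M.edgeVec κ d F.1 + β * M.edgeVec κ (M.rot d) F.1) =
        fun _ => 0 := by
      rw [funext_iff] at h ⊢
      exact fun F => (h F).symm
    rw [this]
    simp [extend]
  have n1 := M.faceOf_rot_rot_ne hreg hconn d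
  have n2 := M.faceOf_rot_ne hreg hconn d
  have n3 := M.faceOf_rot_ne hreg hconn (M.rot d)
  have hα0 : α = 0 := by
    have := hz (M.faceOf d)
    simpa [edgeVec, Pi.single_apply, M.faceOf_symm, n1.symm, n2.symm] using this
  have hβ0 : β = 0 := by
    have := hz (M.faceOf (M.rot (M.rot d)))
    simpa [edgeVec, Pi.single_apply, M.faceOf_symm, n1, n2, n3] using this
  have hb0 := bracket_rot_ne_zero (X := X) (M := M) hreg d
  have h1 : bracket q (X.dartNode (M.rot d)) = 0 :=
    (mul_eq_zero.1 hα0).resolve_right (denom_ne_zero hreg _)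
  have h2 : bracket (X.dartNode d) q = 0 :=
    (mul_eq_zero.1 hβ0).resolve_right (denom_ne_zero hreg _)
  have h3 := bracket_smul_eq (X.dartNode d) (X.dartNode (M.rot d)) q
  rw [h1, h2, zero_smul, zero_smul, add_zero] at h3
  exact (smul_eq_zero.1 h3).resolve_left hb0

theorem range_canonicalMap (v : V) :
    LinearMap.range (X.canonicalMap b v) = M.lineSpace κ o v := by
  apply Submodule.eq_of_le_of_finrank_eq
  · rintro _ ⟨q, rfl⟩
    obtain ⟨d, rfl⟩ := exists_dart hreg v
    have h := smul_canonicalMap hreg hb d q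
    have hmem := M.nodeVec_mem κ o (M.rot d)
    rw [M.rot_fst] at hmem
    rw [← Submodule.smul_mem_iff _ (bracket_rot_ne_zero (X := X) (M := M) hreg d), h]
    exact Submodule.add_mem _ (Submodule.smul_mem _ _ (M.nodeVec_mem κ o d))
      (Submodule.smul_mem _ _ hmem)
  · rw [LinearMap.finrank_range_of_inj (canonicalMap_injective hreg hconn hb v),
      finrank_lineSpace hreg hconn]
    simp

omit hconn in
theorem sameProj_dartNode (d : G.Dart) :
    SameProj κ (X.canonicalMap b d.fst (X.dartNode d)) (M.nodeVec κ o d) := by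
  rw [canonicalMap_dartNode hreg hb]
  exact sameProj_smul (denom_ne_zero hreg d) _

omit [Fintype V] [DecidableEq V] [DecidableRel G.Adj] hreg hconn hb in
theorem sameProj_nodeVec_symm [Finite V] (d : G.Dart) :
    SameProj κ (M.nodeVec κ o d) (M.nodeVec κ o d.symm) := by
  have := Fintype.ofFinite V
  rw [nodeVec_symm, ← neg_one_smul κ]
  exact (sameProj_smul (by simp) _).symm

theorem isCanonicalEmbedding : X.IsCanonicalEmbedding b := by
  have hinj := canonicalMap_injective hreg hconn hb
  have hmem : ∀ v q, X.canonicalMap b v q ∈ M.lineSpace κ o v := fun v q => by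
    rw [← range_canonicalMap hreg hconn hb]
    exact ⟨q, rfl⟩
  have hne : ∀ v q, q ≠ 0 → X.canonicalMap b v q ≠ 0 := fun v q hq h =>
    hq (hinj v (h.trans (map_zero _).symm))
  refine ⟨hne, fun v q u q' hq hq' => ⟨fun h => ?_, ?_⟩⟩
  · by_cases hvu : v = u
    · subst hvu
      exact Or.inl ⟨rfl, (sameProj_map_iff (hinj v)).1 h⟩
    · have hu : X.canonicalMap b v q ∈ M.lineSpace κ o u := by
        have h1 : X.canonicalMap b v q ∈ Submodule.span κ {X.canonicalMap b u q'} :=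
          h ▸ Submodule.mem_span_singleton_self _
        exact (Submodule.span_singleton_le_iff_mem _ _).2 (hmem u q') h1
      obtain ⟨d, rfl, rfl, a, ha, hy⟩ :=
        exists_eq_smul_nodeVec hreg hconn hvu (hmem v q) hu (hne v q hq)
      have s1 : SameProj κ (X.canonicalMap b d.fst q) (M.nodeVec κ o d) := by
        rw [hy]; exact sameProj_smul ha _
      have s2 : SameProj κ (X.canonicalMap b d.snd q') (M.nodeVec κ o d.symm) :=
        (h.symm.trans s1).trans (sameProj_nodeVec_symm d)
      refine Or.inr ⟨d.adj, ?_, ?_⟩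
      · exact (sameProj_map_iff (hinj d.fst)).1 (s1.trans (sameProj_dartNode hreg hb d).symm)
      · exact (sameProj_map_iff (hinj d.snd)).1 (s2.trans (sameProj_dartNode hreg hb d.symm).symm)
  · rintro (⟨rfl, h⟩ | ⟨hadj, h1, h2⟩)
    · exact (sameProj_map_iff (hinj v)).2 h
    · let d : G.Dart := ⟨(v, u), hadj⟩
      have s1 := ((sameProj_map_iff (hinj v)).2 h1).trans (sameProj_dartNode hreg hb d)
      have s2 := ((sameProj_map_iff (hinj u)).2 h2).trans (sameProj_dartNode hreg hb d.symm)
      exact (s1.trans (sameProj_nodeVec_symm d)).trans s2.symm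

theorem componentIdeal_eq [Infinite κ] (v : V) :
    X.componentIdeal b v = lineIdeal κ M o v := by
  rw [componentIdeal, lineIdeal_eq_vanishingIdeal hreg hconn, ← range_canonicalMap hreg hconn hb,
    LinearMap.coe_range]

theorem imageIdeal_eq [Infinite κ] : X.imageIdeal b = schonIdeal κ M o := by
  rw [imageIdeal, vanishingIdeal_iUnion, schonIdeal]
  exact iInf_congr fun v => componentIdeal_eq hreg hconn hb v

end GraphCurve

/-! ### The topology of tropical projective space -/

section Topology

/-- The map `x ↦ -log x` from nonnegative reals to `ℝ ∪ {∞}`. Negative numbers are sent to `∞`,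
which makes the map antitone on the whole real line. -/
noncomputable def negLog (x : ℝ) : WithTop ℝ :=
  if x ≤ 0 then ⊤ else ((-Real.log x : ℝ) : WithTop ℝ)

/-- The map `w ↦ exp (-w)` from `ℝ ∪ {∞}` to the nonnegative reals. -/
noncomputable def expNeg (w : WithTop ℝ) : ℝ := w.recTopCoe 0 fun a => Real.exp (-a)

theorem expNeg_top : expNeg ⊤ = 0 := rfl

theorem expNeg_coe (a : ℝ) : expNeg (a : WithTop ℝ) = Real.exp (-a) := rfl

theorem expNeg_nonneg (w : WithTop ℝ) : 0 ≤ expNeg w := by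
  induction w using WithTop.recTopCoe with
  | top => exact le_rfl
  | coe a => exact (Real.exp_pos _).le

theorem negLog_of_nonpos {x : ℝ} (h : x ≤ 0) : negLog x = ⊤ := if_pos h

theorem negLog_of_pos {x : ℝ} (h : 0 < x) : negLog x = ((-Real.log x : ℝ) : WithTop ℝ) :=
  if_neg (not_le.2 h)

theorem negLog_eq_top_iff {x : ℝ} : negLog x = ⊤ ↔ x ≤ 0 :=
  ⟨fun h => by by_contra h'; rw [negLog_of_pos (not_le.1 h')] at h; exact WithTop.coe_ne_top h,
    negLog_of_nonpos⟩

theorem negLog_expNeg (w : WithTop ℝ) : negLog (expNeg w) = w := by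
  induction w using WithTop.recTopCoe with
  | top => exact negLog_of_nonpos le_rfl
  | coe a => rw [expNeg_coe, negLog_of_pos (Real.exp_pos _), Real.log_exp, neg_neg]

theorem expNeg_negLog {x : ℝ} (h : 0 ≤ x) : expNeg (negLog x) = x := by
  rcases h.eq_or_lt with rfl | h
  · rw [negLog_of_nonpos le_rfl, expNeg_top]
  · rw [negLog_of_pos h, expNeg_coe, neg_neg, Real.exp_log h]

theorem negLog_antitone : Antitone negLog := by
  intro x y hxy
  rcases le_or_gt x 0 with hx | hx
  · rw [negLog_of_nonpos hx]; exact le_top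
  · rw [negLog_of_pos hx, negLog_of_pos (hx.trans_le hxy), WithTop.coe_le_coe]
    exact neg_le_neg (Real.log_le_log hx hxy)

theorem expNeg_antitone : Antitone expNeg := by
  intro w w' h
  by_contra! h'
  have h1 := negLog_antitone h'.le
  rw [negLog_expNeg, negLog_expNeg] at h1
  rw [le_antisymm h h1] at h'
  exact lt_irrefl _ h'

theorem negLog_le_negLog_iff {x y : ℝ} (hx : 0 ≤ x) (hy : 0 ≤ y) :
    negLog x ≤ negLog y ↔ y ≤ x :=
  ⟨fun h => by simpa only [expNeg_negLog hx, expNeg_negLog hy] using expNeg_antitone h,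
    fun h => negLog_antitone h⟩

theorem continuous_negLog : Continuous negLog := by
  have h : Monotone (fun x => OrderDual.toDual (negLog x)) := fun x y hxy => negLog_antitone hxy
  exact h.continuous_of_surjective fun w =>
    ⟨expNeg (OrderDual.ofDual w), congrArg OrderDual.toDual (negLog_expNeg _)⟩

theorem continuous_expNeg : Continuous expNeg := by
  let g : WithTop ℝ → (Set.Ici (0 : ℝ))ᵒᵈ := fun w => OrderDual.toDual ⟨expNeg w, expNeg_nonneg w⟩
  have h : Monotone g := fun x y hxy => expNeg_antitone hxy
  have hg : Continuous g := h.continuous_of_surjective fun y =>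
    ⟨negLog (OrderDual.ofDual y).1, congrArg OrderDual.toDual (Subtype.ext (expNeg_negLog
      (OrderDual.ofDual y).2))⟩
  exact continuous_subtype_val.comp (continuous_ofDual.comp hg)

theorem expNeg_add_coe (w : WithTop ℝ) (c : ℝ) :
    expNeg (w + (c : WithTop ℝ)) = expNeg w * Real.exp (-c) := by
  induction w using WithTop.recTopCoe with
  | top => rw [WithTop.top_add, expNeg_top, zero_mul]
  | coe a => rw [← WithTop.coe_add, expNeg_coe, expNeg_coe, neg_add, Real.exp_add]

variable {ι : Type*} [Fintype ι]

theorem sum_expNeg_pos (w : TropVec ι) : 0 < ∑ i, expNeg (w.1 i) := by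
  obtain ⟨i, hi⟩ := w.2
  refine Finset.sum_pos' (fun _ _ => expNeg_nonneg _) ⟨i, Finset.mem_univ _, ?_⟩
  obtain ⟨a, ha⟩ := WithTop.ne_top_iff_exists.1 hi
  rw [← ha, expNeg_coe]
  exact Real.exp_pos _

/-- The exponential coordinates of a point of tropical projective space, normalized to sum `1`. They
embed tropical projective space as a simplex. -/
noncomputable def TP.toSimplex : TP ι → (ι → ℝ) :=
  Quotient.lift (s := tropSetoid ι) (fun w i => expNeg (w.1 i) / ∑ j, expNeg (w.1 j)) (by
    rintro w w' ⟨c, hc⟩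
    ext i
    simp only [hc, expNeg_add_coe, ← Finset.sum_mul]
    rw [mul_div_mul_right _ _ (Real.exp_pos _).ne'])

theorem TP.toSimplex_mk (w : TropVec ι) :
    TP.toSimplex (TP.mk w) = fun i => expNeg (w.1 i) / ∑ j, expNeg (w.1 j) := rfl

theorem TP.continuous_toSimplex : Continuous (TP.toSimplex (ι := ι)) := by
  refine Continuous.quotient_lift ?_ _
  have h : ∀ i : ι, Continuous fun w : TropVec ι => expNeg (w.1 i) := fun i =>
    continuous_expNeg.comp ((continuous_apply i).comp continuous_subtype_val)
  refine continuous_pi fun i => (h i).div (continuous_finsetSum _ fun j _ => h j) fun w =>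
    (sum_expNeg_pos w).ne'

theorem TP.toSimplex_injective : Function.Injective (TP.toSimplex (ι := ι)) := by
  intro p p' h
  obtain ⟨w, rfl⟩ := p.exists_mk
  obtain ⟨w', rfl⟩ := p'.exists_mk
  rw [TP.toSimplex_mk, TP.toSimplex_mk] at h
  have hS := sum_expNeg_pos w
  have hS' := sum_expNeg_pos w'
  rw [TP.mk_eq_mk_iff]
  refine ⟨-Real.log ((∑ j, expNeg (w'.1 j)) / ∑ j, expNeg (w.1 j)), fun i => ?_⟩
  rw [← negLog_expNeg (w'.1 i), ← negLog_expNeg (w.1 i + _), expNeg_add_coe, neg_neg,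
    Real.exp_log (div_pos hS' hS)]
  congr 1
  have := congrFun h i
  field_simp at this ⊢
  linarith

instance : T2Space (TP ι) :=
  T2Space.of_injective_continuous TP.toSimplex_injective TP.continuous_toSimplex

omit [Fintype ι]

/-- The point of tropical projective space with the homogeneous coordinates `-log y`. -/
noncomputable def TP.ofExp (y : {y : ι → ℝ // ∃ i, 0 < y i}) : TP ι :=
  TP.mk ⟨fun i => negLog (y.1 i), y.2.imp fun _ h => negLog_eq_top_iff.not.2 (not_le.2 h)⟩

theorem TP.continuous_ofExp : Continuous (TP.ofExp (ι := ι)) := by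
  refine continuous_quotient_mk'.comp (Continuous.subtype_mk ?_ _)
  exact continuous_pi fun i => continuous_negLog.comp
    ((continuous_apply i).comp continuous_subtype_val)

/-- The vectors with nonnegative entries and largest entry `1`. They represent the points of
tropical projective space uniquely. -/
structure IsNormalized (y : ι → ℝ) : Prop where
  nonneg : ∀ i, 0 ≤ y i
  le_one : ∀ i, y i ≤ 1
  exists_eq_one : ∃ i, y i = 1

theorem IsNormalized.exists_pos {y : ι → ℝ} (h : IsNormalized y) : ∃ i, 0 < y i :=
  h.exists_eq_one.imp fun i (hi : y i = 1) => by rw [hi]; exact one_pos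

theorem IsNormalized.eq_of_ofExp_eq {y y' : ι → ℝ} (h : IsNormalized y) (h' : IsNormalized y')
    (heq : TP.ofExp ⟨y, h.exists_pos⟩ = TP.ofExp ⟨y', h'.exists_pos⟩) : y = y' := by
  obtain ⟨c, hc⟩ := TP.mk_eq_mk_iff.1 heq
  have key : ∀ i, y' i = y i * Real.exp (-c) := fun i => by
    have := congrArg expNeg (hc i)
    rwa [expNeg_add_coe, expNeg_negLog (h'.nonneg i), expNeg_negLog (h.nonneg i)] at this
  obtain ⟨i, hi⟩ := h.exists_eq_one
  obtain ⟨j, hj⟩ := h'.exists_eq_one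
  have h1 : Real.exp (-c) ≤ 1 := by
    have := h'.le_one i
    rwa [key, hi, one_mul] at this
  have h2 : 1 ≤ Real.exp (-c) := by
    have := key j
    rw [hj] at this
    rw [this]
    exact mul_le_of_le_one_left (Real.exp_pos _).le (h.le_one j)
  ext i
  rw [key, le_antisymm h1 h2, mul_one]

theorem TP.exists_isNormalized [Finite ι] (p : TP ι) :
    ∃ (y : ι → ℝ) (h : IsNormalized y), TP.ofExp ⟨y, h.exists_pos⟩ = p := by
  obtain ⟨w, rfl⟩ := p.exists_mk
  obtain ⟨i₀, hi₀⟩ := w.2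
  have : Nonempty ι := ⟨i₀⟩
  obtain ⟨i, hi⟩ := Finite.exists_min w.1
  obtain ⟨a, ha⟩ := WithTop.ne_top_iff_exists.1
    ((hi i₀).trans_lt (lt_top_iff_ne_top.2 hi₀)).ne
  have hone : expNeg (w.1 i + ((-a : ℝ) : WithTop ℝ)) = 1 := by
    rw [expNeg_add_coe, ← ha, expNeg_coe, ← Real.exp_add]
    simp
  refine ⟨fun j => expNeg (w.1 j + ((-a : ℝ) : WithTop ℝ)),
    ⟨fun j => expNeg_nonneg _, fun j => ?_, i, hone⟩, ?_⟩
  · rw [← hone]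
    apply expNeg_antitone
    gcongr
    exact hi j
  · refine TP.mk_eq_mk_iff.2 ⟨a, fun j => ?_⟩
    change w.1 j = negLog (expNeg (w.1 j + ((-a : ℝ) : WithTop ℝ))) + (a : WithTop ℝ)
    rw [negLog_expNeg, add_assoc, ← WithTop.coe_add, neg_add_cancel, WithTop.coe_zero, add_zero]

end Topology

/-! ### Renaming the coordinates -/

section Reindex

variable {ι ι' κ : Type*} [Field κ]

/-- Renaming the coordinates of tropical projective space. -/
def TP.rename (e : ι ≃ ι') : TP ι → TP ι' :=
  Quotient.map' (s₁ := tropSetoid ι) (s₂ := tropSetoid ι')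
    (fun w => ⟨fun i => w.1 (e.symm i), by
      obtain ⟨i, hi⟩ := w.2; exact ⟨e i, by simpa using hi⟩⟩)
    fun _ _ ⟨c, hc⟩ => ⟨c, fun i => hc _⟩

theorem TP.rename_symm_rename (e : ι ≃ ι') (p : TP ι) : TP.rename e.symm (TP.rename e p) = p := by
  obtain ⟨w, rfl⟩ := p.exists_mk
  exact congrArg TP.mk (Subtype.ext (funext fun i => congrArg w.1 (e.symm_apply_apply i)))

theorem TP.continuous_rename (e : ι ≃ ι') : Continuous (TP.rename e) := by
  refine Continuous.quotient_map' (Continuous.subtype_mk ?_ _) _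
  exact continuous_pi fun i => (continuous_apply _).comp continuous_subtype_val

/-- Renaming the coordinates as a homeomorphism. -/
def TP.renameHomeomorph (e : ι ≃ ι') : TP ι ≃ₜ TP ι' where
  toFun := TP.rename e
  invFun := TP.rename e.symm
  left_inv := TP.rename_symm_rename e
  right_inv := TP.rename_symm_rename e.symm
  continuous_toFun := TP.continuous_rename e
  continuous_invFun := TP.continuous_rename e.symm

theorem weight_mapDomain (e : ι ≃ ι') (w : ι' → WithTop ℝ) (α : ι →₀ ℕ) :
    weight w (α.mapDomain e) = weight (fun i => w (e i)) α := by
  unfold weight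
  rw [Finsupp.sum_mapDomain_index_inj e.injective]

theorem TropVanishes.of_rename {e : ι ≃ ι'} {f : MvPolynomial ι κ} {w : ι' → WithTop ℝ}
    (h : TropVanishes (MvPolynomial.rename e f) w) : TropVanishes f (fun i => w (e i)) := by
  classical
  unfold TropVanishes at h
  rw [MvPolynomial.support_rename_of_injective e.injective] at h
  intro α hα hαw hmin
  obtain ⟨β, hβ, hne, heq⟩ := h (α.mapDomain e) (Finset.mem_image_of_mem _ hα)
    (by rwa [weight_mapDomain]) (fun β hβ => by
      obtain ⟨β, hβf, rfl⟩ := Finset.mem_image.1 hβ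
      rw [weight_mapDomain, weight_mapDomain]
      exact hmin β hβf)
  obtain ⟨β, hβf, rfl⟩ := Finset.mem_image.1 hβ
  rw [weight_mapDomain, weight_mapDomain] at heq
  exact ⟨β, hβf, fun h => hne (by rw [h]), heq⟩

theorem rename_mem_tropProj {e : ι ≃ ι'} {Z : Set (ι → κ)} {Z' : Set (ι' → κ)}
    (hZ : ∀ x ∈ Z, (fun i => x (e.symm i)) ∈ Z') {p : TP ι}
    (hp : p ∈ tropProj (MvPolynomial.vanishingIdeal κ Z)) :
    TP.rename e p ∈ tropProj (MvPolynomial.vanishingIdeal κ Z') := by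
  intro f hf n hn w' hw'
  have h1 : MvPolynomial.rename e.symm f ∈ MvPolynomial.vanishingIdeal κ Z := by
    rw [MvPolynomial.mem_vanishingIdeal_iff] at hf ⊢
    intro x hx
    rw [MvPolynomial.aeval_rename]
    exact hf _ (hZ x hx)
  have h2 := hp _ h1 n (hn.rename_isHomogeneous)
    ⟨fun i => w'.1 (e i), by obtain ⟨i, hi⟩ := w'.2; exact ⟨e.symm i, by simpa using hi⟩⟩ (by
      rw [← TP.rename_symm_rename e p, ← hw']
      rfl)
  have h3 := h2.of_rename
  simpa using h3

theorem rename_image_tropProj (e : ι ≃ ι') {Z : Set (ι → κ)} {Z' : Set (ι' → κ)}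
    (hZ : ∀ x ∈ Z, (fun i => x (e.symm i)) ∈ Z') (hZ' : ∀ x ∈ Z', (fun i => x (e i)) ∈ Z) :
    TP.rename e '' tropProj (MvPolynomial.vanishingIdeal κ Z) =
      tropProj (MvPolynomial.vanishingIdeal κ Z') := by
  apply Set.Subset.antisymm
  · rintro _ ⟨p, hp, rfl⟩
    exact rename_mem_tropProj hZ hp
  · intro p hp
    exact ⟨TP.rename e.symm p, rename_mem_tropProj (e := e.symm) hZ' hp,
      TP.rename_symm_rename e.symm p⟩

theorem IsTropicalLine.rename (e : ι ≃ ι') {S : Set (TP ι)} (h : IsTropicalLine κ S) :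
    IsTropicalLine κ (TP.rename e '' S) := by
  obtain ⟨W, hW, rfl⟩ := h
  let L := LinearEquiv.funCongrLeft κ κ e.symm
  refine ⟨W.map (L : (ι → κ) →ₗ[κ] (ι' → κ)), ?_, ?_⟩
  · rw [← hW]
    exact LinearEquiv.finrank_map_eq L W
  · refine rename_image_tropProj e (fun x hx => ⟨x, hx, rfl⟩) ?_
    rintro _ ⟨x, hx, rfl⟩
    convert hx using 2 with i
    change x (e.symm (e i)) = x i
    rw [e.symm_apply_apply]

theorem IsTropicalGraphCurve.rename {V : Type*} [Fintype V] {G : SimpleGraph V} (e : ι ≃ ι')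
    {S : Set (TP ι)} (h : IsTropicalGraphCurve κ G S) :
    IsTropicalGraphCurve κ G (TP.rename e '' S) := by
  obtain ⟨h1, ⟨T, hT, hline, rfl⟩, N, ⟨φ⟩⟩ := h
  refine ⟨(Nat.card_congr e.symm).trans h1, ⟨fun i => TP.rename e '' T i, ?_,
    fun i => (hline i).rename e, Set.image_iUnion⟩, N,
    ⟨φ.trans ((TP.renameHomeomorph e).image _)⟩⟩
  exact (Set.image_injective.2 (TP.renameHomeomorph e).injective).comp hT

namespace GraphCurve

variable {V : Type*} [Fintype V] [DecidableEq V] {G : SimpleGraph V}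
  [DecidableRel G.Adj] {X : GraphCurve κ G} {b : Module.Basis ι κ X.canonicalSections}

theorem canonicalMap_reindex (e : ι ≃ ι') (v : V) (q : Fin 2 → κ) :
    X.canonicalMap (b.reindex e) v q =
      LinearEquiv.funCongrLeft κ κ e.symm (X.canonicalMap b v q) := by
  ext i
  simp [canonicalMap, LinearEquiv.funCongrLeft]

theorem IsCanonicalEmbedding.reindex (h : X.IsCanonicalEmbedding b) (e : ι ≃ ι') :
    X.IsCanonicalEmbedding (b.reindex e) := by
  let L := LinearEquiv.funCongrLeft κ κ e.symm
  refine ⟨fun v q hq => ?_, fun v q u q' hq hq' => ?_⟩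
  · rw [canonicalMap_reindex]
    exact (map_ne_zero_iff L L.injective).2 (h.1 v q hq)
  · rw [canonicalMap_reindex, canonicalMap_reindex]
    exact (sameProj_map_iff (f := L.toLinearMap) L.injective).trans (h.2 v q u q' hq hq')

theorem tropProj_imageIdeal_reindex (e : ι ≃ ι') :
    tropProj (X.imageIdeal (b.reindex e)) = TP.rename e '' tropProj (X.imageIdeal b) := by
  symm
  refine rename_image_tropProj e ?_ ?_
  · rintro x hx
    obtain ⟨v, q, rfl⟩ := Set.mem_iUnion.1 hx
    exact Set.mem_iUnion.2 ⟨v, q, canonicalMap_reindex e v q⟩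
  · rintro x hx
    obtain ⟨v, q, rfl⟩ := Set.mem_iUnion.1 hx
    refine Set.mem_iUnion.2 ⟨v, q, ?_⟩
    rw [canonicalMap_reindex]
    ext i
    change _ = X.canonicalMap b v q (e.symm (e i))
    rw [e.symm_apply_apply]

end GraphCurve

end Reindex

/-! ### The arrangement of tropical lines as a geometric realization of the graph -/

namespace PlanarEmbedding

variable {V : Type*} [Fintype V] [DecidableEq V] {G : SimpleGraph V} [DecidableRel G.Adj]
  (M : PlanarEmbedding G) (o : M.Face)

/-- The face at the initial vertex of a dart that is opposite to its edge. -/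
def thirdFace (d : G.Dart) : M.Face := M.faceOf (M.rot (M.rot d))

/-- A dart is admissible if it does not lead from an exterior to an interior vertex. Every point of
the graph lies on the initial part of an admissible dart: on the first half of it if the two
vertices are both interior or both exterior, and anywhere on it if its final vertex alone is
exterior. -/
def Admissible (d : G.Dart) : Prop := M.Exterior o d.fst → M.Exterior o d.snd

open Classical in
/-- The barycentric coordinate at the initial vertex of a dart of the point with the parameter `r`.
For `r = 1` it is `1`. -/
noncomputable def cellCoord (d : G.Dart) (r : ℝ) : ℝ :=
  if ¬ M.Exterior o d.fst ∧ M.Exterior o d.snd then r else (1 + r) / 2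

omit [Fintype V] [DecidableRel G.Adj] in
variable (G) in
/-- The point of an edge with the barycentric coordinates `a` and `1 - a`. -/
def edgePoint (d : G.Dart) (a : ℝ) : V → ℝ := Pi.single d.fst a + Pi.single d.snd (1 - a)

/-- The point of the graph with the parameter `r` in the part belonging to an admissible dart. -/
noncomputable def cellPoint (d : G.Dart) (r : ℝ) : V → ℝ := edgePoint G d (M.cellCoord o d r)

open Classical in
/-- The point of the tropical line of the initial vertex of a dart that corresponds to the parameter
`r`: in exponential coordinates, it is `1` on the two faces at the edge and `r` on the third face.
-/
noncomputable def cellVec (d : G.Dart) (r : ℝ) (F : M.IntFace o) : ℝ :=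
  if F.1 = M.thirdFace d then r else if M.Incident d.fst F.1 then 1 else 0

open Classical in
/-- The exponential coordinates of the map from the geometric realization of the graph to the
tropical arrangement. The vertices on the face `F` and those off the face are weighed against each
other, separately among the interior and among the exterior vertices. -/
noncomputable def height (x : V → ℝ) (F : M.IntFace o) : ℝ :=
  max 0 (∑ v, (if M.Exterior o v then 0 else if M.Incident v F.1 then 1 else -1) * x v) +
    max 0 (∑ v, (if M.Exterior o v then if M.Incident v F.1 then 1 else -1 else 0) * x v)

omit [DecidableEq V] [DecidableRel G.Adj] in
theorem continuous_height : Continuous (M.height o) := by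
  refine continuous_pi fun F => ?_
  unfold height
  fun_prop

omit [DecidableRel G.Adj] in
theorem sum_mul_edgePoint (g : V → ℝ) (d : G.Dart) (a : ℝ) :
    ∑ v, g v * edgePoint G d a v = g d.fst * a + g d.snd * (1 - a) := by
  simp [edgePoint, mul_add, Finset.sum_add_distrib, Pi.single_apply]

variable {M o}
variable (hreg : G.IsRegularOfDegree 3) (hconn : ThreeConnected G)

include hreg

theorem incident_fst_iff (d : G.Dart) (F : M.Face) :
    M.Incident d.fst F ↔ F = M.faceOf d ∨ F = M.faceOf d.symm ∨ F = M.thirdFace d := by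
  rw [M.faceOf_symm]
  exact M.incident_iff hreg d F

theorem incident_thirdFace (d : G.Dart) : M.Incident d.fst (M.thirdFace d) :=
  (incident_fst_iff hreg d _).2 (by simp)

theorem exists_admissible (v : V) : ∃ d : G.Dart, d.fst = v ∧ M.Admissible o d := by
  by_cases hv : M.Exterior o v
  · obtain ⟨d, hd, rfl⟩ := hv
    exact ⟨d, hd, fun _ => M.incident_snd d⟩
  · obtain ⟨d, rfl⟩ := exists_dart hreg v
    exact ⟨d, rfl, fun h => absurd h hv⟩

include hconn

theorem thirdFace_ne (d : G.Dart) : M.thirdFace d ≠ M.faceOf d :=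
  M.faceOf_rot_rot_ne hreg hconn d

theorem thirdFace_ne_symm (d : G.Dart) : M.thirdFace d ≠ M.faceOf d.symm := by
  rw [M.faceOf_symm]
  exact M.faceOf_rot_ne hreg hconn (M.rot d)

theorem not_incident_snd_thirdFace (d : G.Dart) : ¬ M.Incident d.snd (M.thirdFace d) := fun h =>
  d.adj.ne (M.eq_of_incident hreg hconn d (M.incident_snd d)
    (by rw [← M.faceOf_symm]; exact M.incident_snd_symm d) h)

theorem Admissible.thirdFace_ne_outer {d : G.Dart} (hd : M.Admissible o d) :
    M.thirdFace d ≠ o := by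
  intro h
  have h1 : M.Exterior o d.fst := h ▸ incident_thirdFace hreg d
  rcases M.outer_of_exterior hreg hconn d h1 (hd h1) with h2 | h2
  · exact thirdFace_ne hreg hconn d (h.trans h2)
  · exact thirdFace_ne_symm hreg hconn d (h.trans h2)

theorem cellVec_eq_one {d : G.Dart} {r : ℝ} {F : M.IntFace o}
    (hF : F.1 = M.faceOf d ∨ F.1 = M.faceOf d.symm) : M.cellVec o d r F = 1 := by
  have h1 : F.1 ≠ M.thirdFace d := by
    rcases hF with h | h <;> rw [h]
    exacts [(thirdFace_ne hreg hconn d).symm, (thirdFace_ne_symm hreg hconn d).symm]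
  have h2 : M.Incident d.fst F.1 := (incident_fst_iff hreg d _).2 (by tauto)
  rw [cellVec, if_neg h1, if_pos h2]

omit [Fintype V] [DecidableEq V] [DecidableRel G.Adj] hreg hconn in
theorem cellVec_thirdFace {d : G.Dart} {r : ℝ} {F : M.IntFace o} (hF : F.1 = M.thirdFace d) :
    M.cellVec o d r F = r := if_pos hF

omit hconn in
theorem cellVec_eq_zero {d : G.Dart} {r : ℝ} {F : M.IntFace o} (hF : ¬ M.Incident d.fst F.1) :
    M.cellVec o d r F = 0 := by
  have h : F.1 ≠ M.thirdFace d := fun h => hF (h ▸ incident_thirdFace hreg d)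
  rw [cellVec, if_neg h, if_neg hF]

theorem isNormalized_cellVec {d : G.Dart} {r : ℝ} (h0 : 0 ≤ r) (h1 : r ≤ 1) :
    IsNormalized (M.cellVec o d r) := by
  refine ⟨fun F => ?_, fun F => ?_, ?_⟩
  · unfold cellVec
    split_ifs <;> simp [h0]
  · unfold cellVec
    split_ifs <;> simp [h1]
  · by_cases h : M.faceOf d = o
    · have h' : M.faceOf d.symm ≠ o := h ▸ (M.faceOf_ne_faceOf_symm hreg hconn d).symm
      exact ⟨⟨_, h'⟩, cellVec_eq_one hreg hconn (Or.inr rfl)⟩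
    · exact ⟨⟨_, h⟩, cellVec_eq_one hreg hconn (Or.inl rfl)⟩

/-- The map to the arrangement takes the point with parameter `r` belonging to a dart to the
corresponding point of the tropical line. -/
theorem height_cellPoint {d : G.Dart} (hd : M.Admissible o d) {r : ℝ} (h0 : 0 ≤ r) (h1 : r ≤ 1) :
    M.height o (M.cellPoint o d r) = M.cellVec o d r := by
  classical
  ext F
  rw [height, cellPoint, sum_mul_edgePoint, sum_mul_edgePoint]
  -- on the two faces of the edge, the third face, and the other faces
  rcases (show (F.1 = M.faceOf d ∨ F.1 = M.faceOf d.symm) ∨ F.1 = M.thirdFace d ∨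
      ¬ M.Incident d.fst F.1 by rw [incident_fst_iff hreg]; tauto) with hF | hF | hF
  · have i1 : M.Incident d.fst F.1 := (incident_fst_iff hreg d _).2 (by tauto)
    have i2 : M.Incident d.snd F.1 := by
      rcases hF with h | h <;> rw [h]
      exacts [M.incident_snd d, M.incident_snd_symm d]
    rw [cellVec_eq_one hreg hconn hF]
    by_cases e1 : M.Exterior o d.fst <;> by_cases e2 : M.Exterior o d.snd
    · simp [cellCoord, e1, e2, i1, i2]
    · exact absurd (hd e1) e2
    · simp [cellCoord, e1, e2, i1, i2, h0, h1]
    · simp [cellCoord, e1, e2, i1, i2]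
  · have i1 : M.Incident d.fst F.1 := hF ▸ incident_thirdFace hreg d
    have i2 : ¬ M.Incident d.snd F.1 := hF ▸ not_incident_snd_thirdFace hreg hconn d
    rw [cellVec_thirdFace hF]
    by_cases e1 : M.Exterior o d.fst <;> by_cases e2 : M.Exterior o d.snd
    · simp [cellCoord, e1, e2, i1, i2]
      rw [max_eq_right] <;> linarith
    · exact absurd (hd e1) e2
    · simp [cellCoord, e1, e2, i1, i2, h0, h1]
    · simp [cellCoord, e1, e2, i1, i2]
      rw [max_eq_right] <;> linarith
  · rw [cellVec_eq_zero hreg hF]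
    by_cases e1 : M.Exterior o d.fst <;> by_cases e2 : M.Exterior o d.snd
    · by_cases i2 : M.Incident d.snd F.1
      · simp [cellCoord, e1, e2, hF, i2]; linarith
      · simp [cellCoord, e1, e2, hF, i2]
    · exact absurd (hd e1) e2
    · -- the outer face is the third face at an exterior end point of the edge
      have i2 : ¬ M.Incident d.snd F.1 := by
        intro i2
        rcases (incident_fst_iff hreg d.symm F.1).1 i2 with h | h | h
        · exact hF (h ▸ M.incident_fst_symm d)
        · rw [SimpleGraph.Dart.symm_symm] at h
          exact hF (h ▸ M.incident_fst d)
        · rcases (incident_fst_iff hreg d.symm o).1 e2 with h' | h' | h'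
          · exact e1 (h' ▸ M.incident_fst_symm d)
          · rw [SimpleGraph.Dart.symm_symm] at h'
            exact e1 (h' ▸ M.incident_fst d)
          · exact F.2 (h.trans h'.symm)
      simp [cellCoord, e1, e2, hF, i2, h0, h1]
    · by_cases i2 : M.Incident d.snd F.1
      · simp [cellCoord, e1, e2, hF, i2]; linarith
      · simp [cellCoord, e1, e2, hF, i2]

omit [DecidableRel G.Adj] [Fintype V] hreg hconn in
theorem cellPoint_one (d : G.Dart) : M.cellPoint o d 1 = Pi.single d.fst 1 := by
  have : M.cellCoord o d 1 = 1 := by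
    unfold cellCoord
    split_ifs <;> norm_num
  simp [cellPoint, edgePoint, this]

omit [DecidableRel G.Adj] [Fintype V] hreg hconn in
theorem edgePoint_symm (d : G.Dart) (a : ℝ) : edgePoint G d.symm (1 - a) = edgePoint G d a := by
  simp [edgePoint, add_comm]

omit hconn in
theorem exists_eq_cellPoint {x : V → ℝ} (hx : x ∈ realization G) :
    ∃ (d : G.Dart) (r : ℝ), M.Admissible o d ∧ 0 ≤ r ∧ r ≤ 1 ∧ x = M.cellPoint o d r := by
  obtain ⟨⟨hpos, hsum⟩, u, v, huv, hzero⟩ := hx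
  rcases huv with rfl | huv
  · obtain ⟨d, rfl, hd⟩ := exists_admissible (o := o) hreg u
    refine ⟨d, 1, hd, zero_le_one, le_rfl, ?_⟩
    rw [cellPoint_one]
    have h : ∀ w, w ≠ d.fst → x w = 0 := fun w hw => hzero w hw hw
    rw [Finset.sum_eq_single_of_mem d.fst (Finset.mem_univ _) fun w _ hw => h w hw] at hsum
    ext w
    by_cases hw : w = d.fst
    · subst hw; simp [hsum]
    · simp [hw, h w hw]
  · let d : G.Dart := ⟨(u, v), huv⟩
    have hs : x u + x v = 1 := by
      rw [← hsum, ← Finset.sum_pair huv.ne]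
      refine Finset.sum_subset (Finset.subset_univ _) fun w _ hw => ?_
      simp only [Finset.mem_insert, Finset.mem_singleton, not_or] at hw
      exact hzero w hw.1 hw.2
    have hx : x = edgePoint G d (x u) := by
      ext w
      have hv : 1 - x u = x v := by linarith
      change _ = (Pi.single u (x u) + Pi.single v (1 - x u) : V → ℝ) w
      by_cases h1 : w = u
      · subst h1; simp [huv.ne]
      · by_cases h2 : w = v
        · subst h2; simp [huv.ne.symm, hv]
        · simp [h1, h2, hzero w h1 h2]
    have hx' : x = edgePoint G d.symm (x v) := by
      rw [← edgePoint_symm, SimpleGraph.Dart.symm_symm, ← eq_sub_of_add_eq hs]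
      exact hx
    have pu := hpos u
    have pv := hpos v
    by_cases e1 : M.Exterior o u <;> by_cases e2 : M.Exterior o v
    · rcases le_total (x v) (x u) with h | h
      · refine ⟨d, 2 * x u - 1, fun _ => e2, by linarith, by linarith, ?_⟩
        have : M.cellCoord o d (2 * x u - 1) = x u := by simp [cellCoord, d, e1]
        rw [cellPoint, this]; exact hx
      · refine ⟨d.symm, 2 * x v - 1, fun _ => e1, by linarith, by linarith, ?_⟩
        have : M.cellCoord o d.symm (2 * x v - 1) = x v := by simp [cellCoord, d, e2]
        rw [cellPoint, this]; exact hx'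
    · refine ⟨d.symm, x v, fun _ => e1, pv, by linarith, ?_⟩
      have : M.cellCoord o d.symm (x v) = x v := by simp [cellCoord, d, e1, e2]
      rw [cellPoint, this]; exact hx'
    · refine ⟨d, x u, fun _ => e2, pu, by linarith, ?_⟩
      have : M.cellCoord o d (x u) = x u := by simp [cellCoord, d, e1, e2]
      rw [cellPoint, this]; exact hx
    · rcases le_total (x v) (x u) with h | h
      · refine ⟨d, 2 * x u - 1, fun h => absurd h e1, by linarith, by linarith, ?_⟩
        have : M.cellCoord o d (2 * x u - 1) = x u := by simp [cellCoord, d, e2]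
        rw [cellPoint, this]; exact hx
      · refine ⟨d.symm, 2 * x v - 1, fun h => absurd h e2, by linarith, by linarith, ?_⟩
        have : M.cellCoord o d.symm (2 * x v - 1) = x v := by simp [cellCoord, d, e1]
        rw [cellPoint, this]; exact hx'

omit [Fintype V] [DecidableEq V] [DecidableRel G.Adj] hreg hconn in
/-- Two sets of faces of the same size are equal if they contain the same interior faces. -/
theorem finset_eq_of_forall_ne {A B : Finset M.Face} (hcard : A.card = B.card)
    (h : ∀ F, F ≠ o → (F ∈ A ↔ F ∈ B)) : A = B := by
  have he : A.erase o = B.erase o := by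
    ext F
    simp only [Finset.mem_erase]
    exact and_congr_right fun hF => h F hF
  by_cases hA : o ∈ A <;> by_cases hB : o ∈ B
  · rw [← Finset.insert_erase hA, ← Finset.insert_erase hB, he]
  · have := Finset.card_erase_lt_of_mem hA
    rw [he, Finset.erase_eq_of_notMem hB] at this
    omega
  · have := Finset.card_erase_lt_of_mem hB
    rw [← he, Finset.erase_eq_of_notMem hA] at this
    omega
  · rwa [Finset.erase_eq_of_notMem hA, Finset.erase_eq_of_notMem hB] at he

/-- A vertex is determined by its interior faces. -/
theorem eq_of_forall_ne_outer {v u : V}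
    (h : ∀ F, F ≠ o → (M.Incident v F ↔ M.Incident u F)) : v = u := by
  obtain ⟨d, rfl⟩ := exists_dart hreg v
  obtain ⟨d', rfl⟩ := exists_dart hreg u
  have hset : ({M.thirdFace d, M.faceOf d, M.faceOf d.symm} : Finset M.Face) =
      {M.thirdFace d', M.faceOf d', M.faceOf d'.symm} := by
    refine finset_eq_of_forall_ne (o := o) ?_ fun F hF => ?_
    · rw [Finset.card_eq_three.2 ⟨_, _, _, thirdFace_ne hreg hconn d,
        thirdFace_ne_symm hreg hconn d, M.faceOf_ne_faceOf_symm hreg hconn d, rfl⟩,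
        Finset.card_eq_three.2 ⟨_, _, _, thirdFace_ne hreg hconn d',
        thirdFace_ne_symm hreg hconn d', M.faceOf_ne_faceOf_symm hreg hconn d', rfl⟩]
    · have := h F hF
      rw [incident_fst_iff hreg, incident_fst_iff hreg] at this
      simp only [Finset.mem_insert, Finset.mem_singleton]
      tauto
  have hmem : ∀ F, M.Incident d.fst F → M.Incident d'.fst F := fun F hF => by
    rw [incident_fst_iff hreg] at hF ⊢
    have := Finset.ext_iff.1 hset F
    simp only [Finset.mem_insert, Finset.mem_singleton] at this
    tauto
  exact M.eq_of_incident hreg hconn d (hmem _ (M.incident_fst d))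
    (hmem _ ((M.incident_iff hreg d _).2 (by simp)))
    (hmem _ ((M.incident_iff hreg d _).2 (by simp)))

theorem cellVec_eq_one_iff {d : G.Dart} {r : ℝ} (hr : r < 1) (F : M.IntFace o) :
    M.cellVec o d r F = 1 ↔ F.1 = M.faceOf d ∨ F.1 = M.faceOf d.symm := by
  refine ⟨fun h => ?_, cellVec_eq_one hreg hconn⟩
  unfold cellVec at h
  split_ifs at h with h1 h2
  · exact absurd h hr.ne
  · rw [incident_fst_iff hreg] at h2
    tauto
  · norm_num at h

omit hconn in
theorem cellVec_one {d : G.Dart} (F : M.IntFace o) [Decidable (M.Incident d.fst F.1)] :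
    M.cellVec o d 1 F = if M.Incident d.fst F.1 then 1 else 0 := by
  unfold cellVec
  by_cases h : F.1 = M.thirdFace d
  · rw [if_pos h, if_pos (h ▸ incident_thirdFace hreg d)]
  · rw [if_neg h]
    split_ifs <;> rfl

omit hconn in
theorem cellVec_one_eq_one_iff {d : G.Dart} (F : M.IntFace o) :
    M.cellVec o d 1 F = 1 ↔ M.Incident d.fst F.1 := by
  classical
  rw [cellVec_one hreg]
  split_ifs with h <;> simp [h]

/-- Points with parameters less than `1` coincide only if they belong to the same edge. -/
theorem cellPoint_eq_of_lt {d d' : G.Dart} (hd : M.Admissible o d) (hd' : M.Admissible o d')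
    {r r' : ℝ} (hr : r < 1) (hr' : r' < 1) (heq : M.cellVec o d r = M.cellVec o d' r') :
    M.cellPoint o d r = M.cellPoint o d' r' := by
  have hset : ({M.faceOf d, M.faceOf d.symm} : Finset M.Face) =
      {M.faceOf d', M.faceOf d'.symm} := by
    refine finset_eq_of_forall_ne (o := o) ?_ fun F hF => ?_
    · rw [Finset.card_pair (M.faceOf_ne_faceOf_symm hreg hconn d),
        Finset.card_pair (M.faceOf_ne_faceOf_symm hreg hconn d')]
    · simp only [Finset.mem_insert, Finset.mem_singleton]
      rw [← cellVec_eq_one_iff hreg hconn hr ⟨F, hF⟩, heq,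
        cellVec_eq_one_iff hreg hconn hr' ⟨F, hF⟩]
  have hmem : ∀ F, (F = M.faceOf d ∨ F = M.faceOf d.symm) ↔
      (F = M.faceOf d' ∨ F = M.faceOf d'.symm) := fun F => by
    simpa using Finset.ext_iff.1 hset F
  have hcases : d' = d ∨ d' = d.symm := by
    have hne := M.faceOf_ne_faceOf_symm hreg hconn d'
    rcases (hmem (M.faceOf d')).2 (Or.inl rfl) with h1 | h1 <;>
      rcases (hmem (M.faceOf d'.symm)).2 (Or.inr rfl) with h2 | h2
    · exact absurd (h1.trans h2.symm) hne
    · exact Or.inl (M.dart_eq_of_faceOf_eq hreg hconn h1 h2)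
    · refine Or.inr (M.dart_eq_of_faceOf_eq hreg hconn h1 ?_)
      rwa [SimpleGraph.Dart.symm_symm]
    · exact absurd (h1.trans h2.symm) hne
  have ho := hd.thirdFace_ne_outer hreg hconn
  have hv := congrFun heq ⟨_, ho⟩
  rw [cellVec_thirdFace rfl] at hv
  rcases hcases with rfl | rfl
  · rw [cellVec_thirdFace rfl] at hv
    rw [hv]
  · have ho' := hd'.thirdFace_ne_outer hreg hconn
    have hv' := congrFun heq ⟨_, ho'⟩
    rw [cellVec_thirdFace (d := d.symm) rfl, cellVec_eq_zero hreg (by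
      simpa using not_incident_snd_thirdFace hreg hconn d.symm)] at hv'
    rw [cellVec_eq_zero hreg (d := d.symm) (by
      simpa using not_incident_snd_thirdFace hreg hconn d)] at hv
    rw [hv, ← hv', cellPoint, cellPoint, ← edgePoint_symm]
    congr 1
    have h1 : ¬ (¬ M.Exterior o d.fst ∧ M.Exterior o d.snd) := fun h => h.1 (hd' h.2)
    have h2 : ¬ (¬ M.Exterior o d.symm.fst ∧ M.Exterior o d.symm.snd) := fun h => h.1 (hd h.2)
    rw [cellCoord, cellCoord, if_neg h1, if_neg h2]
    norm_num

/-- A vertex coincides with a point of parameter less than `1` only if it is an exterior vertex at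
the end of the edge that leads to it from an interior vertex. -/
theorem cellPoint_one_eq_of_lt {d d' : G.Dart} (hd' : M.Admissible o d') {r' : ℝ} (hr' : r' < 1)
    (heq : M.cellVec o d 1 = M.cellVec o d' r') : M.cellPoint o d 1 = M.cellPoint o d' r' := by
  classical
  have hiff : ∀ F, F ≠ o → (M.Incident d.fst F ↔ F = M.faceOf d' ∨ F = M.faceOf d'.symm) :=
    fun F hF => by
      rw [← cellVec_one_eq_one_iff hreg ⟨F, hF⟩, heq, cellVec_eq_one_iff hreg hconn hr' ⟨F, hF⟩]
  have n1 : M.thirdFace d ≠ _ := thirdFace_ne hreg hconn d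
  have n2 : M.thirdFace d ≠ _ := thirdFace_ne_symm hreg hconn d
  have n3 := M.faceOf_ne_faceOf_symm hreg hconn d
  have hpair := M.faceOf_ne_faceOf_symm hreg hconn d'
  -- counting faces: one of the three faces at the vertex is the outer face
  have hext : M.Exterior o d.fst := by
    by_contra hv
    have hsub : ({M.thirdFace d, M.faceOf d, M.faceOf d.symm} : Finset M.Face) ⊆
        {M.faceOf d', M.faceOf d'.symm} := by
      intro F hF
      have hF' : M.Incident d.fst F := by
        rw [incident_fst_iff hreg]
        simp only [Finset.mem_insert, Finset.mem_singleton] at hF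
        tauto
      have hFo : F ≠ o := by
        rintro rfl
        exact hv hF'
      simpa using (hiff F hFo).1 hF'
    have h3 := Finset.card_le_card hsub
    rw [Finset.card_eq_three.2 ⟨_, _, _, n1, n2, n3, rfl⟩, Finset.card_pair hpair] at h3
    omega
  have hout : o ≠ M.faceOf d' ∧ o ≠ M.faceOf d'.symm := by
    have hset : ({M.faceOf d', M.faceOf d'.symm} : Finset M.Face) =
        ({M.thirdFace d, M.faceOf d, M.faceOf d.symm} : Finset M.Face).erase o := by
      symm
      refine finset_eq_of_forall_ne (o := o) ?_ fun F hF => ?_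
      · rw [Finset.card_erase_of_mem, Finset.card_eq_three.2 ⟨_, _, _, n1, n2, n3, rfl⟩,
          Finset.card_pair hpair]
        have := (incident_fst_iff hreg d o).1 hext
        simp only [Finset.mem_insert, Finset.mem_singleton]
        tauto
      · have := hiff F hF
        rw [incident_fst_iff hreg] at this
        simp only [Finset.mem_erase, Finset.mem_insert, Finset.mem_singleton]
        tauto
    have : o ∉ ({M.faceOf d', M.faceOf d'.symm} : Finset M.Face) := by
      rw [hset]
      exact Finset.notMem_erase _ _
    simpa only [Finset.mem_insert, Finset.mem_singleton, not_or] using this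
  have iL := (hiff _ hout.1.symm).2 (Or.inl rfl)
  have iR := (hiff _ hout.2.symm).2 (Or.inr rfl)
  have hfst : d'.fst ≠ d.fst := by
    intro h
    have ho : M.Incident d'.fst o := h ▸ hext
    rcases (incident_fst_iff hreg d' o).1 ho with h1 | h1 | h1
    exacts [hout.1 h1, hout.2 h1, hd'.thirdFace_ne_outer hreg hconn h1.symm]
  obtain ⟨e, he1, he2, he⟩ := M.exists_dart_of_incident_incident hreg hconn hfst hpair
    (M.incident_fst d') (M.incident_fst_symm d') iL iR
  have hed : e = d' := by
    rcases he with ⟨h1, h2⟩ | ⟨h1, h2⟩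
    · exact M.dart_eq_of_faceOf_eq hreg hconn h1 h2
    · have := M.dart_eq_of_faceOf_eq hreg hconn (d' := d'.symm) h1
        (by rwa [SimpleGraph.Dart.symm_symm])
      rw [this] at he1
      exact absurd he1 d'.adj.ne'
  subst hed
  have hint : ¬ M.Exterior o e.fst := by
    intro h
    rcases M.outer_of_exterior hreg hconn e h (he2 ▸ hext) with h1 | h1
    exacts [hout.1 h1, hout.2 h1]
  have hr0 : r' = 0 := by
    have := congrFun heq ⟨_, hd'.thirdFace_ne_outer hreg hconn⟩
    rw [cellVec_thirdFace (d := e) rfl, cellVec_one hreg] at this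
    split_ifs at this
    · exact absurd this hr'.ne'
    · exact this.symm
  rw [cellPoint_one, cellPoint, cellCoord, if_pos ⟨hint, he2 ▸ hext⟩, hr0, edgePoint, ← he2]
  simp

theorem cellPoint_eq_of_cellVec_eq {d d' : G.Dart} (hd : M.Admissible o d)
    (hd' : M.Admissible o d') {r r' : ℝ} (hr : r ≤ 1) (hr' : r' ≤ 1)
    (heq : M.cellVec o d r = M.cellVec o d' r') : M.cellPoint o d r = M.cellPoint o d' r' := by
  rcases hr.eq_or_lt with rfl | hr <;> rcases hr'.eq_or_lt with rfl | hr'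
  · rw [cellPoint_one, cellPoint_one]
    congr 1
    refine eq_of_forall_ne_outer (o := o) hreg hconn fun F hF => ?_
    rw [← cellVec_one_eq_one_iff hreg ⟨F, hF⟩, heq, cellVec_one_eq_one_iff hreg ⟨F, hF⟩]
  · exact cellPoint_one_eq_of_lt hreg hconn hd' hr' heq
  · exact (cellPoint_one_eq_of_lt hreg hconn hd hr heq.symm).symm
  · exact cellPoint_eq_of_lt hreg hconn hd hd' hr hr' heq

end PlanarEmbedding

/-! ### The homeomorphism with the graph -/

namespace PlanarEmbedding

variable {V : Type*} [Fintype V] [DecidableEq V] {G : SimpleGraph V} [DecidableRel G.Adj]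
  {M : PlanarEmbedding G} {o : M.Face} {κ : Type*} [Field κ]

omit [Fintype V] [DecidableEq V] [DecidableRel G.Adj] in
theorem onTropLine_negLog_iff {v : V} {y : M.IntFace o → ℝ} (hy : IsNormalized y) :
    OnTropLine v (fun F => negLog (y F)) ↔
      (∀ F : M.IntFace o, ¬ M.Incident v F.1 → y F = 0) ∧
      (¬ M.Exterior o v → ∃ F F' : M.IntFace o, F ≠ F' ∧ M.Incident v F.1 ∧ M.Incident v F'.1 ∧
        y F = 1 ∧ y F' = 1) := by
  refine and_congr (forall₂_congr fun F _ => ?_) (imp_congr_right fun _ =>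
    exists₂_congr fun F F' => and_congr_right fun _ => and_congr_right fun _ =>
      and_congr_right fun _ => ?_)
  · rw [negLog_eq_top_iff]
    exact ⟨fun h => le_antisymm h (hy.nonneg F), fun h => h.le⟩
  · constructor
    · rintro ⟨he, hmin⟩
      beta_reduce at he hmin
      obtain ⟨K, hK⟩ := hy.exists_eq_one
      have h1 : y F = 1 := le_antisymm (hy.le_one F)
        (hK ▸ (negLog_le_negLog_iff (hy.nonneg F) (hy.nonneg K)).1 (hmin K))
      refine ⟨h1, ?_⟩
      rw [← expNeg_negLog (hy.nonneg F'), ← he, expNeg_negLog (hy.nonneg F), h1]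
    · rintro ⟨h1, h2⟩
      refine ⟨by beta_reduce; rw [h1, h2], fun K => ?_⟩
      beta_reduce
      rw [negLog_le_negLog_iff (hy.nonneg F) (hy.nonneg K), h1]
      exact hy.le_one K

variable (hreg : G.IsRegularOfDegree 3) (hconn : ThreeConnected G)
include hreg hconn

theorem ofExp_mem_tropLine_iff {v : V} {y : M.IntFace o → ℝ} (hy : IsNormalized y) :
    TP.ofExp ⟨y, hy.exists_pos⟩ ∈ tropLine κ M o v ↔
      (∀ F : M.IntFace o, ¬ M.Incident v F.1 → y F = 0) ∧
      (¬ M.Exterior o v → ∃ F F' : M.IntFace o, F ≠ F' ∧ M.Incident v F.1 ∧ M.Incident v F'.1 ∧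
        y F = 1 ∧ y F' = 1) :=
  (mk_mem_tropLine_iff hreg hconn).trans (onTropLine_negLog_iff hy)

theorem cellVec_mem_tropLine (d : G.Dart) {r : ℝ} (h0 : 0 ≤ r) (h1 : r ≤ 1) :
    TP.ofExp ⟨M.cellVec o d r, (isNormalized_cellVec hreg hconn h0 h1).exists_pos⟩ ∈
      tropLine κ M o d.fst := by
  rw [ofExp_mem_tropLine_iff hreg hconn (isNormalized_cellVec hreg hconn h0 h1)]
  refine ⟨fun F hF => cellVec_eq_zero hreg hF, fun hv => ?_⟩
  have hL : M.faceOf d ≠ o := fun h => hv (h ▸ M.incident_fst d)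
  have hR : M.faceOf d.symm ≠ o := fun h => hv (h ▸ M.incident_fst_symm d)
  refine ⟨⟨_, hL⟩, ⟨_, hR⟩, fun h => ?_, M.incident_fst d, M.incident_fst_symm d,
    cellVec_eq_one hreg hconn (Or.inl rfl), cellVec_eq_one hreg hconn (Or.inr rfl)⟩
  exact M.faceOf_ne_faceOf_symm hreg hconn d (congrArg Subtype.val h)

/-- Every point of the tropical line of `v` belongs to an admissible dart at `v`. -/
theorem exists_eq_cellVec {v : V} {y : M.IntFace o → ℝ} (hy : IsNormalized y)
    (hv : TP.ofExp ⟨y, hy.exists_pos⟩ ∈ tropLine κ M o v) :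
    ∃ (d : G.Dart) (r : ℝ), d.fst = v ∧ M.Admissible o d ∧ 0 ≤ r ∧ r ≤ 1 ∧
      y = M.cellVec o d r := by
  rw [ofExp_mem_tropLine_iff hreg hconn hy] at hv
  obtain ⟨h0, h2⟩ := hv
  -- the edge is chosen so that the coordinates of its two faces are `1` unless they are outer
  obtain ⟨d, rfl, had, hd⟩ : ∃ d : G.Dart, d.fst = v ∧ M.Admissible o d ∧
      ∀ F : M.IntFace o, F.1 = M.faceOf d ∨ F.1 = M.faceOf d.symm → y F = 1 := by
    by_cases hv : M.Exterior o v
    · obtain ⟨F, hF⟩ := hy.exists_eq_one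
      have hFv : M.Incident v F.1 := by
        by_contra h
        rw [h0 F h] at hF
        exact zero_ne_one hF
      obtain ⟨d, rfl, h⟩ := M.exists_dart_of_incident hreg hFv hv F.2
      refine ⟨d, rfl, fun _ => ?_, fun H hH => ?_⟩
      · rcases h with ⟨-, h⟩ | ⟨h, -⟩
        · exact h ▸ M.incident_snd_symm d
        · exact h ▸ M.incident_snd d
      · have : H = F := by
          rcases h with ⟨h1, h2⟩ | ⟨h1, h2⟩ <;> rcases hH with hH | hH
          · exact Subtype.ext (hH.trans h1)
          · exact absurd (hH.trans h2) H.2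
          · exact absurd (hH.trans h1) H.2
          · exact Subtype.ext (hH.trans h2)
        rw [this, hF]
    · obtain ⟨F, F', hne, hF, hF', h1, h1'⟩ := h2 hv
      obtain ⟨d, rfl, h⟩ := M.exists_dart_of_incident hreg hF hF' fun h => hne (Subtype.ext h)
      refine ⟨d, rfl, fun h => absurd h hv, fun H hH => ?_⟩
      have : H = F ∨ H = F' := by
        simp only [Subtype.ext_iff]
        rcases h with ⟨h1, h2⟩ | ⟨h1, h2⟩ <;> rw [h1, h2] at hH
        exacts [hH, hH.symm]
      rcases this with rfl | rfl <;> assumption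
  refine ⟨d, y ⟨_, had.thirdFace_ne_outer hreg hconn⟩, rfl, had, hy.nonneg _, hy.le_one _,
    funext fun H => ?_⟩
  by_cases hH : M.Incident d.fst H.1
  · rcases (incident_fst_iff hreg d _).1 hH with h | h | h
    · rw [hd H (Or.inl h), cellVec_eq_one hreg hconn (Or.inl h)]
    · rw [hd H (Or.inr h), cellVec_eq_one hreg hconn (Or.inr h)]
    · rw [cellVec_thirdFace h]
      congr 1
      exact Subtype.ext h
  · rw [h0 H hH, cellVec_eq_zero hreg hH]

theorem isNormalized_height {x : V → ℝ} (hx : x ∈ realization G) :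
    IsNormalized (M.height o x) := by
  obtain ⟨d, r, hd, h0, h1, rfl⟩ := exists_eq_cellPoint (o := o) hreg hx
  rw [height_cellPoint hreg hconn hd h0 h1]
  exact isNormalized_cellVec hreg hconn h0 h1

/-- The map from the geometric realization of the graph to tropical projective space. -/
noncomputable def toTP (x : realization G) : TP (M.IntFace o) :=
  TP.ofExp ⟨M.height o x.1, (isNormalized_height hreg hconn x.2).exists_pos⟩

theorem continuous_toTP : Continuous (toTP (M := M) (o := o) hreg hconn) :=
  TP.continuous_ofExp.comp
    (Continuous.subtype_mk ((M.continuous_height o).comp continuous_subtype_val) _)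

theorem toTP_injective : Function.Injective (toTP (M := M) (o := o) hreg hconn) := by
  rintro ⟨x, hx⟩ ⟨x', hx'⟩ h
  have heq := (isNormalized_height hreg hconn hx).eq_of_ofExp_eq
    (isNormalized_height hreg hconn hx') h
  obtain ⟨d, r, hd, h0, h1, rfl⟩ := exists_eq_cellPoint (o := o) hreg hx
  obtain ⟨d', r', hd', h0', h1', rfl⟩ := exists_eq_cellPoint (o := o) hreg hx'
  rw [height_cellPoint hreg hconn hd h0 h1, height_cellPoint hreg hconn hd' h0' h1'] at heq
  exact Subtype.ext (cellPoint_eq_of_cellVec_eq hreg hconn hd hd' h1 h1' heq)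

omit [DecidableRel G.Adj] [Fintype V] hreg hconn in
theorem cellPoint_mem_realization [Fintype V] {d : G.Dart} {r : ℝ} (h0 : 0 ≤ r) (h1 : r ≤ 1) :
    M.cellPoint o d r ∈ realization G := by
  have ha : 0 ≤ M.cellCoord o d r ∧ M.cellCoord o d r ≤ 1 := by
    unfold cellCoord
    split_ifs
    · exact ⟨h0, h1⟩
    · constructor <;> linarith
  refine ⟨⟨fun w => ?_, ?_⟩, d.fst, d.snd, Or.inr d.adj, fun w hw hw' => ?_⟩
  · refine add_nonneg ?_ ?_ <;> rw [Pi.single_apply] <;> split_ifs <;> simp [ha]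
  · simp [cellPoint, edgePoint, Finset.sum_add_distrib]
  · simp [cellPoint, edgePoint, hw, hw']

theorem range_toTP : Set.range (toTP (M := M) (o := o) hreg hconn) = tropSchon κ M o := by
  rw [tropSchon_eq_iUnion hreg hconn]
  apply Set.Subset.antisymm
  · rintro _ ⟨⟨x, hx⟩, rfl⟩
    obtain ⟨d, r, hd, h0, h1, rfl⟩ := exists_eq_cellPoint (o := o) hreg hx
    refine Set.mem_iUnion.2 ⟨d.fst, ?_⟩
    have := cellVec_mem_tropLine (o := o) (κ := κ) hreg hconn d h0 h1
    unfold toTP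
    simpa only [height_cellPoint hreg hconn hd h0 h1] using this
  · intro p hp
    obtain ⟨v, hv⟩ := Set.mem_iUnion.1 hp
    obtain ⟨y, hy, rfl⟩ := p.exists_isNormalized
    obtain ⟨d, r, -, hd, h0, h1, rfl⟩ := exists_eq_cellVec hreg hconn hy hv
    refine ⟨⟨M.cellPoint o d r, cellPoint_mem_realization h0 h1⟩, ?_⟩
    unfold toTP
    simp only [height_cellPoint hreg hconn hd h0 h1]

omit hconn in
theorem height_vertexPoint (hconn : ThreeConnected G) (v : V) (F : M.IntFace o)
    [Decidable (M.Incident v F.1)] :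
    M.height o (vertexPoint G v).1 F = if M.Incident v F.1 then 1 else 0 := by
  obtain ⟨d, rfl, hd⟩ := exists_admissible (o := o) hreg v
  have h : (vertexPoint G d.fst).1 = M.cellPoint o d 1 := (cellPoint_one d).symm
  rw [h, height_cellPoint hreg hconn hd zero_le_one le_rfl, cellVec_one hreg]

/-- A point with the normalized coordinates `y` is the image of the vertex `v` if these coordinates
are the indicator function of the faces at `v`. -/
theorem ofExp_eq_toTP_vertexPoint {v : V} {y : M.IntFace o → ℝ} (hy : IsNormalized y)
    (h1 : ∀ F : M.IntFace o, M.Incident v F.1 → y F = 1)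
    (h0 : ∀ F : M.IntFace o, ¬ M.Incident v F.1 → y F = 0) :
    TP.ofExp ⟨y, hy.exists_pos⟩ = toTP hreg hconn (vertexPoint G v) := by
  classical
  unfold toTP
  congr 2
  ext F
  rw [height_vertexPoint hreg hconn]
  split_ifs with h
  exacts [h1 F h, h0 F h]

theorem toTP_vertexPoint_mem_tropLine_iff {v u : V} :
    toTP (M := M) (o := o) hreg hconn (vertexPoint G v) ∈ tropLine κ M o u ↔
      (∀ F : M.IntFace o, ¬ M.Incident u F.1 → ¬ M.Incident v F.1) ∧
      (¬ M.Exterior o u → ∃ F F' : M.IntFace o, F ≠ F' ∧ M.Incident u F.1 ∧ M.Incident u F'.1 ∧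
        M.Incident v F.1 ∧ M.Incident v F'.1) := by
  classical
  unfold toTP
  rw [ofExp_mem_tropLine_iff hreg hconn (isNormalized_height hreg hconn (vertexPoint G v).2)]
  simp only [height_vertexPoint hreg hconn, ite_eq_left_iff, ite_eq_right_iff, one_ne_zero,
    zero_ne_one, imp_false, not_not]

theorem toTP_vertexPoint_mem_tropLine (v : V) :
    toTP (M := M) (o := o) hreg hconn (vertexPoint G v) ∈ tropLine κ M o v := by
  rw [toTP_vertexPoint_mem_tropLine_iff]
  refine ⟨fun F h => h, fun hv => ?_⟩
  obtain ⟨F, F', K, hne, -, -, h⟩ := exists_intFace hreg hconn hv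
  exact ⟨F, F', hne, (h F).2 (by simp), (h F').2 (by simp), (h F).2 (by simp), (h F').2 (by simp)⟩

/-- An interior vertex is mapped to the branch point of its tropical line. -/
theorem isBranchPoint {v : V} (hv : ¬ M.Exterior o v) :
    IsBranchPoint κ M o v (toTP hreg hconn (vertexPoint G v)) := by
  classical
  obtain ⟨K₁, K₂, K₃, h12, h13, h23, hK⟩ := exists_intFace hreg hconn hv
  apply Set.Subset.antisymm
  · intro p hp
    obtain ⟨y, hy, rfl⟩ := p.exists_isNormalized
    have hline := (hp K₁ K₂ h12 ((hK _).2 (by simp)) ((hK _).2 (by simp))).1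
    rw [ofExp_mem_tropLine_iff hreg hconn hy] at hline
    have hone : ∀ F F' : M.IntFace o, F ≠ F' → M.Incident v F.1 → M.Incident v F'.1 →
        y F = 1 := by
      intro F F' hne hF hF'
      have hmin := ((hp F F' hne hF hF').2 _ rfl).2
      obtain ⟨H, hH⟩ := hy.exists_eq_one
      exact le_antisymm (hy.le_one F)
        (hH ▸ (negLog_le_negLog_iff (hy.nonneg F) (hy.nonneg H)).1 (hmin H))
    refine ofExp_eq_toTP_vertexPoint hreg hconn hy (fun F hF => ?_) hline.1
    by_cases h : F = K₁
    · exact hone F K₂ (h ▸ h12) hF ((hK _).2 (by simp))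
    · exact hone F K₁ h hF ((hK _).2 (by simp))
  · rintro _ rfl F F' - hF hF'
    refine ⟨toTP_vertexPoint_mem_tropLine hreg hconn v, fun w hw => ?_⟩
    obtain ⟨c, hc⟩ := TP.mk_eq_mk_iff.1 hw.symm
    replace hc : ∀ K, w.1 K = negLog (M.height o (vertexPoint G v).1 K) + (c : WithTop ℝ) := hc
    have hx := isNormalized_height (o := o) hreg hconn (vertexPoint G v).2
    have hFv := height_vertexPoint (o := o) hreg hconn v F
    have hFv' := height_vertexPoint (o := o) hreg hconn v F'
    rw [if_pos hF] at hFv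
    rw [if_pos hF'] at hFv'
    refine ⟨by rw [hc, hc, hFv, hFv'], fun H => ?_⟩
    rw [hc, hc]
    gcongr
    rw [negLog_le_negLog_iff (hx.nonneg F) (hx.nonneg H), hFv]
    exact hx.le_one H

omit hconn in
theorem exists_dart_thirdFace_eq {v : V} (hv : M.Exterior o v) :
    ∃ d : G.Dart, d.fst = v ∧ M.thirdFace d = o := by
  obtain ⟨d, rfl, rfl⟩ := hv
  refine ⟨M.rot d, M.rot_fst d, ?_⟩
  rw [thirdFace, M.rot_rot_rot hreg]

/-- An exterior vertex has a unique interior neighbour, and is mapped to the common point of the two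
tropical lines. -/
theorem exists_interior_neighbor {v : V} (hv : M.Exterior o v) :
    ∃ u, (G.Adj v u ∧ ¬ M.Exterior o u) ∧ (∀ u', G.Adj v u' → ¬ M.Exterior o u' → u' = u) ∧
      tropLine κ M o v ∩ tropLine κ M o u = {toTP hreg hconn (vertexPoint G v)} := by
  obtain ⟨d, rfl, hd⟩ := exists_dart_thirdFace_eq hreg hv
  have hL : M.faceOf d ≠ o := hd ▸ (thirdFace_ne hreg hconn d).symm
  have hR : M.faceOf d.symm ≠ o := hd ▸ (thirdFace_ne_symm hreg hconn d).symm
  have hne := M.faceOf_ne_faceOf_symm hreg hconn d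
  have hu : ¬ M.Exterior o d.snd := fun h =>
    (M.outer_of_exterior hreg hconn d hv h).elim (fun h => hL h.symm) (fun h => hR h.symm)
  have hinc : ∀ F : M.IntFace o, M.Incident d.fst F.1 ↔
      F.1 = M.faceOf d ∨ F.1 = M.faceOf d.symm := by
    intro F
    rw [incident_fst_iff hreg, hd]
    have := F.2
    tauto
  refine ⟨d.snd, ⟨d.adj, hu⟩, fun u' hadj hu' => ?_, ?_⟩
  · rcases M.eq_rot_of_fst_eq hreg (d := d) (d' := ⟨(d.fst, u'), hadj⟩) rfl with h | h | h
    · exact congrArg (fun e : G.Dart => e.snd) h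
    · -- the outer face is on the other side of the next dart
      exfalso
      apply hu'
      have h1 : M.faceOf (M.rot d).symm = o := by rw [M.faceOf_symm]; exact hd
      have h2 := M.incident_snd_symm (M.rot d)
      rw [h1, ← h] at h2
      exact h2
    · exfalso
      apply hu'
      have h2 := M.incident_snd (M.rot (M.rot d))
      rw [show M.faceOf (M.rot (M.rot d)) = o from hd, ← h] at h2
      exact h2
  · apply Set.Subset.antisymm
    · rintro p ⟨hp, hp'⟩
      obtain ⟨y, hy, rfl⟩ := p.exists_isNormalized
      rw [ofExp_mem_tropLine_iff hreg hconn hy] at hp hp'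
      obtain ⟨F, F', hFF, -, -, h1, h1'⟩ := hp'.2 hu
      have hmem : ∀ H : M.IntFace o, y H = 1 → H.1 = M.faceOf d ∨ H.1 = M.faceOf d.symm := by
        intro H hH
        rw [← hinc]
        by_contra h
        rw [hp.1 H h] at hH
        exact zero_ne_one hH
      refine ofExp_eq_toTP_vertexPoint hreg hconn hy (fun H hH => ?_) hp.1
      rw [hinc] at hH
      have hFF' : F.1 ≠ F'.1 := fun h => hFF (Subtype.ext h)
      have : H = F ∨ H = F' := by
        simp only [Subtype.ext_iff]
        rcases hmem F h1 with a | a <;> rcases hmem F' h1' with b | b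
        · exact absurd (a.trans b.symm) hFF'
        · rwa [a, b]
        · rw [a, b]; exact hH.symm
        · exact absurd (a.trans b.symm) hFF'
      rcases this with rfl | rfl <;> assumption
    · rintro _ rfl
      refine ⟨toTP_vertexPoint_mem_tropLine hreg hconn _, ?_⟩
      rw [toTP_vertexPoint_mem_tropLine_iff]
      refine ⟨fun F hF hF' => hF ?_, fun _ => ⟨⟨_, hL⟩, ⟨_, hR⟩,
        fun h => hne (congrArg Subtype.val h), M.incident_snd d, M.incident_snd_symm d,
        M.incident_fst d, M.incident_fst_symm d⟩⟩
      rcases (hinc F).1 hF' with h | h <;> rw [h]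
      exacts [M.incident_snd d, M.incident_snd_symm d]

/-- The tropical lines of different vertices are different: the point of a vertex on its tropical
line shows its interior faces. -/
theorem tropLine_injective : Function.Injective (tropLine κ M o) := by
  have key : ∀ v u, tropLine κ M o v = tropLine κ M o u → ∀ F : M.IntFace o,
      M.Incident v F.1 → M.Incident u F.1 := by
    intro v u h F hF
    by_contra hu
    have := (toTP_vertexPoint_mem_tropLine_iff (κ := κ) (o := o) hreg hconn (v := v) (u := u)).1
      (h ▸ toTP_vertexPoint_mem_tropLine hreg hconn v)
    exact this.1 F hu hF
  exact fun v u h => eq_of_forall_ne_outer hreg hconn fun F hF =>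
    ⟨key v u h ⟨F, hF⟩, key u v h.symm ⟨F, hF⟩⟩

end PlanarEmbedding

section Realization

variable {V : Type*} [Fintype V] {G : SimpleGraph V}

theorem isCompact_realization : IsCompact (realization G) := by
  have h : realization G = stdSimplex ℝ V ∩ ⋃ p ∈ {p : V × V | p.1 = p.2 ∨ G.Adj p.1 p.2},
      {x : V → ℝ | ∀ w, w ≠ p.1 → w ≠ p.2 → x w = 0} := by
    ext x
    simp only [realization, Set.mem_inter_iff, Set.mem_ofPred_eq, Set.mem_iUnion, Prod.exists,
      exists_prop]
  rw [h]
  refine (isCompact_stdSimplex (𝕜 := ℝ) V).inter_right (Set.Finite.isClosed_biUnion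
    (Set.toFinite _) fun p _ => ?_)
  simp only [Set.ofPred_forall]
  exact isClosed_iInter fun w => isClosed_iInter fun _ => isClosed_iInter fun _ =>
    isClosed_singleton.preimage (continuous_apply w)

/-- The modification of a graph to which no trees are attached. -/
def trivialModification (G : SimpleGraph V) : Modification G where
  num := 0
  size := Fin.elim0
  tree := fun i => i.elim0
  isTree := fun i => i.elim0
  base := fun i => i.elim0
  root := fun i => i.elim0

/-- A continuous injective map from the geometric realization of a graph to a Hausdorff space is a
homeomorphism of the trivial modification with its image. -/
theorem exists_homeomorph_trivialModification [DecidableEq V] {Y : Type*}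
    [TopologicalSpace Y] [T2Space Y] {f : realization G → Y} (hf : Continuous f)
    (hinj : Function.Injective f) {S : Set Y} (hS : Set.range f = S) :
    ∃ h : (trivialModification G).Space ≃ₜ S, ∀ v, (h ((trivialModification G).vertex v) : Y) =
      f (vertexPoint G v) := by
  subst hS
  have hcompact : CompactSpace (realization G) :=
    isCompact_iff_compactSpace.1 isCompact_realization
  have hempty : IsEmpty (Σ i, realization ((trivialModification G).tree i)) :=
    ⟨fun x => Fin.elim0 x.1⟩
  let g : (trivialModification G).Space → Set.range f :=
    Quot.lift (Sum.elim (Set.rangeFactorization f) hempty.elim) (by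
      rintro _ _ ⟨i⟩
      exact Fin.elim0 i)
  have hg : Continuous g := continuous_quot_lift _
    ((hf.subtype_mk _).sumElim (continuous_of_const fun x => hempty.elim x))
  have hbij : Function.Bijective g := by
    constructor
    · rintro ⟨x | x⟩ ⟨y | y⟩ h
      · have : x = y := hinj (congrArg Subtype.val h)
        rw [this]
      · exact hempty.elim y
      · exact hempty.elim x
      · exact hempty.elim x
    · rintro ⟨_, x, rfl⟩
      exact ⟨Quot.mk _ (Sum.inl x), rfl⟩
  have : CompactSpace (trivialModification G).Space := Quot.compactSpace
  exact ⟨Continuous.homeoOfEquivCompactToT2 (f := Equiv.ofBijective g hbij) hg, fun v => rfl⟩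

end Realization

section Main

variable {V : Type*} [Fintype V] [DecidableEq V] {G : SimpleGraph V} [DecidableRel G.Adj]
  {M : PlanarEmbedding G} {o : M.Face} {κ : Type*} [Field κ]
  (hreg : G.IsRegularOfDegree 3) (hconn : ThreeConnected G)

open PlanarEmbedding

omit [DecidableEq V] in
theorem card_intFace (M : PlanarEmbedding G) (o : M.Face) : Nat.card (M.IntFace o) = genus G := by
  have h1 := M.euler_card
  have h2 : Nat.card (M.IntFace o) = Fintype.card M.Face - 1 := by
    rw [Nat.card_eq_fintype_card, Fintype.card_subtype_compl, Fintype.card_subtype_eq]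
  rw [genus, h2, Nat.card_eq_fintype_card, Nat.card_eq_fintype_card]
  omega

omit [DecidableEq V] in
include hreg in
theorem two_mul_genus_sub_two : 2 * genus G - 2 = Fintype.card V := by
  have h := G.sum_degrees_eq_twice_card_edges
  simp only [hreg.degree_eq, Finset.sum_const, Finset.card_univ, smul_eq_mul] at h
  have h' : G.edgeFinset.card = Fintype.card G.edgeSet := G.edgeFinset_card
  rw [h'] at h
  rw [genus, Nat.card_eq_fintype_card, Nat.card_eq_fintype_card]
  omega

include hreg hconn

theorem isTropicalGraphCurve_tropSchon [Infinite κ] :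
    IsTropicalGraphCurve κ G (tropSchon κ M o) := by
  obtain ⟨h, -⟩ := exists_homeomorph_trivialModification (continuous_toTP hreg hconn)
    (toTP_injective hreg hconn) (range_toTP (M := M) (o := o) (κ := κ) hreg hconn)
  refine ⟨card_intFace M o, ?_, trivialModification G, ⟨h⟩⟩
  let e : Fin (2 * genus G - 2) ≃ V :=
    (finCongr (two_mul_genus_sub_two hreg)).trans (Fintype.equivFin V).symm
  refine ⟨fun i => tropLine κ M o (e i), (tropLine_injective hreg hconn).comp e.injective,
    fun i => isTropicalLine_tropLine hreg hconn _, ?_⟩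
  rw [tropSchon_eq_iUnion hreg hconn]
  exact (e.surjective.iUnion_comp (tropLine κ M o)).symm

theorem isWellStructured : IsWellStructured κ M o := by
  obtain ⟨h, hh⟩ := exists_homeomorph_trivialModification (continuous_toTP hreg hconn)
    (toTP_injective hreg hconn) (range_toTP (M := M) (o := o) (κ := κ) hreg hconn)
  refine ⟨trivialModification G, h, fun v hv => ?_, fun v hv => ?_⟩
  · rw [hh]
    exact isBranchPoint hreg hconn hv
  · rw [hh]
    exact exists_interior_neighbor hreg hconn hv

end Main

end TropGraph

theorem theorem3p16 {V : Type*} [Fintype V] [DecidableEq V] (G : SimpleGraph V)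
    [DecidableRel G.Adj] (hreg : G.IsRegularOfDegree 3) (hconn : TropGraph.ThreeConnected G)
    (κ : Type*) [Field κ] [IsAlgClosed κ]
    (M : TropGraph.PlanarEmbedding G) (o : M.Face) :
    -- the schön arrangement is the image of a canonical embedding of the graph curve
    (∀ X : TropGraph.GraphCurve κ G,
      ∃ b : Module.Basis (M.IntFace o) κ X.canonicalSections,
        X.IsCanonicalEmbedding b ∧
        (∀ v, X.componentIdeal b v = TropGraph.lineIdeal κ M o v) ∧
        X.imageIdeal b = TropGraph.schonIdeal κ M o) ∧
    -- its tropicalization is the union of the distinct tropical lines of the vertices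
    (∀ v, TropGraph.IsTropicalLine κ (TropGraph.tropLine κ M o v)) ∧
    Function.Injective (TropGraph.tropLine κ M o) ∧
    TropGraph.tropSchon κ M o = (⋃ v, TropGraph.tropLine κ M o v) ∧
    -- it is a tropical graph curve of `G`, in particular homeomorphic to a modification of `G`
    TropGraph.IsTropicalGraphCurve κ G (TropGraph.tropSchon κ M o) ∧
    -- and it is well structured
    TropGraph.IsWellStructured κ M o ∧
    -- existence theorem
    (∃ S : Set (TropGraph.TP (Fin (TropGraph.genus G))), TropGraph.IsTropicalGraphCurve κ G S) ∧
    -- realizability theorem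
    (∀ X : TropGraph.GraphCurve κ G,
      ∃ b : Module.Basis (Fin (TropGraph.genus G)) κ X.canonicalSections,
        X.IsCanonicalEmbedding b ∧ X.IsWeaklyFaithful b) := by
  have hinf : Infinite κ := IsAlgClosed.instInfinite
  have hcurve := TropGraph.isTropicalGraphCurve_tropSchon (M := M) (o := o) (κ := κ) hreg hconn
  let e : M.IntFace o ≃ Fin (TropGraph.genus G) :=
    Finite.equivFinOfCardEq (TropGraph.card_intFace M o)
  refine ⟨fun X => ?_, TropGraph.PlanarEmbedding.isTropicalLine_tropLine hreg hconn,
    TropGraph.PlanarEmbedding.tropLine_injective hreg hconn,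
    TropGraph.tropSchon_eq_iUnion hreg hconn, hcurve, TropGraph.isWellStructured hreg hconn,
    ⟨_, hcurve.rename e⟩, fun X => ?_⟩
  · obtain ⟨b, hb⟩ := TropGraph.GraphCurve.exists_basis X M o hreg hconn
    exact ⟨b, TropGraph.GraphCurve.isCanonicalEmbedding hreg hconn hb,
      TropGraph.GraphCurve.componentIdeal_eq hreg hconn hb,
      TropGraph.GraphCurve.imageIdeal_eq hreg hconn hb⟩
  · obtain ⟨b, hb⟩ := TropGraph.GraphCurve.exists_basis X M o hreg hconn
    refine ⟨b.reindex e, (TropGraph.GraphCurve.isCanonicalEmbedding hreg hconn hb).reindex e, ?_⟩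
    rw [TropGraph.GraphCurve.IsWeaklyFaithful, TropGraph.GraphCurve.tropProj_imageIdeal_reindex,
      TropGraph.GraphCurve.imageIdeal_eq hreg hconn hb]
    exact hcurve.rename e
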